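/- Let $n\in\mathbb N$. A function $f:\mathbb R^n\to[0,\infty)$ is log-concave if $f=e^{-\psi}$ with $\psi:\mathbb R^n\to\mathbb R\cup\{\infty\}$ convex. Let $LC$ be the set of all log-concave $f:\mathbb R^n\to[0,\infty)$ that are upper semicontinuous, integrable and non-degenerate, i.e. $\operatorname{int}\{f>0\}\neq\emptyset$. For a nonsingular affine map $A$ of $\mathbb R^n$ put $(Af)(x)=f(Ax)$. A map $p:LC\to\mathbb R^n$ is an *affine contravariant point* if $p(f_m)\to p(f)$ whenever $f_m,f\in LC$ and $\|f_m-f\|_{1}\to0$, and $p(Af)=A^{-1}(p(f))$ for all $f\in LC$ and all nonsingular affine maps $A$. For $f\in LC$ let $$g(f)=\frac{\int x f(x)\,dx}{\int f(x)\,dx}$$ be the centroid of $f$, and let the Santaló point $s(f)$ be the unique minimizer of $z\mapsto\int f^z(y)\,dy\in[0,\infty]$, where $f^z(y)=\inf_{x:\,f(x)>0}e^{-\langle x-z,\,y-z\rangle}/f(x)$. For $f=e^{-\psi}\in LC$ define three operators, where $B_2^n$ is the closed Euclidean unit ball, $\operatorname{epi}(\psi)=\{(x,y)\in\mathbb R^n\times\mathbb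 R:\ y\ge\psi(x)\}$, and $|\det A|$ denotes the absolute value of the determinant of the linear part of an affine map $A$. * Floating operator, for $\delta\ge0$: $F_\delta f=e^{-\psi_\delta}$, where $\psi_\delta$ is the function with $$\operatorname{epi}(\psi_\delta)=\bigcap\Big\{H^+:\ \operatorname{vol}_{n+1}\big(H^-\cap\operatorname{epi}(\psi)\big)\le\delta\int_{\mathbb R^n}f\,dx\Big\},$$ $H^+$ and $H^-$ being the two closed half-spaces bounded by a hyperplane $H$ of $\mathbb R^{n+1}$ (in either order). * Löwner operator: $(Lf)(x)=e^{-\|A_0x\|+t_0}$, where $(A_0,t_0)$ minimizes $\int_{\mathbb R^n}e^{-\|Ax\|+t}\,dx$ over all nonsingular affine maps $A$ and all $t\in\mathbb R$ such that $\|Ax\|-t\le\psi(x)$ for all $x$. * John operator: $Jf=t_0\mathbf 1_{A_0B_2^n}$, where $(A_0,t_0)$ maximizes $t\,|\det A|$ over all nonsingular affine maps $A$ and all $t\in\mathbb R$ such that $t\le\|f\|_\infty$ and $t\,\mathbf 1_{AB_2^n}\le f$. Then $g$ and $s$ are well defined on $LC$, the functions $F_\delta f$, $Lf$ and $Jf$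 exist, are uniquely determined by $f\in LC$ and belong to $LC$, and for every $P\in\{F_\delta:\delta\ge0\}\cup\{L,J\}$ and every $\lambda\in\mathbb R$ the maps $$f\mapsto g(Pf),\qquad f\mapsto s(Pf),\qquad f\mapsto\lambda\,g(Pf)+(1-\lambda)\,s(Pf)$$ are affine contravariant points. -/

import Mathlib

open MeasureTheory Filter Topology
open scoped NNReal ENNReal RealInnerProductSpace

noncomputable section

namespace LogConcave

/-- Euclidean space `ℝⁿ`. -/
abbrev E (n : ℕ) : Type := EuclideanSpace ℝ (Fin n)

/-- The epigraph, in `ℝⁿ × ℝ`, of an extended real valued function. -/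
def epi {n : ℕ} (ψ : E n → EReal) : Set (E n × ℝ) :=
  {p | ψ p.1 ≤ (p.2 : EReal)}

/-- For a nonnegative `f`, the function `ψ = -log f` with values in `ℝ ∪ {∞}`; it is the only `ψ`
with `f = exp (-ψ)`, and `ψ x = ∞` exactly where `f x = 0`. -/
def potential {n : ℕ} (f : E n → ℝ) (x : E n) : EReal :=
  -ENNReal.log (ENNReal.ofReal (f x))

/-- `f` is a non-degenerate, upper semicontinuous, integrable, log-concave function. -/
structure IsLC {n : ℕ} (f : E n → ℝ) : Prop where
  nonneg : ∀ x, 0 ≤ f x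
  convex : Convex ℝ (epi (potential f))
  upperSemicontinuous : UpperSemicontinuous f
  integrable : Integrable f
  nondegenerate : (interior (Function.support f)).Nonempty

/-- The class `LC` on `ℝⁿ`. -/
def LC (n : ℕ) : Set (E n → ℝ) := {f | IsLC f}

theorem IsLC.comp_affine {n : ℕ} {f : E n → ℝ} (hf : IsLC f) (A : E n ≃ᵃ[ℝ] E n) :
    IsLC (fun x => f (A x)) where
  nonneg x := hf.nonneg (A x)
  convex := by
    have h := hf.convex.affine_preimage
      ((A : E n →ᵃ[ℝ] E n).prodMap (AffineMap.id ℝ ℝ))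
    exact h
  upperSemicontinuous :=
    hf.upperSemicontinuous.comp (A : E n →ᵃ[ℝ] E n).continuous_of_finiteDimensional
  integrable := by
    have hdet : LinearMap.det (A.linear : E n →ₗ[ℝ] E n) ≠ 0 := A.linear.isUnit_det'.ne_zero
    have h1 : Integrable (fun y => f (y + A 0)) := hf.integrable.comp_add_right (A 0)
    have hm := Measure.map_linearMap_addHaar_eq_smul_addHaar (volume : Measure (E n)) hdet
    have hemb : MeasurableEmbedding (A.linear : E n →ₗ[ℝ] E n) :=
      A.linear.toContinuousLinearEquiv.toHomeomorph.measurableEmbedding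
    have h2 : Integrable (fun y => f (y + A 0))
        (Measure.map (A.linear : E n →ₗ[ℝ] E n) volume) := by
      rw [hm]
      exact h1.smul_measure ENNReal.ofReal_ne_top
    have h3 := (hemb.integrable_map_iff).1 h2
    refine h3.congr (Eventually.of_forall fun x => ?_)
    have hx : A x = A.linear x + A 0 := by
      have := A.map_vadd 0 x
      simpa using this
    simp [hx]
  nondegenerate := by
    obtain ⟨x, hx⟩ := hf.nondegenerate
    have hc : Continuous A := (A : E n →ᵃ[ℝ] E n).continuous_of_finiteDimensional
    refine ⟨A.symm x, mem_interior.2 ⟨A ⁻¹' interior (Function.support f), ?_, ?_, ?_⟩⟩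
    · intro y hy
      exact interior_subset (s := Function.support f) hy
    · exact isOpen_interior.preimage hc
    · simpa using hx

/-- The action `(A f)(x) = f (A x)` of a nonsingular affine map on `LC`. -/
def affineAct {n : ℕ} (A : E n ≃ᵃ[ℝ] E n) (f : LC n) : LC n :=
  ⟨fun x => f.1 (A x), IsLC.comp_affine f.2 A⟩

/-- Convergence of a sequence in `LC` in the `L₁`-norm. -/
def L1Tendsto {n : ℕ} (F : ℕ → LC n) (f : LC n) : Prop :=
  Tendsto (fun m => ∫ x, |(F m).1 x - f.1 x|) atTop (𝓝 0)

/-- Affine contravariant points on `LC`. -/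
structure IsAffineContravariantPoint {n : ℕ} (p : LC n → E n) : Prop where
  continuous : ∀ (F : ℕ → LC n) (f : LC n), L1Tendsto F f →
    Tendsto (fun m => p (F m)) atTop (𝓝 (p f))
  contravariant : ∀ (A : E n ≃ᵃ[ℝ] E n) (f : LC n), p (affineAct A f) = A.symm (p f)

/-- The centroid of a function. -/
def centroid {n : ℕ} (f : E n → ℝ) : E n := (∫ x, f x)⁻¹ • ∫ x, f x • x

/-- The polar function `f^z` of `f` with respect to `z`; the infimum is over all `x` with
`f x ≠ 0`. -/
def polar {n : ℕ} (f : E n → ℝ) (z y : E n) : ℝ :=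
  ⨅ x : Function.support f, Real.exp (-⟪x.1 - z, y - z⟫) / f x.1

/-- `z` minimizes `w ↦ ∫ f^w`, an integral with values in `[0, ∞]`. -/
def IsSantaloPoint {n : ℕ} (f : E n → ℝ) (z : E n) : Prop :=
  ∀ w : E n, ∫⁻ y, ENNReal.ofReal (polar f z y) ≤ ∫⁻ y, ENNReal.ofReal (polar f w y)

/-- The half-space `H⁻` of `ℝⁿ × ℝ` with normal vector `(u, c)` and offset `β`. -/
def halfMinus {n : ℕ} (u : E n) (c β : ℝ) : Set (E n × ℝ) :=
  {p | ⟪u, p.1⟫ + c * p.2 ≤ β}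

/-- The complementary closed half-space `H⁺`. -/
def halfPlus {n : ℕ} (u : E n) (c β : ℝ) : Set (E n × ℝ) :=
  {p | β ≤ ⟪u, p.1⟫ + c * p.2}

/-- The intersection of all closed half-spaces `H⁺` of `ℝⁿ × ℝ` for which the opposite half-space
`H⁻` cuts off from `C` a set of volume at most `v`. -/
def floatingSet {n : ℕ} (C : Set (E n × ℝ)) (v : ℝ≥0∞) : Set (E n × ℝ) :=
  {p | ∀ (u : E n) (c β : ℝ), (u, c) ≠ 0 → volume (halfMinus u c β ∩ C) ≤ v →
    p ∈ halfPlus u c β}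

/-- `h` is the floating function `f_δ = exp (-ψ_δ)` of `f = exp (-ψ)`, where the epigraph of `ψ_δ`
is the floating set of the epigraph of `ψ` at level `δ ∫ f`. -/
def IsFloatingFunction {n : ℕ} (δ : ℝ≥0) (f h : E n → ℝ) : Prop :=
  ∃ ψδ : E n → EReal,
    epi ψδ = floatingSet (epi (potential f)) (ENNReal.ofReal ((δ : ℝ) * ∫ x, f x)) ∧
    h = fun x => (EReal.exp (-ψδ x)).toReal

/-- The constraint `‖A x‖ - t ≤ ψ x` of the Löwner problem of `f = exp (-ψ)`. -/
def LownerFeasible {n : ℕ} (f : E n → ℝ) (A : E n ≃ᵃ[ℝ] E n) (t : ℝ) : Prop :=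
  ∀ x, ((‖A x‖ - t : ℝ) : EReal) ≤ potential f x

/-- `h = exp (-‖A x‖ + t)` for a solution `(A, t)` of the Löwner minimization problem of `f`. -/
def IsLownerFunction {n : ℕ} (f h : E n → ℝ) : Prop :=
  ∃ (A : E n ≃ᵃ[ℝ] E n) (t : ℝ), LownerFeasible f A t ∧
    (∀ (B : E n ≃ᵃ[ℝ] E n) (r : ℝ), LownerFeasible f B r →
      ∫ x, Real.exp (-‖A x‖ + t) ≤ ∫ x, Real.exp (-‖B x‖ + r)) ∧
    h = fun x => Real.exp (-‖A x‖ + t)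

/-- The function `t 1_{A B}` where `B` is the closed Euclidean unit ball. -/
def ellipsoidFunction {n : ℕ} (A : E n ≃ᵃ[ℝ] E n) (t : ℝ) : E n → ℝ :=
  (A '' Metric.closedBall (0 : E n) 1).indicator (fun _ => t)

/-- The constraints `t ≤ ‖f‖_∞` and `t 1_{A B} ≤ f` of the John problem of `f`. -/
def JohnFeasible {n : ℕ} (f : E n → ℝ) (A : E n ≃ᵃ[ℝ] E n) (t : ℝ) : Prop :=
  ENNReal.ofReal t ≤ eLpNorm f ∞ volume ∧ ∀ x, ellipsoidFunction A t x ≤ f x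

/-- `h = t 1_{A B}` for a solution `(A, t)` of the John maximization problem of `f`. -/
def IsJohnFunction {n : ℕ} (f h : E n → ℝ) : Prop :=
  ∃ (A : E n ≃ᵃ[ℝ] E n) (t : ℝ), JohnFeasible f A t ∧
    (∀ (B : E n ≃ᵃ[ℝ] E n) (r : ℝ), JohnFeasible f B r →
      r * |LinearMap.det (B.linear : E n →ₗ[ℝ] E n)| ≤
        t * |LinearMap.det (A.linear : E n →ₗ[ℝ] E n)|) ∧
    h = ellipsoidFunction A t

end LogConcave

end

/-! The centroid, the Santaló point and all three operators commute with affine changes of variable,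
so the work lies in well-definedness and continuity. Convergence in the `L₁`-norm gives an almost
everywhere convergent subsequence, and `tendsto_of_exists_subseq` reduces continuity of a point to
finding good subsequences of almost everywhere convergent sequences. For log-concave functions with
a limit in the class, such convergence improves by itself. Lower bounds become locally uniform in
the interior of the support (`AEConv.eventually_lt`), upper bounds locally uniform everywhere
(`AEConv.eventually_gt`), and a global bound by the exponential of a cone, if it holds for the limit
with a margin of linear growth, holds for the tail of the sequence (`AEConv.eventually_le_exp`). In
particular exponential decay is uniform along the tail, and the centroid converges by dominated
convergence.

For the Santaló point, a translation turns `∫ f^z` into `santaloInt`, the integral of an exponential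
tilt of the single function `conj f`. Polarity preserves almost everywhere convergence
(`AEConv.conj`), and the functional is coercive with constants depending only on the decay of `f`.
Fatou's lemma then gives existence and subsequential convergence of minimizers, and strict convexity
of the exponential gives uniqueness.

The floating potential is the supremum of the affine functions that cut off caps of volume at most
`v`. Upward and vertical half-spaces contribute nothing more (`IsLC.floatingSet_eq`), and
compactness of these affine functions yields `AEConv.floatFun`.

The Löwner and John problems maximize a height factor times a determinant over a finite-dimensional
parameter space. An abstract scheme (`CompactFeasible`, `RecoverFeasible`) provides maximizers and
their stability. In `lowner_unique` and `john_unique`, a midpoint construction, made after composing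
with a suitable isometry, shows that the linear parts of two solutions agree up to that isometry; if
their centres differed, the value could be improved. -/

namespace LogConcave

/-! ### Log-concave functions: regularity, boundedness and exponential decay -/

/-- The multiplicative form of convexity of the potential. -/
def LogIneq {n : ℕ} (f : E n → ℝ) : Prop :=
  ∀ (x y : E n) (s t a b : ℝ), 0 ≤ a → 0 ≤ b → a + b = 1 →
    Real.exp s ≤ f x → Real.exp t ≤ f y → Real.exp (a * s + b * t) ≤ f (a • x + b • y)

theorem potential_eq {n : ℕ} (f : E n → ℝ) (x : E n) :
    potential f x = if f x ≤ 0 then ⊤ else ((-Real.log (f x) : ℝ) : EReal) := by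
  unfold potential
  rw [ENNReal.log_ofReal]
  split_ifs <;> simp

theorem potential_le_coe_iff {n : ℕ} {f : E n → ℝ} {x : E n} {y : ℝ} :
    potential f x ≤ (y : EReal) ↔ Real.exp (-y) ≤ f x := by
  rw [potential_eq]
  split_ifs with h
  · simp only [top_le_iff, EReal.coe_ne_top, false_iff, not_le]
    exact h.trans_lt (Real.exp_pos _)
  · rw [EReal.coe_le_coe_iff, ← Real.le_log_iff_exp_le (not_le.1 h)]
    constructor <;> intro h <;> linarith

theorem coe_le_potential_iff {n : ℕ} {f : E n → ℝ} {x : E n} {y : ℝ} :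
    (y : EReal) ≤ potential f x ↔ f x ≤ Real.exp (-y) := by
  rw [potential_eq]
  split_ifs with h
  · simp only [le_top, true_iff]
    exact h.trans (Real.exp_pos _).le
  · rw [EReal.coe_le_coe_iff, ← Real.log_le_iff_le_exp (not_le.1 h)]
    constructor <;> intro h <;> linarith

theorem mem_epi_potential {n : ℕ} {f : E n → ℝ} {p : E n × ℝ} :
    p ∈ epi (potential f) ↔ Real.exp (-p.2) ≤ f p.1 :=
  potential_le_coe_iff

theorem convex_epi_iff {n : ℕ} {f : E n → ℝ} :
    Convex ℝ (epi (potential f)) ↔ LogIneq f := by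
  constructor
  · intro h x y s t a b ha hb hab hs ht
    have h1 : (x, -s) ∈ epi (potential f) := by simpa [mem_epi_potential] using hs
    have h2 : (y, -t) ∈ epi (potential f) := by simpa [mem_epi_potential] using ht
    have h3 := h h1 h2 ha hb hab
    rw [mem_epi_potential] at h3
    simpa [add_comm] using h3
  · rintro h ⟨x, s⟩ h1 ⟨y, t⟩ h2 a b ha hb hab
    rw [mem_epi_potential] at *
    have := h x y (-s) (-t) a b ha hb hab h1 h2
    simpa [add_comm] using this

theorem IsLC.logIneq {n : ℕ} {f : E n → ℝ} (hf : IsLC f) : LogIneq f :=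
  convex_epi_iff.1 hf.convex

theorem IsLC.measurable {n : ℕ} {f : E n → ℝ} (hf : IsLC f) : Measurable f :=
  hf.upperSemicontinuous.measurable

theorem IsLC.mem_support {n : ℕ} {f : E n → ℝ} (hf : IsLC f) {x : E n} :
    x ∈ Function.support f ↔ 0 < f x :=
  ⟨fun h => lt_of_le_of_ne (hf.nonneg x) (Ne.symm h), fun h => h.ne'⟩

/-- The inequality in terms of logarithms. -/
theorem LogIneq.exp_log {n : ℕ} {f : E n → ℝ} (hf : LogIneq f) {x y : E n} (hx : 0 < f x)
    (hy : 0 < f y) {a b : ℝ} (ha : 0 ≤ a) (hb : 0 ≤ b) (hab : a + b = 1) :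
    Real.exp (a * Real.log (f x) + b * Real.log (f y)) ≤ f (a • x + b • y) :=
  hf x y _ _ a b ha hb hab (Real.exp_log hx).le (Real.exp_log hy).le

theorem LogIneq.convex_superlevel {n : ℕ} {f : E n → ℝ} (hf : LogIneq f) {c : ℝ} (hc : 0 < c) :
    Convex ℝ {x | c ≤ f x} := by
  intro x hx y hy a b ha hb hab
  have := hf x y (Real.log c) (Real.log c) a b ha hb hab
    (by rw [Real.exp_log hc]; exact hx) (by rw [Real.exp_log hc]; exact hy)
  rw [← add_mul, hab, one_mul, Real.exp_log hc] at this
  exact this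

theorem LogIneq.convex_support {n : ℕ} {f : E n → ℝ} (hf : LogIneq f) (h0 : ∀ x, 0 ≤ f x) :
    Convex ℝ (Function.support f) := by
  intro x hx y hy a b ha hb hab
  exact ((Real.exp_pos _).trans_le (hf.exp_log ((h0 x).lt_of_ne' hx) ((h0 y).lt_of_ne' hy)
    ha hb hab)).ne'

theorem LogIneq.continuousAt {n : ℕ} {f : E n → ℝ} (hf : LogIneq f) (h0 : ∀ x, 0 ≤ f x) {x : E n}
    (hx : x ∈ interior (Function.support f)) : ContinuousAt f x := by
  have h : ConcaveOn ℝ (Function.support f) (fun x => Real.log (f x)) := by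
    refine ⟨hf.convex_support h0, fun x hx y hy a b ha hb hab => ?_⟩
    have h1 := hf.exp_log ((h0 x).lt_of_ne' hx) ((h0 y).lt_of_ne' hy) ha hb hab
    simpa using (Real.le_log_iff_exp_le ((Real.exp_pos _).trans_le h1)).2 h1
  have hc : ContinuousOn f (interior (Function.support f)) :=
    (h.continuousOn_interior.rexp).congr fun x hx => by
      have := (h0 x).lt_of_ne' (interior_subset hx)
      simp [Real.exp_log this]
  exact hc.continuousAt (isOpen_interior.mem_nhds hx)

/-- The frontier of a convex set is null, so almost everywhere statements need only be checked off
the boundary of the support. -/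
theorem LogIneq.ae_interior_or_notMem_closure {n : ℕ} {f : E n → ℝ} (hf : LogIneq f)
    (h0 : ∀ x, 0 ≤ f x) :
    ∀ᵐ x, x ∈ interior (Function.support f) ∨ x ∉ closure (Function.support f) := by
  have h : volume (frontier (Function.support f)) = 0 := (hf.convex_support h0).addHaar_frontier _
  filter_upwards [measure_eq_zero_iff_ae_notMem.1 h] with x hx
  by_contra! h1
  exact hx ⟨h1.2, h1.1⟩

theorem LogIneq.ae_interior_or {n : ℕ} {f : E n → ℝ} (hf : LogIneq f) (h0 : ∀ x, 0 ≤ f x) :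
    ∀ᵐ x, x ∈ interior (Function.support f) ∨ f x = 0 := by
  filter_upwards [hf.ae_interior_or_notMem_closure h0] with x hx
  exact hx.imp_right fun h => by_contra fun h1 => h (subset_closure h1)

theorem IsLC.convex_support {n : ℕ} {f : E n → ℝ} (hf : IsLC f) :
    Convex ℝ (Function.support f) :=
  hf.logIneq.convex_support hf.nonneg

theorem IsLC.continuousAt {n : ℕ} {f : E n → ℝ} (hf : IsLC f) {x : E n}
    (hx : x ∈ interior (Function.support f)) : ContinuousAt f x :=
  hf.logIneq.continuousAt hf.nonneg hx

/-- Every point of the support is approached by interior points with nearly the same value. -/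
theorem IsLC.exists_interior_near {n : ℕ} {f : E n → ℝ} (hf : IsLC f) {x : E n} {c : ℝ}
    (hc : 0 ≤ c) (hx : c < f x) {U : Set (E n)} (hU : U ∈ 𝓝 x) :
    ∃ y ∈ U, c < f y ∧ y ∈ interior (Function.support f) := by
  obtain ⟨z, hz⟩ := hf.nondegenerate
  have hfx : 0 < f x := hc.trans_lt hx
  have hfz : 0 < f z := hf.mem_support.1 (interior_subset hz)
  -- On the segment from `x` to the interior point `z`, `f` is at least a weighted geometric mean of
  -- `f x` and `f z`, which tends to `f x` at `x`. All points of the segment except possibly `x` are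
  -- interior to the support.
  have t1 : Tendsto (fun b : ℝ => (1 - b) • x + b • z) (𝓝[>] 0) (𝓝 x) := by
    have : Continuous (fun b : ℝ => (1 - b) • x + b • z) := by fun_prop
    simpa using (this.tendsto 0).mono_left nhdsWithin_le_nhds
  have t2 : Tendsto (fun b : ℝ => Real.exp ((1 - b) * Real.log (f x) + b * Real.log (f z)))
      (𝓝[>] 0) (𝓝 (f x)) := by
    have : Continuous (fun b : ℝ => Real.exp ((1 - b) * Real.log (f x) + b * Real.log (f z))) := by
      fun_prop
    simpa [Real.exp_log hfx] using (this.tendsto 0).mono_left nhdsWithin_le_nhds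
  have h3 : ∀ᶠ b : ℝ in 𝓝[>] 0, b ∈ Set.Ioo (0 : ℝ) 1 := Ioo_mem_nhdsGT one_pos
  obtain ⟨b, hb1, hb2, hb3⟩ := ((t1.eventually_mem hU).and
    ((t2.eventually (lt_mem_nhds hx)).and h3)).exists
  refine ⟨_, hb1, hb2.trans_le
    (hf.logIneq.exp_log hfx hfz (by linarith [hb3.2]) hb3.1.le (by ring)), ?_⟩
  exact hf.convex_support.combo_self_interior_mem_interior hfx.ne' hz (by linarith [hb3.2]) hb3.1
    (by ring)

theorem IsLC.eventually_lt {n : ℕ} {f : E n → ℝ} (hf : IsLC f) {x : E n}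
    (hx : x ∈ interior (Function.support f)) {c : ℝ} (hc : c < f x) : ∀ᶠ y in 𝓝 x, c < f y :=
  (hf.continuousAt hx).eventually (lt_mem_nhds hc)

/-- A bound by a continuous function which holds almost everywhere holds everywhere. -/
theorem IsLC.le_of_ae_le {n : ℕ} {f g : E n → ℝ} (hf : IsLC f) (hg : Continuous g)
    (hg0 : ∀ x, 0 ≤ g x) (h : ∀ᵐ x, f x ≤ g x) (x : E n) : f x ≤ g x := by
  by_contra! hx
  obtain ⟨c, hc1, hc2⟩ := exists_between hx
  obtain ⟨y, hy, hcy, hyi⟩ := hf.exists_interior_near ((hg0 x).trans hc1.le) hc2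
    (hg.continuousAt.eventually (gt_mem_nhds hc1))
  have h1 : ∀ᶠ w in 𝓝 y, g w < c := hg.continuousAt.eventually (gt_mem_nhds hy)
  have h2 := h1.and (hf.eventually_lt hyi hcy)
  have h3 : volume {w | ¬ (f w ≤ g w)} = 0 := h
  have h4 : 0 < volume {w | ¬ (f w ≤ g w)} :=
    Measure.measure_pos_of_mem_nhds _ (x := y) (by
      filter_upwards [h2] with w hw
      exact not_le.2 (hw.1.trans hw.2))
  exact h4.ne' h3

theorem IsLC.integral_pos {n : ℕ} {f : E n → ℝ} (hf : IsLC f) : 0 < ∫ x, f x := by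
  rw [integral_pos_iff_support_of_nonneg hf.nonneg hf.integrable]
  obtain ⟨x, hx⟩ := hf.nondegenerate
  exact Measure.measure_pos_of_mem_nhds _ (mem_interior_iff_mem_nhds.1 hx)

theorem IsLC.exists_ball_le {n : ℕ} {f : E n → ℝ} (hf : IsLC f) :
    ∃ (z : E n) (r c : ℝ), 0 < r ∧ 0 < c ∧ z ∈ interior (Function.support f) ∧
      ∀ y ∈ Metric.ball z r, c ≤ f y := by
  obtain ⟨z, hz⟩ := hf.nondegenerate
  have hfz : 0 < f z := hf.mem_support.1 (interior_subset hz)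
  obtain ⟨r, hr, h⟩ := Metric.eventually_nhds_iff_ball.1
    (hf.eventually_lt hz (half_lt_self hfz))
  exact ⟨z, r, f z / 2, hr, half_pos hfz, hz, fun y hy => (h y hy).le⟩

/-- If `f` is at least `c` at a distant point `x`, taking midpoints with a fixed ball on which `f`
is bounded below gives a ball of fixed radius, also distant, inside the superlevel set at `c1`. By
integrability that set has finite volume, so its part outside large balls has volume tending to
zero. -/
theorem IsLC.isBounded_superlevel {n : ℕ} {f : E n → ℝ} (hf : IsLC f) {c : ℝ} (hc : 0 < c) :
    Bornology.IsBounded {x | c ≤ f x} := by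
  obtain ⟨z, r, c0, hr, hc0, -, hball⟩ := hf.exists_ball_le
  set c1 : ℝ := Real.exp ((1 / 2) * Real.log c + (1 / 2) * Real.log c0) with hc1
  have hfin : volume {x | c1 ≤ f x} < ∞ := by
    have := hf.integrable.measure_norm_ge_lt_top (Real.exp_pos _ : 0 < c1)
    refine lt_of_le_of_lt (measure_mono fun x hx => ?_) this
    simpa only [Set.mem_ofPred_eq, Real.norm_eq_abs, abs_of_nonneg (hf.nonneg x)] using hx
  have key : ∀ x, c ≤ f x → Metric.ball ((1 / 2 : ℝ) • x + (1 / 2 : ℝ) • z) (r / 2) ⊆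
      {x | c1 ≤ f x} := by
    intro x hx y hy
    -- The point `y` is the midpoint of `x` and `2y - x`.
    have hw : (2 : ℝ) • y - x ∈ Metric.ball z r := by
      rw [mem_ball_iff_norm] at hy ⊢
      have : (2 : ℝ) • y - x - z = (2 : ℝ) • (y - ((1 / 2 : ℝ) • x + (1 / 2 : ℝ) • z)) := by
        module
      rw [this, norm_smul]
      norm_num
      linarith
    have h1 := hf.logIneq x ((2 : ℝ) • y - x) (Real.log c) (Real.log c0) (1 / 2) (1 / 2)
      (by norm_num) (by norm_num) (by norm_num) (by rwa [Real.exp_log hc])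
      (by rw [Real.exp_log hc0]; exact hball _ hw)
    have h2 : (1 / 2 : ℝ) • x + (1 / 2 : ℝ) • ((2 : ℝ) • y - x) = y := by module
    rw [h2] at h1
    exact h1
  have hmeas : MeasurableSet {x | c1 ≤ f x} := measurableSet_le measurable_const hf.measurable
  have htail : Tendsto (fun N : ℕ => volume ({x | c1 ≤ f x} \ Metric.ball (0 : E n) N)) atTop
      (𝓝 0) := by
    have h := tendsto_measure_iInter_atTop (μ := (volume : Measure (E n)))
      (s := fun N : ℕ => {x | c1 ≤ f x} \ Metric.ball (0 : E n) N)
      (fun N => (hmeas.diff measurableSet_ball).nullMeasurableSet)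
      (fun a b hab => Set.sdiff_subset_sdiff_right
        (Metric.ball_subset_ball (by exact_mod_cast hab)))
      ⟨0, ne_top_of_le_ne_top hfin.ne (measure_mono Set.sdiff_subset)⟩
    have h0 : ⋂ N : ℕ, ({x | c1 ≤ f x} \ Metric.ball (0 : E n) N) = ∅ := by
      ext y
      simp only [Set.mem_iInter, Set.mem_empty_iff_false, iff_false, not_forall]
      obtain ⟨N, hN⟩ := exists_nat_gt ‖y‖
      exact ⟨N, fun h => h.2 (by simpa using hN)⟩
    rwa [h0, measure_empty] at h
  have hvol : 0 < volume (Metric.ball (0 : E n) (r / 2)) :=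
    Metric.measure_ball_pos _ _ (half_pos hr)
  obtain ⟨N, hN⟩ := (htail.eventually (gt_mem_nhds hvol)).exists
  rw [isBounded_iff_forall_norm_le]
  refine ⟨2 * (N + r) + ‖z‖, fun x hx => ?_⟩
  by_contra! hlt
  have hsub : Metric.ball ((1 / 2 : ℝ) • x + (1 / 2 : ℝ) • z) (r / 2) ⊆
      {x | c1 ≤ f x} \ Metric.ball (0 : E n) N := by
    intro y hy
    refine ⟨key x hx hy, fun hyN => ?_⟩
    rw [mem_ball_zero_iff] at hyN
    rw [mem_ball_iff_norm] at hy
    have e : x = (2 : ℝ) • y - (2 : ℝ) • (y - ((1 / 2 : ℝ) • x + (1 / 2 : ℝ) • z)) - z := by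
      module
    have h1 : ‖x‖ ≤ 2 * ‖y‖ + 2 * ‖y - ((1 / 2 : ℝ) • x + (1 / 2 : ℝ) • z)‖ + ‖z‖ := by
      conv_lhs => rw [e]
      refine (norm_sub_le _ _).trans ?_
      gcongr
      refine (norm_sub_le _ _).trans ?_
      simp [norm_smul]
    linarith
  have := measure_mono (μ := volume) hsub
  rw [Measure.addHaar_ball_center] at this
  exact absurd (this.trans_lt hN) (lt_irrefl _)

theorem IsLC.bddAbove {n : ℕ} {f : E n → ℝ} (hf : IsLC f) : ∃ C : ℝ, ∀ x, f x ≤ C := by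
  obtain ⟨R, hR⟩ := isBounded_iff_forall_norm_le.1 (hf.isBounded_superlevel one_pos)
  obtain ⟨C, hC⟩ := (hf.upperSemicontinuous.upperSemicontinuousOn
    (Metric.closedBall 0 R)).bddAbove_of_isCompact (isCompact_closedBall _ _)
  refine ⟨max C 1, fun x => ?_⟩
  by_cases h : 1 ≤ f x
  · exact le_max_of_le_left (hC ⟨x, by simpa using hR x h, rfl⟩)
  · exact le_max_of_le_right (le_of_not_ge h)

/-- Log-concave integrable functions decay exponentially. -/
theorem IsLC.exists_decay {n : ℕ} {f : E n → ℝ} (hf : IsLC f) :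
    ∃ a b : ℝ, 0 < a ∧ ∀ x, f x ≤ Real.exp (b - a * ‖x‖) := by
  obtain ⟨z, hz⟩ := hf.nondegenerate
  have hfz : 0 < f z := hf.mem_support.1 (interior_subset hz)
  set l := Real.log (f z) with hl
  obtain ⟨R0, hR0⟩ := isBounded_iff_forall_norm_le.1
    (hf.isBounded_superlevel (Real.exp_pos (l - 1)))
  obtain ⟨C, hC⟩ := hf.bddAbove
  have hCpos : 0 < C := hfz.trans_le (hC z)
  -- At distance `R` or more from `z` the logarithm of `f` has dropped by more than 1 from its value
  -- `l` at `z`. Concavity along rays from `z` then gives `log (f x) ≤ l - R⁻¹ * ‖x - z‖` there.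
  set R := max R0 0 + 1 + ‖z‖ with hRdef
  have hR : 0 < R := by positivity
  have hout : ∀ y, R ≤ ‖y - z‖ → f y < Real.exp (l - 1) := by
    intro y hy
    by_contra! h
    have h1 := hR0 y h
    have h2 := norm_sub_le y z
    have h3 := le_max_left R0 0
    linarith
  have hlin : ∀ x, f x ≤ Real.exp (max l (Real.log C) + 1 - R⁻¹ * ‖x - z‖) := by
    intro x
    rcases le_or_gt R ‖x - z‖ with h | h
    · rcases (hf.nonneg x).eq_or_lt with h0 | h0
      · rw [← h0]; positivity
      have hd : 0 < ‖x - z‖ := hR.trans_le h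
      have hlam : R / ‖x - z‖ ≤ 1 := (div_le_one hd).2 h
      have h1 := hf.logIneq.exp_log hfz h0 (sub_nonneg.2 hlam) (by positivity : 0 ≤ R / ‖x - z‖)
        (by ring)
      have h2 : ((1 - R / ‖x - z‖) • z + (R / ‖x - z‖) • x) - z = (R / ‖x - z‖) • (x - z) := by
        module
      have h3 := hout _ (by
        rw [h2, norm_smul, Real.norm_of_nonneg (by positivity), div_mul_cancel₀ _ hd.ne'])
      have h4 := Real.exp_lt_exp.1 (h1.trans_lt h3)
      rw [← hl] at h4
      have h5 : R / ‖x - z‖ * (Real.log (f x) - l + R⁻¹ * ‖x - z‖) < 0 := by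
        have : R / ‖x - z‖ * (R⁻¹ * ‖x - z‖) = 1 := by field_simp
        linarith
      have h6 : Real.log (f x) - l + R⁻¹ * ‖x - z‖ < 0 := by
        by_contra! hh
        exact absurd h5 (not_lt.2 (by positivity))
      rw [← Real.log_le_iff_le_exp h0]
      linarith [le_max_left l (Real.log C)]
    · refine (hC x).trans ?_
      rw [← Real.log_le_iff_le_exp hCpos]
      have : R⁻¹ * ‖x - z‖ ≤ 1 := by
        rw [inv_mul_le_iff₀ hR]; linarith
      linarith [le_max_right l (Real.log C)]
  refine ⟨R⁻¹, max l (Real.log C) + 1 + R⁻¹ * ‖z‖, by positivity, fun x => (hlin x).trans ?_⟩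
  rw [Real.exp_le_exp]
  have h1 : ‖x‖ - ‖z‖ ≤ ‖x - z‖ := norm_sub_norm_le x z
  have h2 : R⁻¹ * (‖x‖ - ‖z‖) ≤ R⁻¹ * ‖x - z‖ := by gcongr
  linarith

/-! ### Self-improvement of almost everywhere convergence -/

/-- Almost everywhere convergence of a sequence of functions. -/
def AEConv {n : ℕ} (F : ℕ → E n → ℝ) (f : E n → ℝ) : Prop :=
  ∀ᵐ x, Tendsto (fun m => F m x) atTop (𝓝 (f x))

theorem AEConv.comp {n : ℕ} {F : ℕ → E n → ℝ} {f : E n → ℝ} (h : AEConv F f) {φ : ℕ → ℕ}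
    (hφ : StrictMono φ) : AEConv (fun m => F (φ m)) f := by
  filter_upwards [h] with x hx
  exact hx.comp hφ.tendsto_atTop

theorem AEConv.const {n : ℕ} (f : E n → ℝ) : AEConv (fun _ => f) f :=
  Eventually.of_forall fun _ => tendsto_const_nhds

section Convergence

variable {n : ℕ} {F : ℕ → E n → ℝ} {f : E n → ℝ}

theorem AEConv.exists_mem (h : AEConv F f) {U : Set (E n)} {x : E n} (hU : U ∈ 𝓝 x) :
    ∃ y ∈ U, Tendsto (fun m => F m y) atTop (𝓝 (f y)) := by
  obtain ⟨y, hy1, hy2⟩ := mem_closure_iff_nhds.1 (Measure.dense_of_ae h x) U hU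
  exact ⟨y, hy1, hy2⟩

/-- Convergence at `x` itself is not known, but arbitrarily close to `x` there is a `y` such that
the sequence converges both at `y` and at its reflection `2x - y`. Lower bounds at these two points
pass to their midpoint `x`. -/
theorem AEConv.eventually_lt_point (h : AEConv F f) (hF : ∀ m, IsLC (F m)) (hf : IsLC f) {x : E n}
    (hx : x ∈ interior (Function.support f)) {c : ℝ} (hc : c < f x) :
    ∀ᶠ m in atTop, c < F m x := by
  have hfx : 0 < f x := hf.mem_support.1 (interior_subset hx)
  obtain ⟨c', hc1, hc2⟩ := exists_between (max_lt hc hfx)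
  have hU := hf.eventually_lt hx hc2
  have hrefl : ∀ᵐ y, Tendsto (fun m => F m ((x + x) - y)) atTop (𝓝 (f ((x + x) - y))) :=
    (Measure.measurePreserving_sub_left volume (x + x)).quasiMeasurePreserving.ae h
  have hU' : ∀ᶠ y in 𝓝 x, c' < f ((x + x) - y) := by
    have : Tendsto (fun y => (x + x) - y) (𝓝 x) (𝓝 x) := by
      have hc : Continuous (fun y : E n => (x + x) - y) := by fun_prop
      simpa using hc.tendsto x
    exact this.eventually hU
  obtain ⟨y, ⟨hy1, hy2⟩, hy3, hy4⟩ := mem_closure_iff_nhds.1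
    (Measure.dense_of_ae (h.and hrefl) x) _ (hU.and hU')
  filter_upwards [hy3.eventually (lt_mem_nhds hy1), hy4.eventually (lt_mem_nhds hy2)] with m h1 h2
  have hpos : 0 < c' := (le_max_right _ _).trans_lt hc1
  have h3 := (hF m).logIneq.convex_superlevel hpos h1.le h2.le (a := 1 / 2) (b := 1 / 2)
    (by norm_num) (by norm_num) (by norm_num)
  have h4 : (1 / 2 : ℝ) • y + (1 / 2 : ℝ) • ((x + x) - y) = x := by module
  rw [h4] at h3
  exact ((le_max_left _ _).trans_lt hc1).trans_le h3

/-- A neighbourhood of `x` is enclosed in a simplex with vertices near `x`. Finitely many lower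
bounds at the vertices extend to the whole simplex by convexity of superlevel sets. -/
theorem AEConv.eventually_lt (h : AEConv F f) (hF : ∀ m, IsLC (F m)) (hf : IsLC f) {x : E n}
    (hx : x ∈ interior (Function.support f)) {c : ℝ} (hc : c < f x) :
    ∀ᶠ p : ℕ × E n in atTop ×ˢ 𝓝 x, c < F p.1 p.2 := by
  have hfx : 0 < f x := hf.mem_support.1 (interior_subset hx)
  obtain ⟨c', hc1, hc2⟩ := exists_between (max_lt hc hfx)
  have hpos : 0 < c' := (le_max_right _ _).trans_lt hc1
  obtain ⟨b, hb1, hb2⟩ := exists_mem_interior_convexHull_affineBasis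
    (inter_mem (hf.eventually_lt hx hc2) (isOpen_interior.mem_nhds hx))
  have h1 : ∀ᶠ m in atTop, ∀ i, c' < F m (b i) := by
    rw [eventually_all]
    intro i
    have := hb2 (subset_convexHull ℝ _ ⟨i, rfl⟩)
    exact h.eventually_lt_point hF hf this.2 this.1
  filter_upwards [h1.prod_mk (mem_interior_iff_mem_nhds.1 hb1)] with p hp
  have : p.2 ∈ {y | c' ≤ F p.1 y} := by
    refine convexHull_min ?_ ((hF p.1).logIneq.convex_superlevel hpos) hp.2
    rintro _ ⟨i, rfl⟩
    exact (hp.1 i).le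
  exact ((le_max_left _ _).trans_lt hc1).trans_le this

/-- A ball on which almost all functions of the sequence are bounded below. -/
theorem AEConv.exists_ball (h : AEConv F f) (hF : ∀ m, IsLC (F m)) (hf : IsLC f) {x : E n}
    (hx : x ∈ interior (Function.support f)) {c : ℝ} (hc : c < f x) :
    ∃ r > 0, ∀ᶠ m in atTop, ∀ y ∈ Metric.ball x r, c < F m y := by
  obtain ⟨p, hp, q, hq, hpq⟩ := eventually_prod_iff.1 (h.eventually_lt hF hf hx hc)
  obtain ⟨r, hr, hr'⟩ := Metric.eventually_nhds_iff_ball.1 hq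
  exact ⟨r, hr, hp.mono fun m hm y hy => hpq hm (hr' y hy)⟩

/-- If `F m` were at least `c` at a point near `x`, interpolating with the ball around `z`, where `F
m` is bounded below, would force a large value at a prescribed point `y` near `x`. At `y` the
sequence converges to `f y`, which is small by upper semicontinuity. This works at every `x`,
including boundary points of the support. -/
theorem AEConv.eventually_gt (h : AEConv F f) (hF : ∀ m, IsLC (F m)) (hf : IsLC f) {x : E n}
    {c : ℝ} (hc : f x < c) : ∀ᶠ p : ℕ × E n in atTop ×ˢ 𝓝 x, F p.1 p.2 < c := by
  obtain ⟨z, hz⟩ := hf.nondegenerate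
  have hfz : 0 < f z := hf.mem_support.1 (interior_subset hz)
  set c0 := f z / 2
  have hc0 : 0 < c0 := half_pos hfz
  obtain ⟨r, hr, hball⟩ := h.exists_ball hF hf hz (half_lt_self hfz)
  obtain ⟨c', hc1, hc2⟩ := exists_between hc
  have hcpos : 0 < c := (hf.nonneg x).trans_lt hc
  obtain ⟨ρ, hρ, hU⟩ := Metric.eventually_nhds_iff_ball.1 (hf.upperSemicontinuous x c' hc1)
  have t1 : ∀ᶠ l : ℝ in 𝓝[>] 0, l * (‖z - x‖ + r) < ρ := by
    have hcont : Continuous (fun l : ℝ => l * (‖z - x‖ + r)) := by fun_prop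
    have := (hcont.tendsto 0).mono_left (nhdsWithin_le_nhds (s := Set.Ioi 0))
    exact this.eventually (gt_mem_nhds (by simpa using hρ))
  have t2 : ∀ᶠ l : ℝ in 𝓝[>] 0, c' < Real.exp ((1 - l) * Real.log c + l * Real.log c0) := by
    have hcont : Continuous
        (fun l : ℝ => Real.exp ((1 - l) * Real.log c + l * Real.log c0)) := by fun_prop
    have := (hcont.tendsto 0).mono_left (nhdsWithin_le_nhds (s := Set.Ioi 0))
    exact this.eventually (lt_mem_nhds (by simpa [Real.exp_log hcpos] using hc2))
  have t3 : ∀ᶠ l : ℝ in 𝓝[>] 0, l ∈ Set.Ioo (0 : ℝ) 1 := Ioo_mem_nhdsGT one_pos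
  obtain ⟨l, hl1, hl2, hl3, hl4⟩ := (t1.and (t2.and t3)).exists
  obtain ⟨y, hy1, hy2⟩ := h.exists_mem
    (Metric.ball_mem_nhds ((1 - l) • x + l • z) (mul_pos hl3 hr))
  rw [mem_ball_iff_norm] at hy1
  have hyx : f y < c' := by
    refine hU y ?_
    rw [mem_ball_iff_norm]
    have e : y - x = (y - ((1 - l) • x + l • z)) + l • (z - x) := by module
    calc ‖y - x‖ ≤ ‖y - ((1 - l) • x + l • z)‖ + ‖l • (z - x)‖ := by
          conv_lhs => rw [e]
          exact norm_add_le _ _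
      _ < l * r + l * ‖z - x‖ := by
          rw [norm_smul, Real.norm_of_nonneg hl3.le]; linarith
      _ < ρ := by linarith
  -- For given `w` near `x`, this is the `u` solving `y = (1 - l) • w + l • u`. The choice of `y`
  -- places it in the ball around `z`.
  have hcont : Continuous (fun w : E n => l⁻¹ • (y - (1 - l) • w)) := by fun_prop
  have hzx : ∀ᶠ w in 𝓝 x, l⁻¹ • (y - (1 - l) • w) ∈ Metric.ball z r := by
    refine hcont.continuousAt.eventually (Metric.isOpen_ball.mem_nhds ?_)
    rw [mem_ball_iff_norm]
    have e : l⁻¹ • (y - (1 - l) • x) - z = l⁻¹ • (y - ((1 - l) • x + l • z)) := by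
      simp only [smul_sub, smul_add, inv_smul_smul₀ hl3.ne']
      abel
    rw [e, norm_smul, Real.norm_of_nonneg (inv_nonneg.2 hl3.le), inv_mul_lt_iff₀ hl3]
    exact hy1
  filter_upwards [(hball.and (hy2.eventually (gt_mem_nhds hyx))).prod_mk hzx] with p hp
  by_contra! hcon
  have h1 := (hF p.1).logIneq p.2 _ (Real.log c) (Real.log c0) (1 - l) l (by linarith) hl3.le
    (by ring) (by rwa [Real.exp_log hcpos])
    (by rw [Real.exp_log hc0]; exact (hp.1.1 _ hp.2).le)
  rw [smul_inv_smul₀ hl3.ne', add_sub_cancel] at h1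
  exact absurd (h1.trans_lt (hp.1.2.trans hl2)) (lt_irrefl _)

/-- Pointwise upper bounds by functions of conical growth pass to the sequence, with a margin. -/
theorem AEConv.eventually_le_exp (h : AEConv F f) (hF : ∀ m, IsLC (F m)) (hf : IsLC f)
    {s : ℝ} (hs : 0 ≤ s) (S : E n →L[ℝ] E n) (e w : E n) (c : ℝ) {κ : ℝ} (hκ : 0 < κ)
    (hle : ∀ x, f x ≤ Real.exp (-(s * ‖S x + e‖ + ⟪w, x⟫ + c + κ * (1 + ‖x‖)))) :
    ∀ᶠ m in atTop, ∀ x, F m x ≤ Real.exp (-(s * ‖S x + e‖ + ⟪w, x⟫ + c)) := by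
  set θ : E n → ℝ := fun x => s * ‖S x + e‖ + ⟪w, x⟫ + c with hθ
  have hθc : Continuous θ := by fun_prop
  obtain ⟨z, hz⟩ := hf.nondegenerate
  have hfz : 0 < f z := hf.mem_support.1 (interior_subset hz)
  set c0 := f z / 2
  have hc0 : 0 < c0 := half_pos hfz
  set C := s * ‖S z + e‖ + |⟪w, z⟫| + |c| with hC
  -- A substitute for convexity of `θ` along segments from `z`, with the contribution of `z`
  -- absorbed into the constant `C`.
  have hθC : ∀ l : ℝ, 0 ≤ l → l ≤ 1 → ∀ x, l * θ x ≤ θ ((1 - l) • z + l • x) + C := by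
    intro l hl0 hl1 x
    have h1 : l * ‖S x + e‖ ≤ ‖S ((1 - l) • z + l • x) + e‖ + ‖S z + e‖ := by
      have e1 : l • (S x + e) = (S ((1 - l) • z + l • x) + e) - (1 - l) • (S z + e) := by
        simp only [map_add, map_smul]; module
      calc l * ‖S x + e‖ = ‖l • (S x + e)‖ := by rw [norm_smul, Real.norm_of_nonneg hl0]
        _ ≤ ‖S ((1 - l) • z + l • x) + e‖ + ‖(1 - l) • (S z + e)‖ := by
            rw [e1]; exact norm_sub_le _ _
        _ ≤ _ := by
            rw [norm_smul, Real.norm_of_nonneg (sub_nonneg.2 hl1)]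
            gcongr
            exact mul_le_of_le_one_left (norm_nonneg _) (by linarith)
    have h2 : l * ⟪w, x⟫ ≤ ⟪w, (1 - l) • z + l • x⟫ + |⟪w, z⟫| := by
      rw [inner_add_right, inner_smul_right, inner_smul_right]
      have : -((1 - l) * ⟪w, z⟫) ≤ |⟪w, z⟫| := by
        refine (neg_le_abs _).trans ?_
        rw [abs_mul, abs_of_nonneg (sub_nonneg.2 hl1)]
        exact mul_le_of_le_one_left (abs_nonneg _) (by linarith)
      linarith
    have h3 : l * c ≤ c + |c| := by
      have : -((1 - l) * c) ≤ |c| := by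
        refine (neg_le_abs _).trans ?_
        rw [abs_mul, abs_of_nonneg (sub_nonneg.2 hl1)]
        exact mul_le_of_le_one_left (abs_nonneg _) (by linarith)
      linarith
    have h4 := mul_le_mul_of_nonneg_left h1 hs
    simp only [hθ, hC]
    linarith
  -- On the sphere of radius `R` about `z`, the margin `κ * ‖y‖` exceeds `C + |log c0|`.
  set R := (C + |Real.log c0|) / κ + ‖z‖ + 1 with hR
  have hCnn : 0 ≤ C := by positivity
  have hRpos : 0 < R := by positivity
  -- Inside the ball, compactness turns the local upper bounds of `AEConv.eventually_gt` into a
  -- uniform one. The part `κ * ‖y‖` of the margin is kept for use outside the ball.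
  have hnear : ∀ᶠ m in atTop, ∀ y ∈ Metric.closedBall z R,
      F m y < Real.exp (-(θ y + κ * ‖y‖)) := by
    have hP : ∀ x ∈ Metric.closedBall z R, ∀ᶠ p : ℕ × E n in atTop ×ˢ 𝓝 x,
        F p.1 p.2 < Real.exp (-(θ p.2 + κ * ‖p.2‖)) := by
      intro x _
      have hlt : f x < Real.exp (-(θ x + κ * ‖x‖)) := by
        refine (hle x).trans_lt (Real.exp_lt_exp.2 ?_)
        simp only [hθ]
        linarith
      obtain ⟨d, hd1, hd2⟩ := exists_between hlt
      have hcont : Continuous (fun y => Real.exp (-(θ y + κ * ‖y‖))) := by fun_prop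
      have h2 : ∀ᶠ y in 𝓝 x, d < Real.exp (-(θ y + κ * ‖y‖)) :=
        hcont.continuousAt.eventually (lt_mem_nhds hd2)
      filter_upwards [h.eventually_gt hF hf hd1, h2.prod_inr (atTop : Filter ℕ)] with p h3 h4
      exact h3.trans h4
    have hK := (isCompact_closedBall z R).prod_nhdsSet_eq_biSup (atTop : Filter ℕ)
    have : ∀ᶠ p : ℕ × E n in atTop ×ˢ 𝓝ˢ (Metric.closedBall z R),
        F p.1 p.2 < Real.exp (-(θ p.2 + κ * ‖p.2‖)) := by
      rw [hK]
      simpa only [eventually_iSup] using hP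
    exact this.curry.mono fun m hm y hy => hm.self_of_nhdsSet y hy
  filter_upwards [hnear, h.eventually_lt_point hF hf hz (half_lt_self hfz)] with m hm hmz x
  rcases le_or_gt ‖x - z‖ R with hx | hx
  · refine (hm x (by rwa [mem_closedBall_iff_norm])).le.trans (Real.exp_le_exp.2 ?_)
    have : 0 ≤ κ * ‖x‖ := by positivity
    simp only [hθ]
    linarith
  -- A violation at `x` outside the ball propagates along the segment to `z`, where `F m` is at
  -- least `c0`, and contradicts the margin at the point `y` of the sphere.
  · by_contra! hcon
    have hd : 0 < ‖x - z‖ := hRpos.trans hx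
    set l := R / ‖x - z‖ with hl
    have hl0 : 0 ≤ l := by positivity
    have hl1 : l ≤ 1 := (div_le_one hd).2 hx.le
    have h1 := (hF m).logIneq z x (Real.log c0) (-θ x) (1 - l) l (by linarith) hl0 (by ring)
      (by rw [Real.exp_log hc0]; exact hmz.le) hcon.le
    set y := (1 - l) • z + l • x with hy
    have hyz : y - z = l • (x - z) := by rw [hy]; module
    have hyn : ‖y - z‖ = R := by
      rw [hyz, norm_smul, Real.norm_of_nonneg hl0, hl, div_mul_cancel₀ _ hd.ne']
    have h2 := hm y (by rw [mem_closedBall_iff_norm, hyn])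
    have h3 := Real.exp_lt_exp.1 (h1.trans_lt h2)
    have h4 := hθC l hl0 hl1 x
    rw [← hy] at h4
    have h5 : -((1 - l) * Real.log c0) ≤ |Real.log c0| := by
      refine (neg_le_abs _).trans ?_
      rw [abs_mul, abs_of_nonneg (sub_nonneg.2 hl1)]
      exact mul_le_of_le_one_left (abs_nonneg _) (by linarith)
    have h6 : κ * ‖y‖ < C + |Real.log c0| := by linarith
    have h7 : R ≤ ‖y‖ + ‖z‖ := hyn ▸ norm_sub_le y z
    have h8 : (C + |Real.log c0|) / κ + 1 ≤ ‖y‖ := by linarith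
    have h9 := mul_le_mul_of_nonneg_left h8 hκ.le
    rw [mul_add, mul_div_cancel₀ _ hκ.ne'] at h9
    linarith

/-- Uniform exponential decay along an almost everywhere convergent sequence. -/
theorem AEConv.exists_decay (h : AEConv F f) (hF : ∀ m, IsLC (F m)) (hf : IsLC f) :
    ∃ a b : ℝ, 0 < a ∧ (∀ x, f x ≤ Real.exp (b - a * ‖x‖)) ∧
      ∀ᶠ m in atTop, ∀ x, F m x ≤ Real.exp (b - a * ‖x‖) := by
  obtain ⟨a, b, ha, hab⟩ := hf.exists_decay
  -- Half of the decay rate is kept and half is spent as the margin `κ`. The term `-a / 2`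
  -- compensates for the constant part of `κ * (1 + ‖x‖)`.
  have h1 := h.eventually_le_exp hF hf (s := a / 2) (by positivity) (ContinuousLinearMap.id ℝ _)
    0 0 (-b - a / 2) (κ := a / 2) (by positivity) (fun x => (hab x).trans (Real.exp_le_exp.2 (by
      simp
      linarith)))
  refine ⟨a / 2, b + a / 2, by positivity, fun x => (hab x).trans (Real.exp_le_exp.2 ?_), ?_⟩
  · have : 0 ≤ a * ‖x‖ := by positivity
    linarith
  · filter_upwards [h1] with m hm x
    refine (hm x).trans (Real.exp_le_exp.2 ?_)
    simp
    linarith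

end Convergence

/-! ### Affine changes of variable and integrability under exponential decay -/

section ChangeOfVariables

variable {n : ℕ}

/-- The Jacobian of an affine equivalence. -/
noncomputable def jac (A : E n ≃ᵃ[ℝ] E n) : ℝ := |LinearMap.det (A.linear : E n →ₗ[ℝ] E n)|

theorem jac_pos (A : E n ≃ᵃ[ℝ] E n) : 0 < jac A :=
  abs_pos.2 A.linear.isUnit_det'.ne_zero

theorem jac_trans (A B : E n ≃ᵃ[ℝ] E n) : jac (A.trans B) = jac A * jac B := by
  unfold jac
  rw [← abs_mul, mul_comm, ← LinearMap.det_comp]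
  rfl

theorem continuous_affineEquiv (A : E n ≃ᵃ[ℝ] E n) : Continuous A :=
  (A : E n →ᵃ[ℝ] E n).continuous_of_finiteDimensional

theorem affineEquiv_apply (A : E n ≃ᵃ[ℝ] E n) (x : E n) : A x = A.linear x + A 0 := by
  have := A.map_vadd 0 x
  simpa using this

theorem measurableEmbedding_affineEquiv (A : E n ≃ᵃ[ℝ] E n) : MeasurableEmbedding A :=
  (Homeomorph.mk A.toEquiv (continuous_affineEquiv A)
    (continuous_affineEquiv A.symm)).measurableEmbedding

theorem map_affineEquiv (A : E n ≃ᵃ[ℝ] E n) :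
    Measure.map A volume = ENNReal.ofReal (jac A)⁻¹ • (volume : Measure (E n)) := by
  have hdet : LinearMap.det (A.linear : E n →ₗ[ℝ] E n) ≠ 0 := A.linear.isUnit_det'.ne_zero
  have hm := Measure.map_linearMap_addHaar_eq_smul_addHaar (volume : Measure (E n)) hdet
  have hl : Measurable (A.linear : E n →ₗ[ℝ] E n) :=
    (LinearMap.continuous_of_finiteDimensional _).measurable
  have e : (A : E n → E n) = (fun y => y + A 0) ∘ (A.linear : E n →ₗ[ℝ] E n) := by
    ext1 x
    exact affineEquiv_apply A x
  rw [e, ← Measure.map_map (by fun_prop) hl, hm, Measure.map_smul, map_add_right_eq_self, jac,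
    abs_inv]

theorem integral_comp_affineEquiv {G : Type*} [NormedAddCommGroup G] [NormedSpace ℝ G]
    (A : E n ≃ᵃ[ℝ] E n) (g : E n → G) : ∫ x, g (A x) = (jac A)⁻¹ • ∫ x, g x := by
  rw [← (measurableEmbedding_affineEquiv A).integral_map, map_affineEquiv, integral_smul_measure,
    ENNReal.toReal_ofReal (inv_nonneg.2 (jac_pos A).le)]

theorem lintegral_comp_affineEquiv (A : E n ≃ᵃ[ℝ] E n) (g : E n → ℝ≥0∞) :
    ∫⁻ x, g (A x) = ENNReal.ofReal (jac A)⁻¹ * ∫⁻ x, g x := by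
  rw [← (measurableEmbedding_affineEquiv A).lintegral_map, map_affineEquiv, lintegral_smul_measure,
    smul_eq_mul]

end ChangeOfVariables

/-- Bounding the exponential below by its Taylor term of order `n + 2` cancels the factor `1 + ‖x‖`
and leaves a power `-(n + 1)` of `1 + ‖x‖`, integrable in dimension `n`. -/
theorem integrable_mul_exp_decay {n : ℕ} {a : ℝ} (ha : 0 < a) (b : ℝ) :
    Integrable (fun x : E n => (1 + ‖x‖) * Real.exp (b - a * ‖x‖)) := by
  have h1 : Integrable (fun x : E n => (1 + ‖x‖) ^ (-((n : ℝ) + 1))) :=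
    integrable_one_add_norm (by simp)
  refine (h1.const_mul (Real.exp (b + a) * ((n + 2).factorial / a ^ (n + 2)))).mono'
    (by fun_prop) (Eventually.of_forall fun x => ?_)
  have hx : 0 < 1 + ‖x‖ := by positivity
  rw [Real.norm_of_nonneg (by positivity)]
  have h2 := Real.pow_div_factorial_le_exp (a * (1 + ‖x‖)) (by positivity) (n + 2)
  have h3 : Real.exp (b - a * ‖x‖) = Real.exp (b + a) / Real.exp (a * (1 + ‖x‖)) := by
    rw [← Real.exp_sub]; congr 1; ring
  have h4 : (1 + ‖x‖) ^ (-((n : ℝ) + 1)) = ((1 + ‖x‖) ^ (n + 1))⁻¹ := by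
    rw [Real.rpow_neg hx.le]
    congr 1
    exact_mod_cast Real.rpow_natCast (1 + ‖x‖) (n + 1)
  have h5 : (Real.exp (a * (1 + ‖x‖)))⁻¹ ≤
      ((a * (1 + ‖x‖)) ^ (n + 2) / (n + 2).factorial)⁻¹ := by
    gcongr
  rw [h3, h4, div_eq_mul_inv]
  calc (1 + ‖x‖) * (Real.exp (b + a) * (Real.exp (a * (1 + ‖x‖)))⁻¹)
      ≤ (1 + ‖x‖) * (Real.exp (b + a) *
        ((a * (1 + ‖x‖)) ^ (n + 2) / (n + 2).factorial)⁻¹) := by gcongr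
    _ = _ := by rw [mul_pow]; field_simp; ring

theorem integrable_exp_decay {n : ℕ} {a : ℝ} (ha : 0 < a) (b : ℝ) :
    Integrable (fun x : E n => Real.exp (b - a * ‖x‖)) := by
  refine (integrable_mul_exp_decay ha b).mono' (by fun_prop) (Eventually.of_forall fun x => ?_)
  rw [Real.norm_of_nonneg (by positivity)]
  exact le_mul_of_one_le_left (Real.exp_pos _).le (by simp)

theorem IsLC.integrable_smul {n : ℕ} {f : E n → ℝ} (hf : IsLC f) :
    Integrable (fun x => f x • x) := by
  obtain ⟨a, b, ha, hab⟩ := hf.exists_decay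
  refine (integrable_mul_exp_decay ha b).mono'
    (hf.measurable.aestronglyMeasurable.smul aestronglyMeasurable_id)
    (Eventually.of_forall fun x => ?_)
  rw [norm_smul, Real.norm_of_nonneg (hf.nonneg x), mul_comm]
  gcongr
  · exact hf.nonneg x
  · linarith
  · exact hab x

/-! ### Continuity and equivariance of the centroid -/

section Centroid

variable {n : ℕ} {F : ℕ → E n → ℝ} {f : E n → ℝ}

theorem AEConv.tendsto_integral (h : AEConv F f) (hF : ∀ m, IsLC (F m)) (hf : IsLC f) :
    Tendsto (fun m => ∫ x, F m x) atTop (𝓝 (∫ x, f x)) := by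
  obtain ⟨a, b, ha, -, hab⟩ := h.exists_decay hF hf
  refine tendsto_integral_filter_of_dominated_convergence _
    (Eventually.of_forall fun m => (hF m).measurable.aestronglyMeasurable) ?_
    (integrable_exp_decay ha b) h
  filter_upwards [hab] with m hm
  refine Eventually.of_forall fun x => ?_
  rw [Real.norm_of_nonneg ((hF m).nonneg x)]
  exact hm x

theorem AEConv.tendsto_centroid (h : AEConv F f) (hF : ∀ m, IsLC (F m)) (hf : IsLC f) :
    Tendsto (fun m => centroid (F m)) atTop (𝓝 (centroid f)) := by
  obtain ⟨a, b, ha, -, hab⟩ := h.exists_decay hF hf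
  refine Tendsto.smul ((h.tendsto_integral hF hf).inv₀ hf.integral_pos.ne') ?_
  refine tendsto_integral_filter_of_dominated_convergence _
    (Eventually.of_forall fun m => (hF m).integrable_smul.aestronglyMeasurable) ?_
    (integrable_mul_exp_decay ha b) ?_
  · filter_upwards [hab] with m hm
    refine Eventually.of_forall fun x => ?_
    rw [norm_smul, Real.norm_of_nonneg ((hF m).nonneg x), mul_comm]
    gcongr
    · exact (hF m).nonneg x
    · linarith
    · exact hm x
  · filter_upwards [h] with x hx
    exact hx.smul_const x

theorem IsLC.centroid_comp (hf : IsLC f) (A : E n ≃ᵃ[ℝ] E n) :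
    centroid (fun x => f (A x)) = A.symm (centroid f) := by
  have h1 : ∫ x, f (A x) • x = (jac A)⁻¹ • ∫ y, f y • A.symm y := by
    rw [← integral_comp_affineEquiv A (fun y => f y • A.symm y)]
    simp
  set L : E n →L[ℝ] E n := LinearMap.toContinuousLinearMap (A.symm.linear : E n →ₗ[ℝ] E n)
    with hL
  have hA : ∀ y, A.symm y = L y + A.symm 0 := affineEquiv_apply A.symm
  have h2 : ∫ y, f y • A.symm y = L (∫ y, f y • y) + (∫ y, f y) • A.symm 0 := by
    rw [← L.integral_comp_comm hf.integrable_smul, ← integral_smul_const, ← integral_add]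
    · refine integral_congr_ae (Eventually.of_forall fun y => ?_)
      simp only [map_smul, hA y, smul_add]
    · exact L.integrable_comp hf.integrable_smul
    · exact hf.integrable.smul_const _
  have hI := hf.integral_pos.ne'
  have hj := (jac_pos A).ne'
  unfold centroid
  rw [h1, h2, integral_comp_affineEquiv A f, hA ((∫ x, f x)⁻¹ • _), L.map_smul, smul_smul, smul_add,
    smul_smul, smul_eq_mul]
  have e1 : ((jac A)⁻¹ * ∫ x, f x)⁻¹ * (jac A)⁻¹ = (∫ x, f x)⁻¹ := by field_simp
  rw [e1, inv_mul_cancel₀ hI, one_smul]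

end Centroid

/-- A nonnegative upper semicontinuous log-concave function with exponential decay which is
bounded below on a ball belongs to the class. -/
theorem isLC_of_decay {n : ℕ} {f : E n → ℝ} (h0 : ∀ x, 0 ≤ f x) (hl : LogIneq f)
    (hu : UpperSemicontinuous f) {a b : ℝ} (ha : 0 < a) (hab : ∀ x, f x ≤ Real.exp (b - a * ‖x‖))
    {x : E n} (hx : ∀ᶠ y in 𝓝 x, 0 < f y) : IsLC f where
  nonneg := h0
  convex := convex_epi_iff.2 hl
  upperSemicontinuous := hu
  integrable := (integrable_exp_decay ha b).mono' hu.measurable.aestronglyMeasurable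
    (Eventually.of_forall fun x => by rw [Real.norm_of_nonneg (h0 x)]; exact hab x)
  nondegenerate := ⟨x, mem_interior_iff_mem_nhds.2 (hx.mono fun _ h => h.ne')⟩

/-! ### Polarity and the Santaló point -/

/-- The polar with respect to the origin. -/
noncomputable def conj {n : ℕ} (f : E n → ℝ) (w : E n) : ℝ := polar f 0 w

/-- The Santaló functional `z ↦ ∫ exp ⟪z, w⟫ f° (w) dw`. -/
noncomputable def santaloInt {n : ℕ} (f : E n → ℝ) (z : E n) : ℝ≥0∞ :=
  ∫⁻ w, ENNReal.ofReal (Real.exp ⟪z, w⟫ * conj f w)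

section Unconditional

variable {n : ℕ} (f : E n → ℝ)

/-- Moving the centre only multiplies by an exponential. All polars are thus tilts of one function,
and the dependence on `z` is visibly convex. -/
theorem polar_add (z w : E n) : polar f z (z + w) = Real.exp ⟪z, w⟫ * conj f w := by
  unfold conj polar
  rw [Real.mul_iInf_of_nonneg (Real.exp_pos _).le]
  congr 1
  ext x
  rw [mul_div_assoc', ← Real.exp_add]
  congr 2
  simp only [add_sub_cancel_left, inner_sub_left, sub_zero]
  ring

theorem lintegral_polar (z : E n) : ∫⁻ y, ENNReal.ofReal (polar f z y) = santaloInt f z := by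
  rw [← lintegral_add_left_eq_self _ z]
  simp only [polar_add, santaloInt]

theorem isSantaloPoint_iff (z : E n) :
    IsSantaloPoint f z ↔ ∀ w, santaloInt f z ≤ santaloInt f w := by
  simp only [IsSantaloPoint, lintegral_polar]

end Unconditional

section Conj

variable {n : ℕ} {f : E n → ℝ}

theorem IsLC.le_conj_iff (hf : IsLC f) {w : E n} {c : ℝ} :
    c ≤ conj f w ↔ ∀ x, f x * c ≤ Real.exp (-⟪x, w⟫) := by
  have hne : Nonempty (Function.support f) := by
    obtain ⟨x, hx⟩ := hf.nondegenerate
    exact ⟨⟨x, interior_subset hx⟩⟩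
  unfold conj polar
  simp only [sub_zero]
  rw [le_ciInf_iff ⟨0, by
    rintro _ ⟨x, rfl⟩
    exact div_nonneg (Real.exp_pos _).le (hf.nonneg _)⟩]
  constructor
  · intro h x
    by_cases hx : f x = 0
    · rw [hx, zero_mul]; positivity
    · have := h ⟨x, hx⟩
      rwa [le_div_iff₀ (hf.mem_support.1 hx), mul_comm] at this
  · rintro h ⟨x, hx⟩
    rw [le_div_iff₀ (hf.mem_support.1 hx), mul_comm]
    exact h x

theorem IsLC.exp_le_conj_iff (hf : IsLC f) {w : E n} {s : ℝ} :
    Real.exp s ≤ conj f w ↔ ∀ x, f x ≤ Real.exp (-⟪x, w⟫ - s) := by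
  simp only [hf.le_conj_iff, Real.exp_sub, le_div_iff₀ (Real.exp_pos s)]

theorem IsLC.conj_nonneg (hf : IsLC f) (w : E n) : 0 ≤ conj f w :=
  hf.le_conj_iff.2 fun x => by simpa using (Real.exp_pos _).le

/-- The logarithm of the tilt is an infimum of affine functions of `w`, one for each point of the
support of `f`. -/
theorem IsLC.logIneq_tilt (hf : IsLC f) (z : E n) :
    LogIneq (fun w => Real.exp ⟪z, w⟫ * conj f w) := by
  have key : ∀ (w : E n) (s : ℝ), Real.exp s ≤ Real.exp ⟪z, w⟫ * conj f w ↔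
      ∀ x, f x ≤ Real.exp (-⟪x, w⟫ - (s - ⟪z, w⟫)) := by
    intro w s
    rw [← hf.exp_le_conj_iff, Real.exp_sub, div_le_iff₀ (Real.exp_pos _), mul_comm]
  intro u v s t a b ha hb hab hs ht
  rw [key] at hs ht ⊢
  intro x
  rcases (hf.nonneg x).eq_or_lt with h0 | h0
  · rw [← h0]; positivity
  · have h1 := (Real.log_le_iff_le_exp h0).2 (hs x)
    have h2 := (Real.log_le_iff_le_exp h0).2 (ht x)
    rw [← Real.log_le_iff_le_exp h0]
    simp only [inner_add_right, inner_smul_right]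
    have h3 := add_le_add (mul_le_mul_of_nonneg_left h1 ha) (mul_le_mul_of_nonneg_left h2 hb)
    rw [← add_mul, hab, one_mul] at h3
    linarith

theorem IsLC.logIneq_conj (hf : IsLC f) : LogIneq (conj f) := by
  simpa using hf.logIneq_tilt 0

theorem IsLC.upperSemicontinuous_tilt (hf : IsLC f) (z : E n) :
    UpperSemicontinuous (fun w => Real.exp ⟪z, w⟫ * conj f w) := by
  rw [upperSemicontinuous_iff_isClosed_preimage]
  intro c
  have : (fun w => Real.exp ⟪z, w⟫ * conj f w) ⁻¹' Set.Ici c =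
      ⋂ x, {w | f x * (c * Real.exp (-⟪z, w⟫)) ≤ Real.exp (-⟪x, w⟫)} := by
    ext w
    simp only [Set.mem_preimage, Set.mem_Ici, Set.mem_iInter, Set.mem_ofPred_eq]
    rw [← hf.le_conj_iff, Real.exp_neg, ← div_eq_mul_inv, div_le_iff₀ (Real.exp_pos _), mul_comm]
  rw [this]
  exact isClosed_iInter fun x => isClosed_le (by fun_prop) (by fun_prop)

theorem IsLC.measurable_tilt (hf : IsLC f) (z : E n) :
    Measurable (fun w => Real.exp ⟪z, w⟫ * conj f w) :=
  (hf.upperSemicontinuous_tilt z).measurable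

theorem IsLC.exp_le_conj_of_decay (hf : IsLC f) {a b : ℝ}
    (h : ∀ x, f x ≤ Real.exp (b - a * ‖x‖)) {w : E n} (hw : ‖w‖ ≤ a) :
    Real.exp (-b) ≤ conj f w := by
  refine hf.exp_le_conj_iff.2 fun x => (h x).trans (Real.exp_le_exp.2 ?_)
  have h1 := real_inner_le_norm x w
  have h2 : ‖x‖ * ‖w‖ ≤ ‖x‖ * a := by gcongr
  linarith

end Conj

section InnerBounds

variable {n : ℕ}

theorem inner_unit (w : E n) : ⟪w, ‖w‖⁻¹ • w⟫ = ‖w‖ := by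
  rw [inner_smul_right, real_inner_self_eq_norm_sq]
  rcases eq_or_ne ‖w‖ 0 with h | h
  · simp [h]
  · field_simp

theorem norm_unit_le (w : E n) : ‖‖w‖⁻¹ • w‖ ≤ 1 := by
  rw [norm_smul, norm_inv, norm_norm]
  exact inv_mul_le_one

/-- A linear functional is large on a small ball placed in the direction of its gradient. -/
theorem inner_ge_of_mem_ball {w x y : E n} {r : ℝ} (hr : 0 < r)
    (hy : y ∈ Metric.ball (x + (r / 2) • (‖w‖⁻¹ • w)) (r / 4)) :
    ⟪w, x⟫ + ‖w‖ * r / 4 ≤ ⟪w, y⟫ ∧ ‖y - x‖ < r := by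
  rw [mem_ball_iff_norm] at hy
  set e := y - (x + (r / 2) • (‖w‖⁻¹ • w)) with he
  have hyx : y = x + (r / 2) • (‖w‖⁻¹ • w) + e := by rw [he]; abel
  constructor
  · rw [hyx, inner_add_right, inner_add_right, inner_smul_right _ _ (r / 2), inner_unit]
    have h1 := abs_le.1 (abs_real_inner_le_norm w e)
    have h2 : ‖w‖ * ‖e‖ ≤ ‖w‖ * (r / 4) := by gcongr
    linarith [h1.1]
  · have h3 : y - x = (r / 2) • (‖w‖⁻¹ • w) + e := by rw [hyx]; abel
    rw [h3]
    refine (norm_add_le _ _).trans_lt ?_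
    rw [norm_smul, Real.norm_of_nonneg (by positivity)]
    have : r / 2 * ‖‖w‖⁻¹ • w‖ ≤ r / 2 * 1 := by
      gcongr
      exact norm_unit_le w
    linarith

end InnerBounds

section Santalo

variable {n : ℕ} {F : ℕ → E n → ℝ} {f : E n → ℝ}

/-- Coercivity in `z`: on a ball of radius `a / 4` placed at distance `a / 2` from the origin in the
direction of `z`, the exponent is at least `‖z‖ * a / 4` and the polar at least `exp (-b)`. Only the
decay constants enter, so the bound is uniform along sequences. -/
theorem IsLC.santaloInt_ge (hf : IsLC f) {a b : ℝ} (ha : 0 < a)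
    (h : ∀ x, f x ≤ Real.exp (b - a * ‖x‖)) (z : E n) :
    ENNReal.ofReal (Real.exp (‖z‖ * a / 4 - b)) * volume (Metric.ball (0 : E n) (a / 4)) ≤
      santaloInt f z := by
  rw [← Measure.addHaar_ball_center volume (0 + (a / 2) • (‖z‖⁻¹ • z)), ← setLIntegral_const]
  refine (setLIntegral_mono' measurableSet_ball fun w hw => ?_).trans
    (setLIntegral_le_lintegral _ _)
  obtain ⟨h1, h2⟩ := inner_ge_of_mem_ball ha hw
  rw [sub_zero] at h2
  rw [inner_zero_right, zero_add] at h1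
  refine ENNReal.ofReal_le_ofReal ?_
  rw [sub_eq_add_neg, Real.exp_add]
  gcongr
  exact hf.exp_le_conj_of_decay h h2.le

/-- Testing the infimum at the point at distance `r / 2` from `z` in the direction of `w` gives an
integrable majorant depending only on `r` and `c`. -/
theorem IsLC.tilt_le (hf : IsLC f) {z : E n} {r c : ℝ} (hr : 0 < r) (hc : 0 < c)
    (h : ∀ y ∈ Metric.ball z r, c ≤ f y) (w : E n) :
    Real.exp ⟪z, w⟫ * conj f w ≤ Real.exp (-Real.log c - r / 2 * ‖w‖) := by
  have h1 := (hf.le_conj_iff (w := w)).1 le_rfl (z + (r / 2) • (‖w‖⁻¹ • w))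
  have h2 : c ≤ f (z + (r / 2) • (‖w‖⁻¹ • w)) := by
    refine h _ ?_
    rw [mem_ball_iff_norm, add_sub_cancel_left, norm_smul, Real.norm_of_nonneg (by positivity)]
    have : r / 2 * ‖‖w‖⁻¹ • w‖ ≤ r / 2 * 1 := by
      gcongr
      exact norm_unit_le w
    linarith
  have h3 : c * conj f w ≤ Real.exp (-⟪z, w⟫ - r / 2 * ‖w‖) := by
    refine (mul_le_mul_of_nonneg_right h2 (hf.conj_nonneg w)).trans (h1.trans_eq ?_)
    rw [inner_add_left, inner_smul_left, real_inner_comm w (_ • w), inner_unit]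
    simp
    ring
  have h4 : Real.exp (-Real.log c - r / 2 * ‖w‖) =
      Real.exp ⟪z, w⟫ * (Real.exp (-⟪z, w⟫ - r / 2 * ‖w‖) / c) := by
    rw [← Real.exp_log hc, ← Real.exp_sub, ← Real.exp_add, Real.exp_log hc]
    congr 1
    ring
  rw [h4]
  gcongr
  rw [le_div_iff₀ hc, mul_comm]
  exact h3

/-- A lower bound for the polar on a whole ball around `w` says that `f` lies below the
corresponding exponential with a margin linear in `‖x‖`. This is exactly what
`AEConv.eventually_le_exp` needs. -/
theorem AEConv.eventually_lt_conj (h : AEConv F f) (hF : ∀ m, IsLC (F m)) (hf : IsLC f) {w : E n}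
    (hw : w ∈ interior (Function.support (conj f))) {c : ℝ} (hc : c < conj f w) :
    ∀ᶠ m in atTop, c < conj (F m) w := by
  have hw0 : 0 < conj f w := (hf.conj_nonneg w).lt_of_ne' (interior_subset hw)
  obtain ⟨c', hc1, hc2⟩ := exists_between (max_lt hc hw0)
  obtain ⟨d, hd1, hd2⟩ := exists_between hc2
  have hc'0 : 0 < c' := (le_max_right _ _).trans_lt hc1
  have hd0 : 0 < d := hc'0.trans hd1
  have hlog : Real.log c' < Real.log d := Real.log_lt_log hc'0 hd1
  obtain ⟨ρ, hρ, hball⟩ := Metric.eventually_nhds_iff_ball.1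
    ((hf.logIneq_conj.continuousAt hf.conj_nonneg hw).eventually (lt_mem_nhds hd2))
  set κ := min (ρ / 2) (Real.log d - Real.log c') with hκ
  have hκ0 : 0 < κ := lt_min (by positivity) (by linarith)
  have h1 := h.eventually_le_exp hF hf (s := 0) le_rfl 0 0 w (Real.log c') hκ0 (fun x => by
    have hmem : w + (ρ / 2) • (‖x‖⁻¹ • x) ∈ Metric.ball w ρ := by
      rw [mem_ball_iff_norm, add_sub_cancel_left, norm_smul, Real.norm_of_nonneg (by positivity)]
      have : ρ / 2 * ‖‖x‖⁻¹ • x‖ ≤ ρ / 2 * 1 := by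
        gcongr
        exact norm_unit_le x
      linarith
    have h2 := (hball _ hmem).le
    rw [← Real.exp_log hd0, hf.exp_le_conj_iff] at h2
    refine (h2 x).trans (Real.exp_le_exp.2 ?_)
    rw [inner_add_right, inner_smul_right, inner_unit, real_inner_comm]
    have h3 : κ * ‖x‖ ≤ ρ / 2 * ‖x‖ := by
      gcongr
      exact min_le_left _ _
    have h4 : κ ≤ Real.log d - Real.log c' := min_le_right _ _
    linarith)
  filter_upwards [h1] with m hm
  refine ((le_max_left _ _).trans_lt hc1).trans_le ?_
  rw [← Real.exp_log hc'0, (hF m).exp_le_conj_iff]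
  intro x
  refine (hm x).trans (Real.exp_le_exp.2 ?_)
  rw [real_inner_comm]
  linarith

/-- A point witnessing that the infimum is below `c` can be moved into the interior of the support,
where lower bounds for `f` persist along the sequence. -/
theorem AEConv.eventually_conj_lt (h : AEConv F f) (hF : ∀ m, IsLC (F m)) (hf : IsLC f) {w : E n}
    {c : ℝ} (hc : conj f w < c) : ∀ᶠ m in atTop, conj (F m) w < c := by
  have hc0 : 0 < c := (hf.conj_nonneg w).trans_lt hc
  have h1 := not_le.2 hc
  rw [hf.le_conj_iff, not_forall] at h1
  obtain ⟨x, hx⟩ := h1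
  rw [not_le, ← div_lt_iff₀ hc0] at hx
  obtain ⟨d, hd1, hd2⟩ := exists_between hx
  have hd0 : 0 < d := lt_of_le_of_lt (by positivity) hd1
  have hcont : Continuous (fun y : E n => Real.exp (-⟪y, w⟫) / c) := by fun_prop
  obtain ⟨y, hy1, hy2, hy3⟩ := hf.exists_interior_near hd0.le hd2
    (hcont.continuousAt.eventually (gt_mem_nhds hd1))
  filter_upwards [h.eventually_lt_point hF hf hy3 hy2] with m hm
  by_contra! hcon
  have h2 := (hF m).le_conj_iff.1 hcon y
  rw [← le_div_iff₀ hc0] at h2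
  exact absurd (hm.trans_le (h2.trans hy1.le)) (lt_irrefl _)

theorem AEConv.conj (h : AEConv F f) (hF : ∀ m, IsLC (F m)) (hf : IsLC f) :
    AEConv (fun m => conj (F m)) (conj f) := by
  filter_upwards [hf.logIneq_conj.ae_interior_or hf.conj_nonneg] with w hw
  rw [tendsto_order]
  refine ⟨fun c hc => ?_, fun c hc => h.eventually_conj_lt hF hf hc⟩
  rcases hw with hw | hw
  · exact h.eventually_lt_conj hF hf hw hc
  · rw [hw] at hc
    exact Eventually.of_forall fun m => hc.trans_le ((hF m).conj_nonneg w)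

theorem AEConv.tendsto_santaloInt (h : AEConv F f) (hF : ∀ m, IsLC (F m)) (hf : IsLC f) {z : E n}
    (hz : z ∈ interior (Function.support f)) :
    Tendsto (fun m => santaloInt (F m) z) atTop (𝓝 (santaloInt f z)) := by
  have hfz : 0 < f z := hf.mem_support.1 (interior_subset hz)
  obtain ⟨r, hr, hball⟩ := h.exists_ball hF hf hz (half_lt_self hfz)
  refine tendsto_lintegral_filter_of_dominated_convergence
    (fun w => ENNReal.ofReal (Real.exp (-Real.log (f z / 2) - r / 2 * ‖w‖)))
    (Eventually.of_forall fun m => ((hF m).measurable_tilt z).ennreal_ofReal) ?_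
    (integrable_exp_decay (by positivity) _).lintegral_lt_top.ne ?_
  · filter_upwards [hball] with m hm
    exact Eventually.of_forall fun w => ENNReal.ofReal_le_ofReal
      ((hF m).tilt_le hr (half_pos hfz) (fun y hy => (hm y hy).le) w)
  · filter_upwards [h.conj hF hf] with w hw
    exact ENNReal.tendsto_ofReal (hw.const_mul _)

theorem IsLC.santaloInt_lt_top (hf : IsLC f) {z : E n}
    (hz : z ∈ interior (Function.support f)) : santaloInt f z < ∞ := by
  have hfz : 0 < f z := hf.mem_support.1 (interior_subset hz)
  obtain ⟨r, hr, hball⟩ := Metric.eventually_nhds_iff_ball.1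
    (hf.eventually_lt hz (half_lt_self hfz))
  refine lt_of_le_of_lt (lintegral_mono fun w => ENNReal.ofReal_le_ofReal
    (hf.tilt_le hr (half_pos hfz) (fun y hy => (hball y hy).le) w)) ?_
  exact (integrable_exp_decay (by positivity) _).lintegral_lt_top

/-- Uniform coercivity bounds the points `z m`, and Fatou's lemma gives lower semicontinuity along a
convergent subsequence. Constant sequences yield existence of a minimizer, general ones continuity.
-/
theorem AEConv.exists_subseq_santaloInt_le (h : AEConv F f) (hF : ∀ m, IsLC (F m)) (hf : IsLC f)
    {z : ℕ → E n} {C : ℕ → ℝ≥0∞} {C0 : ℝ≥0∞} (hC : Tendsto C atTop (𝓝 C0)) (hC0 : C0 ≠ ∞)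
    (hz : ∀ m, santaloInt (F m) (z m) ≤ C m) :
    ∃ (z0 : E n) (φ : ℕ → ℕ), StrictMono φ ∧ Tendsto (z ∘ φ) atTop (𝓝 z0) ∧
      santaloInt f z0 ≤ C0 := by
  obtain ⟨a, b, ha, -, hab⟩ := h.exists_decay hF hf
  set V := volume (Metric.ball (0 : E n) (a / 4)) with hV
  have hVpos : 0 < V := Metric.measure_ball_pos _ _ (by positivity)
  have hVtop : V < ∞ := measure_ball_lt_top
  have hbdd : ∀ᶠ m in atTop, z m ∈ Metric.closedBall (0 : E n)
      (4 / a * (b + ((C0 + 1) / V).toReal)) := by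
    filter_upwards [hab, hC.eventually (gt_mem_nhds (ENNReal.lt_add_right hC0 one_ne_zero))]
      with m hm hCm
    have h1 := (((hF m).santaloInt_ge ha hm (z m)).trans (hz m)).trans hCm.le
    rw [← ENNReal.le_div_iff_mul_le (Or.inl hVpos.ne') (Or.inl hVtop.ne)] at h1
    have h2 : (C0 + 1) / V ≠ ∞ :=
      ENNReal.div_ne_top (ENNReal.add_ne_top.2 ⟨hC0, ENNReal.one_ne_top⟩) hVpos.ne'
    have h3 := (ENNReal.ofReal_le_iff_le_toReal h2).1 h1
    have h4 := Real.add_one_le_exp (‖z m‖ * a / 4 - b)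
    rw [mem_closedBall_zero_iff]
    have h5 : ‖z m‖ * a / 4 ≤ b + ((C0 + 1) / V).toReal := by linarith
    calc ‖z m‖ = 4 / a * (‖z m‖ * a / 4) := by field_simp
      _ ≤ _ := by gcongr
  obtain ⟨z0, -, φ, hφ, hlim⟩ := tendsto_subseq_of_frequently_bounded
    Metric.isBounded_closedBall hbdd.frequently
  refine ⟨z0, φ, hφ, hlim, ?_⟩
  have hae : ∀ᵐ w, ENNReal.ofReal (Real.exp ⟪z0, w⟫ * LogConcave.conj f w) ≤
      liminf (fun m => ENNReal.ofReal
        (Real.exp ⟪z (φ m), w⟫ * LogConcave.conj (F (φ m)) w)) atTop := by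
    filter_upwards [(h.comp hφ).conj (fun m => hF (φ m)) hf] with w hw
    have h1 : Tendsto (fun m => ENNReal.ofReal
        (Real.exp ⟪z (φ m), w⟫ * LogConcave.conj (F (φ m)) w)) atTop
        (𝓝 (ENNReal.ofReal (Real.exp ⟪z0, w⟫ * LogConcave.conj f w))) := by
      refine ENNReal.tendsto_ofReal (Tendsto.mul ?_ hw)
      have hcont : Continuous (fun y : E n => Real.exp ⟪y, w⟫) := by fun_prop
      exact (hcont.tendsto z0).comp hlim
    exact h1.liminf_eq.ge
  calc santaloInt f z0 ≤ ∫⁻ w, liminf (fun m => ENNReal.ofReal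
        (Real.exp ⟪z (φ m), w⟫ * LogConcave.conj (F (φ m)) w)) atTop := lintegral_mono_ae hae
    _ ≤ liminf (fun m => santaloInt (F (φ m)) (z (φ m))) atTop :=
        lintegral_liminf_le fun m => ((hF _).measurable_tilt _).ennreal_ofReal
    _ ≤ liminf (fun m => C (φ m)) atTop :=
        liminf_le_liminf (Eventually.of_forall fun m => hz (φ m))
    _ = C0 := (hC.comp hφ.tendsto_atTop).liminf_eq

theorem IsLC.exists_santaloPoint (hf : IsLC f) : ∃ z, IsSantaloPoint f z := by
  obtain ⟨x, hx⟩ := hf.nondegenerate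
  have hV : (⨅ z, santaloInt f z) ≠ ∞ := ((iInf_le _ x).trans_lt (hf.santaloInt_lt_top hx)).ne
  have hex : ∀ m : ℕ, ∃ z, santaloInt f z ≤ (⨅ z, santaloInt f z) + ((m : ℝ≥0∞) + 1)⁻¹ := by
    intro m
    have hlt : (⨅ z, santaloInt f z) < (⨅ z, santaloInt f z) + ((m : ℝ≥0∞) + 1)⁻¹ :=
      ENNReal.lt_add_right hV (by simp)
    obtain ⟨z, hz⟩ := iInf_lt_iff.1 hlt
    exact ⟨z, hz.le⟩
  choose z hz using hex
  have hC : Tendsto (fun m : ℕ => (⨅ z, santaloInt f z) + ((m : ℝ≥0∞) + 1)⁻¹) atTop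
      (𝓝 (⨅ z, santaloInt f z)) := by
    have h1 : Tendsto (fun m : ℕ => (((m + 1 : ℕ) : ℝ≥0∞))⁻¹) atTop (𝓝 0) :=
      ENNReal.tendsto_inv_nat_nhds_zero.comp (tendsto_add_atTop_nat 1)
    simpa using h1.const_add (⨅ z, santaloInt f z)
  obtain ⟨z0, φ, -, -, h0⟩ := (AEConv.const f).exists_subseq_santaloInt_le (fun _ => hf) hf hC hV hz
  exact ⟨z0, (isSantaloPoint_iff f z0).2 fun w => h0.trans (iInf_le _ w)⟩

theorem IsLC.santaloInt_min_lt_top (hf : IsLC f) {z : E n} (hz : IsSantaloPoint f z) :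
    santaloInt f z < ∞ := by
  obtain ⟨x, hx⟩ := hf.nondegenerate
  exact ((isSantaloPoint_iff f z).1 hz x).trans_lt (hf.santaloInt_lt_top hx)

theorem IsLC.eventually_conj_pos (hf : IsLC f) : ∀ᶠ w in 𝓝 (0 : E n), 0 < conj f w := by
  obtain ⟨a, b, ha, hab⟩ := hf.exists_decay
  filter_upwards [Metric.closedBall_mem_nhds (0 : E n) ha] with w hw
  exact (Real.exp_pos _).trans_le (hf.exp_le_conj_of_decay hab (by simpa using hw))

theorem eq_of_exp_midpoint {p q : ℝ}
    (h : Real.exp (p / 2 + q / 2) = (Real.exp p + Real.exp q) / 2) : p = q := by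
  have hp : Real.exp p = Real.exp (p / 2) ^ 2 := by rw [← Real.exp_nat_mul]; congr 1; ring
  have hq : Real.exp q = Real.exp (q / 2) ^ 2 := by rw [← Real.exp_nat_mul]; congr 1; ring
  rw [Real.exp_add, hp, hq] at h
  have h1 : (Real.exp (p / 2) - Real.exp (q / 2)) ^ 2 = 0 := by linarith
  have h2 := Real.exp_injective (sub_eq_zero.1 (pow_eq_zero_iff two_ne_zero |>.1 h1))
  linarith

theorem exp_midpoint_le (p q : ℝ) :
    Real.exp (p / 2 + q / 2) ≤ (Real.exp p + Real.exp q) / 2 := by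
  have hp : Real.exp p = Real.exp (p / 2) ^ 2 := by rw [← Real.exp_nat_mul]; congr 1; ring
  have hq : Real.exp q = Real.exp (q / 2) ^ 2 := by rw [← Real.exp_nat_mul]; congr 1; ring
  rw [Real.exp_add, hp, hq]
  linarith [sq_nonneg (Real.exp (p / 2) - Real.exp (q / 2))]

/-- By minimality the midpoint inequality for the exponential must be an equality almost everywhere.
Where the polar is positive, equality means that `z1` and `z2` pair equally with `w`. This fails
near a small multiple of `z1 - z2` if the points differ. -/
theorem IsLC.santaloPoint_unique (hf : IsLC f) {z1 z2 : E n} (h1 : IsSantaloPoint f z1)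
    (h2 : IsSantaloPoint f z2) : z1 = z2 := by
  have hV := hf.santaloInt_min_lt_top h1
  have heq : santaloInt f z1 = santaloInt f z2 :=
    le_antisymm ((isSantaloPoint_iff f z1).1 h1 z2) ((isSantaloPoint_iff f z2).1 h2 z1)
  set z := (1 / 2 : ℝ) • z1 + (1 / 2 : ℝ) • z2 with hz
  have hzw : ∀ w, ⟪z, w⟫ = ⟪z1, w⟫ / 2 + ⟪z2, w⟫ / 2 := by
    intro w
    rw [hz, inner_add_left, inner_smul_left, inner_smul_left]
    simp
    ring
  set G : E n → ℝ≥0∞ := fun w => ENNReal.ofReal (1 / 2) *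
    (ENNReal.ofReal (Real.exp ⟪z1, w⟫ * conj f w) +
      ENNReal.ofReal (Real.exp ⟪z2, w⟫ * conj f w)) with hG
  have hGeq : ∀ w, G w =
      ENNReal.ofReal ((Real.exp ⟪z1, w⟫ + Real.exp ⟪z2, w⟫) / 2 * conj f w) := by
    intro w
    have hn := hf.conj_nonneg w
    simp only [hG]
    rw [← ENNReal.ofReal_add (by positivity) (by positivity), ← ENNReal.ofReal_mul (by norm_num)]
    congr 1
    ring
  have hGint : ∫⁻ w, G w = santaloInt f z1 := by
    rw [hG, lintegral_const_mul' _ _ ENNReal.ofReal_ne_top,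
      lintegral_add_left (hf.measurable_tilt z1).ennreal_ofReal]
    change _ * (santaloInt f z1 + santaloInt f z2) = _
    rw [← heq, ← two_mul, ← mul_assoc]
    have : ENNReal.ofReal (1 / 2) * 2 = 1 := by
      rw [show (2 : ℝ≥0∞) = ENNReal.ofReal 2 by simp, ← ENNReal.ofReal_mul (by norm_num)]
      norm_num
    rw [this, one_mul]
  have hle : ∀ w, ENNReal.ofReal (Real.exp ⟪z, w⟫ * conj f w) ≤ G w := by
    intro w
    rw [hGeq, hzw]
    refine ENNReal.ofReal_le_ofReal (mul_le_mul_of_nonneg_right (exp_midpoint_le _ _)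
      (hf.conj_nonneg w))
  have hGm : Measurable G :=
    ((hf.measurable_tilt z1).ennreal_ofReal.add (hf.measurable_tilt z2).ennreal_ofReal).const_mul _
  have hae := ae_eq_of_ae_le_of_lintegral_le (Eventually.of_forall hle)
    (((lintegral_mono hle).trans_eq hGint).trans_lt hV).ne hGm.aemeasurable
    (hGint.trans_le ((isSantaloPoint_iff f z1).1 h1 z))
  by_contra hne
  · have hne' : z1 - z2 ≠ 0 := sub_ne_zero.2 hne
    have hU := hf.eventually_conj_pos
    obtain ⟨ρ, hρ, hball⟩ := Metric.eventually_nhds_iff_ball.1 hU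
    obtain ⟨t, ht, htρ⟩ : ∃ t : ℝ, 0 < t ∧ t * ‖z1 - z2‖ < ρ := by
      refine ⟨ρ / (2 * ‖z1 - z2‖), by positivity, ?_⟩
      have : 0 < ‖z1 - z2‖ := norm_pos_iff.2 hne'
      field_simp
      linarith
    set w0 := t • (z1 - z2)
    have hw0 : ∀ᶠ w in 𝓝 w0, ⟪z1 - z2, w⟫ ≠ 0 := by
      have hcont : Continuous (fun w : E n => ⟪z1 - z2, w⟫) := by fun_prop
      refine hcont.continuousAt.eventually_ne ?_
      rw [inner_smul_right, real_inner_self_eq_norm_sq]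
      have : 0 < ‖z1 - z2‖ := norm_pos_iff.2 hne'
      positivity
    have hw1 : Metric.ball (0 : E n) ρ ∈ 𝓝 w0 := by
      refine Metric.isOpen_ball.mem_nhds ?_
      rw [mem_ball_zero_iff, norm_smul, Real.norm_of_nonneg ht.le]
      exact htρ
    obtain ⟨w, ⟨hwa, hwb⟩, hwc⟩ := mem_closure_iff_nhds.1 (Measure.dense_of_ae hae w0) _
      (hw0.and hw1)
    have hwc' : ENNReal.ofReal (Real.exp ⟪z, w⟫ * conj f w) = G w := hwc
    have hk := hball w hwb
    rw [hGeq, ENNReal.ofReal_eq_ofReal_iff (by positivity) (by positivity)] at hwc'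
    have h3 := mul_right_cancel₀ hk.ne' hwc'
    rw [hzw] at h3
    have h4 := eq_of_exp_midpoint h3
    exact hwa (by rw [inner_sub_left, h4, sub_self])

/-- Otherwise some hyperplane through `z`, with normal `u`, has the support on one side. The tilted
polar then never falls below its value at the origin along the ray spanned by `u`, although it is
integrable and log-concave and so has bounded superlevel sets. -/
theorem IsLC.santaloPoint_mem_interior (hf : IsLC f) {z : E n} (hz : IsSantaloPoint f z) :
    z ∈ interior (Function.support f) := by
  by_contra hcon
  obtain ⟨l, hl⟩ := geometric_hahn_banach_open_point hf.convex_support.interior isOpen_interior hcon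
  set u : E n := (InnerProductSpace.toDual ℝ (E n)).symm l with hu
  have hlu : ∀ x, l x = ⟪u, x⟫ := fun x => (InnerProductSpace.toDual_symm_apply).symm
  have hsupp : ∀ x ∈ Function.support f, ⟪u, x⟫ ≤ ⟪u, z⟫ := by
    intro x hx
    have hcl : x ∈ closure (interior (Function.support f)) := by
      rw [hf.convex_support.closure_interior_eq_closure_of_nonempty_interior hf.nondegenerate]
      exact subset_closure hx
    refine closure_minimal (fun y hy => ?_)
      (isClosed_le (by fun_prop) continuous_const : IsClosed {x | ⟪u, x⟫ ≤ ⟪u, z⟫}) hcl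
    have := hl y hy
    rw [hlu, hlu] at this
    exact this.le
  have hmono : ∀ t : ℝ, 0 ≤ t → conj f 0 ≤ Real.exp ⟪z, t • u⟫ * conj f (t • u) := by
    intro t ht
    rw [← div_le_iff₀' (Real.exp_pos _), hf.le_conj_iff]
    intro x
    rw [mul_div_assoc', div_le_iff₀ (Real.exp_pos _), ← Real.exp_add]
    have h1 := (hf.le_conj_iff (w := 0)).1 le_rfl x
    rw [inner_zero_right, neg_zero, Real.exp_zero] at h1
    by_cases hx : f x = 0
    · rw [hx, zero_mul]; positivity
    · refine h1.trans (Real.one_le_exp ?_)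
      rw [inner_smul_right, inner_smul_right, real_inner_comm, real_inner_comm u z]
      have := mul_le_mul_of_nonneg_left (hsupp x hx) ht
      linarith
  have hLC : IsLC (fun w => Real.exp ⟪z, w⟫ * conj f w) :=
    { nonneg := fun w => mul_nonneg (Real.exp_pos _).le (hf.conj_nonneg w)
      convex := convex_epi_iff.2 (hf.logIneq_tilt z)
      upperSemicontinuous := hf.upperSemicontinuous_tilt z
      integrable := by
        refine ⟨(hf.measurable_tilt z).aestronglyMeasurable, ?_⟩
        rw [hasFiniteIntegral_iff_ofReal (Eventually.of_forall fun w =>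
          mul_nonneg (Real.exp_pos _).le (hf.conj_nonneg w))]
        exact hf.santaloInt_min_lt_top hz
      nondegenerate := ⟨0, mem_interior_iff_mem_nhds.2 (hf.eventually_conj_pos.mono fun w hw =>
        (mul_pos (Real.exp_pos _) hw).ne')⟩ }
  have hu0 : u ≠ 0 := by
    rintro h0
    obtain ⟨y, hy⟩ := hf.nondegenerate
    have := hl y hy
    rw [hlu, hlu, h0, inner_zero_left, inner_zero_left] at this
    exact lt_irrefl _ this
  have hk : 0 < conj f 0 := hf.eventually_conj_pos.self_of_nhds
  obtain ⟨R, hR⟩ := isBounded_iff_forall_norm_le.1 (hLC.isBounded_superlevel hk)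
  have hun : 0 < ‖u‖ := norm_pos_iff.2 hu0
  have := hR (((|R| + 1) / ‖u‖) • u) (hmono _ (by positivity))
  rw [norm_smul, Real.norm_of_nonneg (by positivity), div_mul_cancel₀ _ hun.ne'] at this
  linarith [le_abs_self R]

/-- Continuity of the Santaló point along a subsequence. -/
theorem AEConv.exists_subseq_tendsto_santalo (h : AEConv F f) (hF : ∀ m, IsLC (F m)) (hf : IsLC f)
    {z : ℕ → E n} {z0 : E n} (hz : ∀ m, IsSantaloPoint (F m) (z m)) (hz0 : IsSantaloPoint f z0) :
    ∃ φ : ℕ → ℕ, StrictMono φ ∧ Tendsto (z ∘ φ) atTop (𝓝 z0) := by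
  -- The fixed point `z0` serves as competitor for every `F m`. Its values converge because it is
  -- interior to the support of `f`.
  obtain ⟨y, φ, hφ, hlim, hle⟩ := h.exists_subseq_santaloInt_le hF hf
    (h.tendsto_santaloInt hF hf (hf.santaloPoint_mem_interior hz0))
    (hf.santaloInt_min_lt_top hz0).ne (fun m => (isSantaloPoint_iff _ _).1 (hz m) z0)
  have hy : IsSantaloPoint f y :=
    (isSantaloPoint_iff f y).2 fun w => hle.trans ((isSantaloPoint_iff f z0).1 hz0 w)
  rw [hf.santaloPoint_unique hz0 hy]
  exact ⟨φ, hφ, hlim⟩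

/-- The polar of `f ∘ A` is, up to an exponential factor, the polar of `f` composed with the adjoint
of the inverse linear part. Hence the functional of `f ∘ A` at `y` is a constant multiple of that of
`f` at `A y`. -/
theorem IsLC.santaloPoint_comp (hf : IsLC f) {z : E n} (hz : IsSantaloPoint f z)
    (A : E n ≃ᵃ[ℝ] E n) : IsSantaloPoint (fun x => f (A x)) (A.symm z) := by
  have hfA := hf.comp_affine A
  set L : E n →L[ℝ] E n := LinearMap.toContinuousLinearMap (A.symm.linear : E n →ₗ[ℝ] E n)
    with hL
  set M : E n →L[ℝ] E n := LinearMap.toContinuousLinearMap (A.linear : E n →ₗ[ℝ] E n) with hM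
  have hLA : ∀ y, A.symm y = L y + A.symm 0 := affineEquiv_apply A.symm
  have hLM : ∀ x, L (M x) = x := fun x => A.linear.symm_apply_apply x
  have hML : ∀ x, M (L x) = x := fun x => A.linear.apply_symm_apply x
  let T : E n ≃ₗ[ℝ] E n :=
    { toLinearMap := (ContinuousLinearMap.adjoint L : E n →L[ℝ] E n).toLinearMap
      invFun := ContinuousLinearMap.adjoint M
      left_inv := fun x => by
        change (ContinuousLinearMap.adjoint M) ((ContinuousLinearMap.adjoint L) x) = x
        exact ext_inner_left ℝ fun y => by
          rw [ContinuousLinearMap.adjoint_inner_right, ContinuousLinearMap.adjoint_inner_right, hLM]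
      right_inv := fun x => by
        change (ContinuousLinearMap.adjoint L) ((ContinuousLinearMap.adjoint M) x) = x
        exact ext_inner_left ℝ fun y => by
          rw [ContinuousLinearMap.adjoint_inner_right, ContinuousLinearMap.adjoint_inner_right,
            hML] }
  have hT : ∀ w, T.toAffineEquiv w = ContinuousLinearMap.adjoint L w := fun _ => rfl
  have hconj : ∀ w, conj (fun x => f (A x)) w =
      Real.exp (-⟪A.symm 0, w⟫) * conj f (T.toAffineEquiv w) := by
    intro w
    refine eq_of_forall_le_iff fun c => ?_
    rw [hfA.le_conj_iff, ← div_le_iff₀' (Real.exp_pos _), hf.le_conj_iff]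
    refine A.toEquiv.forall_congr fun x => ?_
    change f (A x) * c ≤ _ ↔ f (A x) * (c / _) ≤ Real.exp (-⟪A x, _⟫)
    have h1 : ⟪x, w⟫ = ⟪A x, T.toAffineEquiv w⟫ + ⟪A.symm 0, w⟫ := by
      rw [hT, ContinuousLinearMap.adjoint_inner_right, ← inner_add_left, ← hLA]
      simp
    rw [mul_div_assoc', div_le_iff₀ (Real.exp_pos _), ← Real.exp_add, h1]
    congr! 2
    ring
  have key : ∀ y, santaloInt (fun x => f (A x)) y =
      ENNReal.ofReal (jac T.toAffineEquiv)⁻¹ * santaloInt f (A y) := by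
    intro y
    unfold santaloInt
    rw [← lintegral_comp_affineEquiv]
    refine lintegral_congr fun w => ?_
    rw [hconj, ← mul_assoc, ← Real.exp_add]
    congr 3
    have h1 : y = L (A y) + A.symm 0 := by rw [← hLA]; simp
    rw [hT, ContinuousLinearMap.adjoint_inner_right]
    conv_lhs => rw [h1]
    rw [inner_add_left]
    ring
  rw [isSantaloPoint_iff] at hz ⊢
  intro w
  rw [key, key, A.apply_symm_apply]
  gcongr
  exact hz _

end Santalo

/-! ### Caps of the epigraph and the floating function -/

/-- The volume between the graph of the potential of `f` and the affine function
`x ↦ ⟪w, x⟫ + b` above it. -/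
noncomputable def capVolume {n : ℕ} (f : E n → ℝ) (w : E n) (b : ℝ) : ℝ≥0∞ :=
  ∫⁻ x, ENNReal.ofReal (Real.posLog (Real.exp (⟪w, x⟫ + b) * f x))

/-- The infimum of the functions `exp (-ℓ)`, where `ℓ` is affine and cuts off a cap of volume at
most `v` from the epigraph. -/
noncomputable def floatFun {n : ℕ} (f : E n → ℝ) (v : ℝ≥0∞) (x : E n) : ℝ :=
  ⨅ p : {p : E n × ℝ // capVolume f p.1 p.2 ≤ v}, Real.exp (-(⟪p.1.1, x⟫ + p.1.2))

theorem posLog_exp_mul {t s : ℝ} (hs : 0 < s) :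
    Real.posLog (Real.exp t * s) = max 0 (t + Real.log s) := by
  rw [Real.posLog_apply, Real.log_mul (Real.exp_pos t).ne' hs.ne', Real.log_exp]

section Cap

variable {n : ℕ} {f : E n → ℝ}

theorem IsLC.capVolume_eq_zero_of_le (hf : IsLC f) {w : E n} {b : ℝ}
    (h : ∀ x, f x ≤ Real.exp (-(⟪w, x⟫ + b))) : capVolume f w b = 0 := by
  have : ∀ x, ENNReal.ofReal (Real.posLog (Real.exp (⟪w, x⟫ + b) * f x)) = 0 := by
    intro x
    have h1 : Real.exp (⟪w, x⟫ + b) * f x ≤ 1 := by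
      have := mul_le_mul_of_nonneg_left (h x) (Real.exp_pos (⟪w, x⟫ + b)).le
      rwa [← Real.exp_add, add_neg_cancel, Real.exp_zero] at this
    rw [(Real.posLog_eq_zero_iff _).2 (by
      rwa [abs_of_nonneg (mul_nonneg (Real.exp_pos _).le (hf.nonneg x))]), ENNReal.ofReal_zero]
  simp [capVolume, this]

theorem IsLC.exists_capVolume_zero (hf : IsLC f) :
    ∃ a b : ℝ, 0 < a ∧ ∀ w : E n, ‖w‖ ≤ a → capVolume f w (-b) = 0 := by
  obtain ⟨a, b, ha, hab⟩ := hf.exists_decay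
  refine ⟨a, b, ha, fun w hw => hf.capVolume_eq_zero_of_le fun x => (hab x).trans ?_⟩
  rw [Real.exp_le_exp]
  have h1 := real_inner_le_norm w x
  have h2 : ‖w‖ * ‖x‖ ≤ a * ‖x‖ := by gcongr
  linarith

theorem IsLC.le_floatFun_iff (hf : IsLC f) {v : ℝ≥0∞} {x : E n} {c : ℝ} :
    c ≤ floatFun f v x ↔ ∀ w b, capVolume f w b ≤ v → c ≤ Real.exp (-(⟪w, x⟫ + b)) := by
  have hne : Nonempty {p : E n × ℝ // capVolume f p.1 p.2 ≤ v} := by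
    obtain ⟨a, b, ha, h⟩ := hf.exists_capVolume_zero
    exact ⟨⟨(0, -b), by rw [h 0 (by simpa using ha.le)]; exact zero_le⟩⟩
  unfold floatFun
  rw [le_ciInf_iff ⟨0, by rintro _ ⟨p, rfl⟩; positivity⟩]
  exact ⟨fun h w b hwb => h ⟨(w, b), hwb⟩, fun h p => h _ _ p.2⟩

theorem IsLC.floatFun_le (hf : IsLC f) {v : ℝ≥0∞} {w : E n} {b : ℝ} (h : capVolume f w b ≤ v)
    (x : E n) : floatFun f v x ≤ Real.exp (-(⟪w, x⟫ + b)) :=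
  hf.le_floatFun_iff.1 le_rfl w b h

theorem IsLC.exp_le_floatFun_iff (hf : IsLC f) {v : ℝ≥0∞} {x : E n} {s : ℝ} :
    Real.exp s ≤ floatFun f v x ↔ ∀ w b, capVolume f w b ≤ v → ⟪w, x⟫ + b ≤ -s := by
  rw [hf.le_floatFun_iff]
  refine forall_congr' fun w => forall_congr' fun b => forall_congr' fun _ => ?_
  rw [Real.exp_le_exp, le_neg]

theorem IsLC.floatFun_nonneg (hf : IsLC f) (v : ℝ≥0∞) (x : E n) : 0 ≤ floatFun f v x :=
  hf.le_floatFun_iff.2 fun _ _ _ => (Real.exp_pos _).le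

/-- Functionals cutting off small caps are bounded near interior points. -/
theorem affine_le_of_capVolume_le {x w : E n} {b r c : ℝ} {v : ℝ≥0∞} (hv : v ≠ ∞) (hr : 0 < r)
    (hc : 0 < c) (h : ∀ y ∈ Metric.ball x r, c ≤ f y) (hcap : capVolume f w b ≤ v) :
    ⟪w, x⟫ + b + ‖w‖ * r / 4 ≤
      (v / volume (Metric.ball (0 : E n) (r / 4))).toReal - Real.log c := by
  set V := volume (Metric.ball (0 : E n) (r / 4)) with hV
  have hVpos : 0 < V := Metric.measure_ball_pos _ _ (by positivity)
  have hVtop : V < ∞ := measure_ball_lt_top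
  -- On a ball of radius `r / 4`, shifted by `r / 2` in the direction of `w`, the cap has at least
  -- this height.
  have h1 : ENNReal.ofReal (⟪w, x⟫ + b + ‖w‖ * r / 4 + Real.log c) * V ≤ v := by
    refine le_trans ?_ hcap
    rw [hV, ← Measure.addHaar_ball_center volume (x + (r / 2) • (‖w‖⁻¹ • w)), ← setLIntegral_const]
    refine (setLIntegral_mono' measurableSet_ball fun y hy => ?_).trans
      (setLIntegral_le_lintegral _ _)
    obtain ⟨h2, h3⟩ := inner_ge_of_mem_ball hr hy
    have h4 := h y (mem_ball_iff_norm.2 h3)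
    rw [posLog_exp_mul (hc.trans_le h4)]
    refine ENNReal.ofReal_le_ofReal (le_max_of_le_right ?_)
    have := Real.log_le_log hc h4
    linarith
  rw [← ENNReal.le_div_iff_mul_le (Or.inl hVpos.ne') (Or.inl hVtop.ne)] at h1
  have h3 := (ENNReal.ofReal_le_iff_le_toReal (ENNReal.div_ne_top hv hVpos.ne')).1 h1
  linarith

/-- An infimum of exponentials of affine functions is log-concave and upper semicontinuous. Decay
comes from the slopes of norm at most `a` that cut off nothing, and positivity near `z` from the
bound on admissible affine functions in `affine_le_of_capVolume_le`. -/
theorem IsLC.isLC_floatFun (hf : IsLC f) {v : ℝ≥0∞} (hv : v ≠ ∞) : IsLC (floatFun f v) := by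
  obtain ⟨a, b, ha, h⟩ := hf.exists_capVolume_zero
  obtain ⟨z, r, c, hr, hc, -, hball⟩ := hf.exists_ball_le
  refine isLC_of_decay (hf.floatFun_nonneg v) ?_ ?_ ha (b := b) (fun x => ?_) (x := z) ?_
  · intro x y s t p q hp hq hpq hs ht
    rw [hf.exp_le_floatFun_iff] at *
    intro w d hwd
    have h1 := mul_le_mul_of_nonneg_left (hs w d hwd) hp
    have h2 := mul_le_mul_of_nonneg_left (ht w d hwd) hq
    rw [inner_add_right, inner_smul_right, inner_smul_right]
    have : d = p * d + q * d := by rw [← add_mul, hpq, one_mul]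
    linarith
  · rw [upperSemicontinuous_iff_isClosed_preimage]
    intro c
    have : floatFun f v ⁻¹' Set.Ici c = ⋂ w : E n, ⋂ b : ℝ, ⋂ _ : capVolume f w b ≤ v,
        {x | c ≤ Real.exp (-(⟪w, x⟫ + b))} := by
      ext x
      simp [hf.le_floatFun_iff]
    rw [this]
    exact isClosed_iInter fun w => isClosed_iInter fun b => isClosed_iInter fun _ =>
      isClosed_le continuous_const (by fun_prop)
  · have hw : ‖a • (‖x‖⁻¹ • x)‖ ≤ a := by
      rw [norm_smul, Real.norm_of_nonneg ha.le]
      exact mul_le_of_le_one_right ha.le (norm_unit_le x)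
    refine (hf.floatFun_le ((h _ hw).trans_le zero_le) x).trans_eq ?_
    rw [inner_smul_left, real_inner_comm x (_ • x), inner_unit]
    simp
    ring
  · filter_upwards [Metric.ball_mem_nhds z (half_pos hr)] with y hy
    have hball' : ∀ u ∈ Metric.ball y (r / 2), c ≤ f u := fun u hu => hball u (by
      rw [Metric.mem_ball] at *
      linarith [dist_triangle u y z])
    refine (Real.exp_pos _).trans_le ((hf.exp_le_floatFun_iff
      (s := -((v / volume (Metric.ball (0 : E n) (r / 2 / 4))).toReal - Real.log c))).2 ?_)
    intro w d hwd
    have h1 := affine_le_of_capVolume_le hv (half_pos hr) hc hball' hwd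
    have h2 : 0 ≤ ‖w‖ * (r / 2) / 4 := by positivity
    linarith

/-- The floating function vanishes outside every half-space containing the support. -/
theorem IsLC.floatFun_eq_zero (hf : IsLC f) (v : ℝ≥0∞) {u x : E n} {β : ℝ}
    (hβ : ∀ y ∈ Function.support f, β ≤ ⟪u, y⟫) (hx : ⟪u, x⟫ < β) : floatFun f v x = 0 := by
  refine le_antisymm ?_ (hf.floatFun_nonneg v x)
  by_contra! hpos
  obtain ⟨a, b, ha, hab⟩ := hf.exists_decay
  have key : ∀ t : ℝ, 0 ≤ t → floatFun f v x ≤ Real.exp (b - t * (β - ⟪u, x⟫)) := by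
    intro t ht
    -- Outside the half-space containing the support, affine functions of arbitrarily large slope
    -- `t` cut off nothing. Letting `t` grow forces the value at `x` to vanish.
    have hcap : capVolume f (-(t • u)) (t * β - b) = 0 := by
      refine hf.capVolume_eq_zero_of_le fun y => ?_
      by_cases hy : f y = 0
      · rw [hy]; positivity
      · refine (hab y).trans (Real.exp_le_exp.2 ?_)
        rw [inner_neg_left, inner_smul_left]
        have h1 := mul_le_mul_of_nonneg_left (hβ y hy) ht
        have h2 : 0 ≤ a * ‖y‖ := by positivity
        simp
        linarith
    refine (hf.floatFun_le (hcap.trans_le zero_le) x).trans_eq ?_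
    rw [inner_neg_left, inner_smul_left]
    simp
    ring
  have h1 := key ((|b - Real.log (floatFun f v x)| + 1) / (β - ⟪u, x⟫)) (by
    have : 0 < β - ⟪u, x⟫ := sub_pos.2 hx
    positivity)
  rw [div_mul_cancel₀ _ (sub_pos.2 hx).ne', ← Real.log_le_iff_le_exp hpos] at h1
  linarith [le_abs_self (b - Real.log (floatFun f v x))]

end Cap

section Halfspaces

variable {n : ℕ} {f : E n → ℝ}

/-- By Fubini: the fibre over `x` is the interval from `-log (f x)` to `⟪w, x⟫ + b`, and is empty
where `f` vanishes. -/
theorem IsLC.volume_cap (hf : IsLC f) (w : E n) (b : ℝ) :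
    volume {p : E n × ℝ | p ∈ epi (potential f) ∧ p.2 ≤ ⟪w, p.1⟫ + b} = capVolume f w b := by
  have hm : MeasurableSet {p : E n × ℝ | p ∈ epi (potential f) ∧ p.2 ≤ ⟪w, p.1⟫ + b} := by
    simp only [mem_epi_potential]
    have h1 : Measurable (fun p : E n × ℝ => Real.exp (-p.2)) := by fun_prop
    have h2 : Measurable (fun p : E n × ℝ => ⟪w, p.1⟫ + b) := by fun_prop
    exact (measurableSet_le h1 (hf.measurable.comp measurable_fst)).inter
      (measurableSet_le measurable_snd h2)
  rw [Measure.volume_eq_prod, Measure.prod_apply hm]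
  refine lintegral_congr fun x => ?_
  have hs : Prod.mk x ⁻¹' {p : E n × ℝ | p ∈ epi (potential f) ∧ p.2 ≤ ⟪w, p.1⟫ + b} =
      {y | Real.exp (-y) ≤ f x ∧ y ≤ ⟪w, x⟫ + b} := by
    ext y
    simp [mem_epi_potential]
  rw [hs]
  rcases (hf.nonneg x).eq_or_lt with h0 | h0
  · have : {y : ℝ | Real.exp (-y) ≤ f x ∧ y ≤ ⟪w, x⟫ + b} = ∅ := by
      ext y
      simp [← h0, Real.exp_pos]
    rw [this]
    simp [← h0]
  · have : {y : ℝ | Real.exp (-y) ≤ f x ∧ y ≤ ⟪w, x⟫ + b} =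
        Set.Icc (-Real.log (f x)) (⟪w, x⟫ + b) := by
      ext y
      simp only [Set.mem_ofPred_eq, Set.mem_Icc]
      rw [← Real.le_log_iff_exp_le h0, neg_le]
    rw [this, Real.volume_Icc, posLog_exp_mul h0, ENNReal.ofReal_max, ENNReal.ofReal_zero,
      max_eq_right zero_le, sub_neg_eq_add]

theorem halfMinus_inter_eq {C : Set (E n × ℝ)} (u : E n) {c : ℝ} (hc : 0 < c) (β : ℝ) :
    halfMinus u c β ∩ C = {p | p ∈ C ∧ p.2 ≤ ⟪-(c⁻¹ • u), p.1⟫ + β / c} := by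
  ext p
  simp only [halfMinus, Set.mem_inter_iff, Set.mem_ofPred_eq, inner_neg_left, inner_smul_left]
  rw [and_comm]
  refine and_congr_right fun _ => ?_
  have : -((starRingEnd ℝ) c⁻¹ * ⟪u, p.1⟫) + β / c = (β - ⟪u, p.1⟫) / c := by
    simp
    ring
  rw [this, le_div_iff₀ hc]
  constructor <;> intro h <;> linarith

/-- The half-space contains a ball around `z` times a half-line of large heights, and this column
can be taken inside the epigraph. -/
theorem IsLC.volume_halfMinus_eq_top (hf : IsLC f) {u z : E n} {c β : ℝ}
    (hz : z ∈ interior (Function.support f)) (hc : c < 0 ∨ c = 0 ∧ ⟪u, z⟫ < β) :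
    volume (halfMinus u c β ∩ epi (potential f)) = ∞ := by
  have hT : ∃ T : ℝ, ∀ᶠ x in 𝓝 z, ∀ y, T ≤ y → ⟪u, x⟫ + c * y ≤ β := by
    have hcont : Continuous (fun x : E n => ⟪u, x⟫) := by fun_prop
    rcases hc with hc | ⟨rfl, hc⟩
    · refine ⟨(⟪u, z⟫ + 1 - β) / (-c), ?_⟩
      have h1 : ∀ᶠ x in 𝓝 z, ⟪u, x⟫ < ⟪u, z⟫ + 1 :=
        hcont.continuousAt.eventually (gt_mem_nhds (by linarith))
      filter_upwards [h1] with x hx y hy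
      rw [div_le_iff₀ (by linarith)] at hy
      linarith
    · refine ⟨0, ?_⟩
      filter_upwards [hcont.continuousAt.eventually (gt_mem_nhds hc)] with x hx y _
      rw [zero_mul, add_zero]
      exact hx.le
  obtain ⟨T, hT⟩ := hT
  have hfz : 0 < f z := hf.mem_support.1 (interior_subset hz)
  obtain ⟨r, hr, hball⟩ := Metric.eventually_nhds_iff_ball.1
    (hT.and (hf.eventually_lt hz (half_lt_self hfz)))
  have hsub : Metric.ball z r ×ˢ Set.Ici (max T (-Real.log (f z / 2))) ⊆
      halfMinus u c β ∩ epi (potential f) := by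
    rintro ⟨x, y⟩ ⟨hx, hy⟩
    obtain ⟨h1, h2⟩ := hball x hx
    have hy' := max_le_iff.1 (Set.mem_Ici.1 hy)
    refine ⟨h1 y hy'.1, mem_epi_potential.2 (le_trans ?_ h2.le)⟩
    rw [← Real.le_log_iff_exp_le (half_pos hfz)]
    linarith [hy'.2]
  refine top_le_iff.1 (le_trans ?_ (measure_mono hsub))
  rw [Measure.volume_eq_prod, Measure.prod_prod, Real.volume_Ici,
    ENNReal.mul_top (Metric.measure_ball_pos _ _ hr).ne']

/-- The sign of the vertical component `c` decides. For `c < 0` the cut-off volume is infinite. For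
`c = 0` an admissible half-space has the support on its far side, and beyond it `floatFun` already
vanishes. For `c > 0` the half-space lies below the graph of an affine function. -/
theorem IsLC.floatingSet_eq (hf : IsLC f) {v : ℝ≥0∞} (hv : v ≠ ∞) :
    floatingSet (epi (potential f)) v = epi (potential (floatFun f v)) := by
  ext p
  rw [mem_epi_potential]
  constructor
  · intro h
    rw [hf.exp_le_floatFun_iff]
    intro w b hwb
    have h1 := h (-w) 1 b (by simp) (by
      rw [halfMinus_inter_eq _ one_pos, inv_one, one_smul, neg_neg, div_one, hf.volume_cap]
      exact hwb)
    simp only [halfPlus, Set.mem_ofPred_eq, inner_neg_left] at h1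
    linarith
  · intro h u c β huc hvol
    rcases lt_trichotomy c 0 with hc | hc | hc
    · obtain ⟨z, hz⟩ := hf.nondegenerate
      rw [hf.volume_halfMinus_eq_top hz (Or.inl hc), top_le_iff] at hvol
      exact absurd hvol hv
    · by_contra hp
      simp only [halfPlus, Set.mem_ofPred_eq, hc, zero_mul, add_zero, not_le] at hp
      have hsupp : ∀ y ∈ Function.support f, β ≤ ⟪u, y⟫ := by
        intro y hy
        have hcl : y ∈ closure (interior (Function.support f)) := by
          rw [hf.convex_support.closure_interior_eq_closure_of_nonempty_interior
            hf.nondegenerate]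
          exact subset_closure hy
        refine closure_minimal (fun z hz => ?_)
          (isClosed_le continuous_const (by fun_prop) : IsClosed {x | β ≤ ⟪u, x⟫}) hcl
        by_contra hlt
        rw [hf.volume_halfMinus_eq_top hz (Or.inr ⟨hc, not_le.1 hlt⟩), top_le_iff] at hvol
        exact hv hvol
      rw [hf.floatFun_eq_zero v hsupp hp] at h
      exact absurd h (not_le.2 (Real.exp_pos _))
    · rw [halfMinus_inter_eq u hc, hf.volume_cap] at hvol
      have h1 := hf.exp_le_floatFun_iff.1 h _ _ hvol
      have h2 : ⟪-(c⁻¹ • u), p.1⟫ + β / c = (β - ⟪u, p.1⟫) / c := by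
        rw [inner_neg_left, inner_smul_left]
        simp
        ring
      rw [h2, neg_neg, div_le_iff₀ hc] at h1
      simp only [halfPlus, Set.mem_ofPred_eq]
      linarith

theorem epi_injective {ψ χ : E n → EReal} (h : epi ψ = epi χ) : ψ = χ := by
  have key : ∀ x (z : ℝ), ψ x ≤ z ↔ χ x ≤ z := fun x z => Set.ext_iff.1 h (x, z)
  ext1 x
  exact le_antisymm (EReal.le_of_forall_lt_iff_le.1 fun z hz => (key x z).2 hz.le)
    (EReal.le_of_forall_lt_iff_le.1 fun z hz => (key x z).1 hz.le)

theorem exp_neg_potential {g : E n → ℝ} (hg : ∀ x, 0 ≤ g x) (x : E n) :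
    (EReal.exp (-potential g x)).toReal = g x := by
  rw [potential, neg_neg, ENNReal.exp_log, ENNReal.toReal_ofReal (hg x)]

theorem IsLC.isFloatingFunction_iff (hf : IsLC f) (δ : ℝ≥0) (h : E n → ℝ) :
    IsFloatingFunction δ f h ↔ h = floatFun f (ENNReal.ofReal ((δ : ℝ) * ∫ x, f x)) := by
  have heq := hf.floatingSet_eq (v := ENNReal.ofReal ((δ : ℝ) * ∫ x, f x)) ENNReal.ofReal_ne_top
  constructor
  · rintro ⟨ψ, h1, rfl⟩
    rw [epi_injective (h1.trans heq)]
    ext1 x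
    exact exp_neg_potential (hf.floatFun_nonneg _) x
  · rintro rfl
    refine ⟨_, heq.symm, ?_⟩
    ext1 x
    exact (exp_neg_potential (hf.floatFun_nonneg _) x).symm

end Halfspaces

/-! ### Continuity and equivariance of the floating function -/

section FloatingConvergence

variable {n : ℕ} {F : ℕ → E n → ℝ} {f : E n → ℝ}

theorem IsLC.measurable_cap (hf : IsLC f) (w : E n) (b : ℝ) :
    Measurable (fun x => ENNReal.ofReal (Real.posLog (Real.exp (⟪w, x⟫ + b) * f x))) := by
  have h1 : Measurable (fun x : E n => Real.exp (⟪w, x⟫ + b)) := by fun_prop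
  exact (Real.continuous_posLog.measurable.comp (h1.mul hf.measurable)).ennreal_ofReal

/-- A functional cutting off a cap of finite volume exceeds the potential by a bounded amount. -/
theorem IsLC.exists_le_of_capVolume (hf : IsLC f) {w : E n} {b : ℝ} {v : ℝ≥0∞} (hv : v ≠ ∞)
    (hcap : capVolume f w b ≤ v) : ∃ C, ∀ x, f x ≤ Real.exp (C - (⟪w, x⟫ + b)) := by
  obtain ⟨z, r, c, hr, hc, -, hball⟩ := hf.exists_ball_le
  set K := (v / volume (Metric.ball (0 : E n) (r / 2 / 4))).toReal - Real.log c with hK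
  refine ⟨2 * (|K| + |Real.log c| + |⟪w, z⟫ + b| + |b| + 1), fun x => ?_⟩
  rcases (hf.nonneg x).eq_or_lt with h0 | h0
  · rw [← h0]; positivity
  rw [← Real.log_le_iff_le_exp h0]
  set c1 := Real.exp ((1 / 2) * Real.log (f x) + (1 / 2) * Real.log c)
  have hb1 : ∀ y ∈ Metric.ball ((1 / 2 : ℝ) • x + (1 / 2 : ℝ) • z) (r / 2), c1 ≤ f y := by
    intro y hy
    have hw : (2 : ℝ) • y - x ∈ Metric.ball z r := by
      rw [mem_ball_iff_norm] at hy ⊢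
      have : (2 : ℝ) • y - x - z = (2 : ℝ) • (y - ((1 / 2 : ℝ) • x + (1 / 2 : ℝ) • z)) := by
        module
      rw [this, norm_smul]
      norm_num
      linarith
    have h1 := hf.logIneq x ((2 : ℝ) • y - x) (Real.log (f x)) (Real.log c) (1 / 2) (1 / 2)
      (by norm_num) (by norm_num) (by norm_num) (by rw [Real.exp_log h0])
      (by rw [Real.exp_log hc]; exact hball _ hw)
    have h2 : (1 / 2 : ℝ) • x + (1 / 2 : ℝ) • ((2 : ℝ) • y - x) = y := by module
    rwa [h2] at h1
  -- The bound is applied at the midpoint of `x` and `z`, around which log-concavity supplies a ball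
  -- of radius `r / 2` with values at least `c1`.
  have h1 := affine_le_of_capVolume_le hv (half_pos hr) (Real.exp_pos _) hb1 hcap
  rw [Real.log_exp, inner_add_right, inner_smul_right, inner_smul_right] at h1
  have h2 : 0 ≤ ‖w‖ * (r / 2) / 4 := by positivity
  have h3 : (v / volume (Metric.ball (0 : E n) (r / 2 / 4))).toReal = K + Real.log c := by rw [hK]; ring
  rw [h3] at h1
  have := le_abs_self K
  have := le_abs_self (Real.log c)
  have := neg_abs_le (⟪w, z⟫ + b)
  have := neg_abs_le b
  have := abs_nonneg K
  have := abs_nonneg (Real.log c)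
  have := abs_nonneg (⟪w, z⟫ + b)
  have := abs_nonneg b
  linarith

theorem IsLC.le_of_capVolume_eq_zero (hf : IsLC f) {w : E n} {b : ℝ}
    (hcap : capVolume f w b = 0) (x : E n) : f x ≤ Real.exp (-(⟪w, x⟫ + b)) := by
  have h1 := (lintegral_eq_zero_iff (hf.measurable_cap w b)).1 hcap
  refine hf.le_of_ae_le (g := fun y => Real.exp (-(⟪w, y⟫ + b))) (by fun_prop) (fun y => (Real.exp_pos _).le) ?_ x
  filter_upwards [h1] with y hy
  have hy' := ENNReal.ofReal_eq_zero.1 hy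
  have h2 := (Real.posLog_eq_zero_iff _).1 (le_antisymm hy' Real.posLog_nonneg)
  rw [abs_of_nonneg (mul_nonneg (Real.exp_pos _).le (hf.nonneg y))] at h2
  rwa [Real.exp_neg, ← one_div, le_div_iff₀ (Real.exp_pos _), mul_comm]

/-- Interpolation of an affine bound with exponential decay passes to the sequence. -/
theorem AEConv.eventually_le_exp_tilt (h : AEConv F f) (hF : ∀ m, IsLC (F m)) (hf : IsLC f)
    {a d C b η : ℝ} {w : E n} (ha : 0 < a) (hdec : ∀ x, f x ≤ Real.exp (d - a * ‖x‖))
    (haff : ∀ x, f x ≤ Real.exp (C - (⟪w, x⟫ + b))) (hη0 : 0 < η) (hη1 : η < 1) :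
    ∀ᶠ m in atTop, ∀ x, F m x ≤ Real.exp (-(η * a / 2 * ‖x‖ + ⟪(1 - η) • w, x⟫ +
      ((1 - η) * (b - C) - η * d - η * a / 2))) := by
  have h1 := h.eventually_le_exp hF hf (s := η * a / 2) (by positivity)
    (ContinuousLinearMap.id ℝ _) 0 ((1 - η) • w) ((1 - η) * (b - C) - η * d - η * a / 2)
    (κ := η * a / 2) (by positivity) (fun x => by
      rcases (hf.nonneg x).eq_or_lt with h0 | h0
      · rw [← h0]; positivity
      rw [← Real.log_le_iff_le_exp h0]
      have h2 := mul_le_mul_of_nonneg_left ((Real.log_le_iff_le_exp h0).2 (hdec x)) hη0.le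
      have h3 := mul_le_mul_of_nonneg_left ((Real.log_le_iff_le_exp h0).2 (haff x))
        (sub_nonneg.2 hη1.le)
      rw [inner_smul_left]
      simp
      linarith)
  simpa using h1

/-- The pair `(w, b)` itself may narrowly violate the constraint for `F m`, so it is contracted by
`1 - η` and lowered by `η * K`, with `K` independent of `η`. If `v0 = 0`, the contracted affine
function eventually cuts off nothing. If `v0 > 0`, its cap has volume strictly below `v0`, and cap
volumes converge by dominated convergence. -/
theorem AEConv.eventually_capVolume_le (h : AEConv F f) (hF : ∀ m, IsLC (F m)) (hf : IsLC f)
    {v : ℕ → ℝ≥0∞} {v0 : ℝ≥0∞} (hv : Tendsto v atTop (𝓝 v0)) (hv0 : v0 ≠ ∞) {w : E n} {b : ℝ}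
    (hcap : capVolume f w b ≤ v0) :
    ∃ K, ∀ η : ℝ, 0 < η → η < 1 → ∀ᶠ m in atTop,
      capVolume (F m) ((1 - η) • w) ((1 - η) * b - η * K) ≤ v m := by
  obtain ⟨a, d, ha, hdec⟩ := hf.exists_decay
  rcases eq_or_ne v0 0 with rfl | hne
  · refine ⟨d + a / 2, fun η hη0 hη1 => ?_⟩
    have haff := hf.le_of_capVolume_eq_zero (le_antisymm hcap zero_le)
    filter_upwards [h.eventually_le_exp_tilt hF hf ha hdec (C := 0) (by simpa using haff) hη0 hη1]
      with m hm
    refine (le_of_eq ((hF m).capVolume_eq_zero_of_le fun x => (hm x).trans ?_)).trans zero_le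
    rw [Real.exp_le_exp]
    have : 0 ≤ η * a / 2 * ‖x‖ := by positivity
    linarith
  · refine ⟨d, fun η hη0 hη1 => ?_⟩
    obtain ⟨C, haff⟩ := hf.exists_le_of_capVolume hv0 hcap
    set w' := (1 - η) • w
    set b' := (1 - η) * b - η * d with hb'
    have hlt : capVolume f w' b' < v0 := by
      -- Exponential decay bounds `log (f x)` by `d`, so lowering by `η * d` makes the new height at
      -- most `1 - η` times the old one pointwise.
      have h1 : capVolume f w' b' ≤ ENNReal.ofReal (1 - η) * capVolume f w b := by
        unfold capVolume
        rw [← lintegral_const_mul _ (hf.measurable_cap w b)]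
        refine lintegral_mono fun x => ?_
        rw [← ENNReal.ofReal_mul (sub_nonneg.2 hη1.le)]
        refine ENNReal.ofReal_le_ofReal ?_
        rcases (hf.nonneg x).eq_or_lt with h0 | h0
        · rw [← h0]; simp
        rw [posLog_exp_mul h0, posLog_exp_mul h0]
        have h1 : 0 ≤ a * ‖x‖ := by positivity
        have h2 := mul_le_mul_of_nonneg_left ((Real.log_le_iff_le_exp h0).2 (hdec x)) hη0.le
        have h3 := mul_le_mul_of_nonneg_left (le_max_right 0 (⟪w, x⟫ + b + Real.log (f x)))
          (sub_nonneg.2 hη1.le)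
        have h5 := mul_nonneg hη0.le h1
        refine max_le (mul_nonneg (sub_nonneg.2 hη1.le) (le_max_left _ _)) ?_
        have h4 : ⟪w', x⟫ = (1 - η) * ⟪w, x⟫ := by simp [w', inner_smul_left]
        rw [h4, hb']
        linarith
      refine h1.trans_lt ((mul_le_mul_right hcap _).trans_lt ?_)
      have h3 : ENNReal.ofReal (1 - η) < 1 := by
        rw [← ENNReal.ofReal_one]
        exact (ENNReal.ofReal_lt_ofReal_iff one_pos).2 (by linarith)
      calc ENNReal.ofReal (1 - η) * v0 < 1 * v0 :=
            ENNReal.mul_lt_mul_left hne hv0 h3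
        _ = v0 := one_mul _
    have hlim : Tendsto (fun m => capVolume (F m) w' b') atTop (𝓝 (capVolume f w' b')) := by
      refine tendsto_lintegral_filter_of_dominated_convergence
        (fun x => ENNReal.ofReal (Real.exp ((b' - ((1 - η) * (b - C) - η * d - η * a / 2)) -
          η * a / 2 * ‖x‖)))
        (Eventually.of_forall fun m => (hF m).measurable_cap w' b') ?_
        (integrable_exp_decay (by positivity) _).lintegral_lt_top.ne ?_
      · filter_upwards [h.eventually_le_exp_tilt hF hf ha hdec haff hη0 hη1] with m hm
        refine Eventually.of_forall fun x => ENNReal.ofReal_le_ofReal ?_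
        rcases ((hF m).nonneg x).eq_or_lt with h0 | h0
        · rw [← h0]
          simp
          positivity
        rw [posLog_exp_mul h0]
        refine max_le (Real.exp_pos _).le ?_
        have h2 := (Real.log_le_iff_le_exp h0).2 (hm x)
        refine le_trans ?_ ((le_add_of_nonneg_right zero_le_one).trans (Real.add_one_le_exp _))
        linarith
      · filter_upwards [h] with x hx
        exact ENNReal.tendsto_ofReal ((Real.continuous_posLog.tendsto _).comp (hx.const_mul _))
    exact (hlim.eventually_lt hv hlt).mono fun m hm => hm.le

theorem AEConv.eventually_floatFun_lt (h : AEConv F f) (hF : ∀ m, IsLC (F m)) (hf : IsLC f)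
    {v : ℕ → ℝ≥0∞} {v0 : ℝ≥0∞} (hv : Tendsto v atTop (𝓝 v0)) (hv0 : v0 ≠ ∞) {x : E n} {c : ℝ}
    (hc : floatFun f v0 x < c) : ∀ᶠ m in atTop, floatFun (F m) (v m) x < c := by
  have h1 := not_le.2 hc
  rw [hf.le_floatFun_iff] at h1
  push Not at h1
  obtain ⟨w, b, hwb, hlt⟩ := h1
  obtain ⟨K, hK⟩ := h.eventually_capVolume_le hF hf hv hv0 hwb
  have t1 : ∀ᶠ η : ℝ in 𝓝[>] 0,
      Real.exp (-(⟪(1 - η) • w, x⟫ + ((1 - η) * b - η * K))) < c := by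
    have hcont : Continuous
        (fun η : ℝ => Real.exp (-(⟪(1 - η) • w, x⟫ + ((1 - η) * b - η * K)))) := by fun_prop
    have := (hcont.tendsto 0).mono_left (nhdsWithin_le_nhds (s := Set.Ioi 0))
    exact this.eventually (gt_mem_nhds (by simpa using hlt))
  have t2 : ∀ᶠ l : ℝ in 𝓝[>] 0, l ∈ Set.Ioo (0 : ℝ) 1 := Ioo_mem_nhdsGT one_pos
  obtain ⟨η, hη, hη0, hη1⟩ := (t1.and t2).exists
  filter_upwards [hK η hη0 hη1] with m hm
  exact ((hF m).floatFun_le hm x).trans_lt hη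

theorem AEConv.eventually_lt_floatFun (h : AEConv F f) (hF : ∀ m, IsLC (F m)) (hf : IsLC f)
    {v : ℕ → ℝ≥0∞} {v0 : ℝ≥0∞} (hv : Tendsto v atTop (𝓝 v0)) (hv0 : v0 ≠ ∞) {x : E n}
    (hx : x ∈ interior (Function.support f)) {c : ℝ}
    (hc : c < floatFun f v0 x) : ∀ᶠ m in atTop, c < floatFun (F m) (v m) x := by
  by_contra hcon
  obtain ⟨c', hcc', hc'⟩ := exists_between hc
  have hfx : 0 < f x := hf.mem_support.1 (interior_subset hx)
  obtain ⟨r, hr, hball⟩ := h.exists_ball hF hf hx (half_lt_self hfx)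
  have hfreq : ∃ᶠ m in atTop, (floatFun (F m) (v m) x ≤ c ∧ v m ≤ v0 + 1) ∧
      ∀ y ∈ Metric.ball x r, f x / 2 < F m y := by
    refine Frequently.and_eventually (Frequently.and_eventually ?_ ?_) hball
    · exact (not_eventually.1 hcon).mono fun _ => le_of_not_gt
    · exact (hv.eventually (gt_mem_nhds (ENNReal.lt_add_right hv0 one_ne_zero))).mono
        fun _ => le_of_lt
  obtain ⟨φ, hφ, hall⟩ := extraction_of_frequently_atTop hfreq
  have hex : ∀ k, ∃ p : E n × ℝ, capVolume (F (φ k)) p.1 p.2 ≤ v (φ k) ∧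
      Real.exp (-(⟪p.1, x⟫ + p.2)) < c' := by
    intro k
    have h1 := not_le.2 ((hall k).1.1.trans_lt hcc')
    rw [(hF _).le_floatFun_iff] at h1
    push Not at h1
    obtain ⟨w, b, h2, h3⟩ := h1
    exact ⟨(w, b), h2, h3⟩
  choose p hp1 hp2 using hex
  have hv1 : v0 + 1 ≠ ∞ := ENNReal.add_ne_top.2 ⟨hv0, ENNReal.one_ne_top⟩
  set M := ((v0 + 1) / volume (Metric.ball (0 : E n) (r / 4))).toReal - Real.log (f x / 2)
  have hbound : ∀ k, ⟪(p k).1, x⟫ + (p k).2 + ‖(p k).1‖ * r / 4 ≤ M := fun k =>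
    affine_le_of_capVolume_le hv1 hr (half_pos hfx) (fun y hy => ((hall k).2 y hy).le)
      ((hp1 k).trans (hall k).1.2)
  have hc'0 : 0 < c' := (Real.exp_pos _).trans (hp2 0)
  have hlow : ∀ k, -Real.log c' < ⟪(p k).1, x⟫ + (p k).2 := by
    intro k
    have := (Real.lt_log_iff_exp_lt hc'0).2 (hp2 k)
    linarith
  have hw : ∀ k, ‖(p k).1‖ ≤ 4 / r * (M + Real.log c') := by
    intro k
    have h1 : ‖(p k).1‖ * r / 4 ≤ M + Real.log c' := by linarith [hbound k, hlow k]
    calc ‖(p k).1‖ = 4 / r * (‖(p k).1‖ * r / 4) := by field_simp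
      _ ≤ _ := by gcongr
  set W := 4 / r * (M + Real.log c')
  have hbd : ∀ k, |(p k).2| ≤ |M| + |Real.log c'| + W * ‖x‖ := by
    intro k
    have h1 := abs_le.1 (abs_real_inner_le_norm (p k).1 x)
    have h2 : ‖(p k).1‖ * ‖x‖ ≤ W * ‖x‖ := by gcongr; exact hw k
    have h3 : 0 ≤ ‖(p k).1‖ * r / 4 := by positivity
    rw [abs_le]
    constructor
    · linarith [hlow k, le_abs_self (Real.log c'), abs_nonneg M, h1.2]
    · linarith [hbound k, le_abs_self M, abs_nonneg (Real.log c'), h1.1]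
  have hpmem : ∀ k, p k ∈ Metric.closedBall (0 : E n) W ×ˢ
      Metric.closedBall (0 : ℝ) (|M| + |Real.log c'| + W * ‖x‖) := fun k =>
    ⟨by simpa using hw k, by simpa using hbd k⟩
  obtain ⟨q, -, χ, hχ, hlim⟩ := ((isCompact_closedBall (0 : E n) W).prod
    (isCompact_closedBall (0 : ℝ) (|M| + |Real.log c'| + W * ‖x‖))).tendsto_subseq hpmem
  have hφχ : StrictMono (φ ∘ χ) := hφ.comp hχ
  have hae : ∀ᵐ y, ENNReal.ofReal (Real.posLog (Real.exp (⟪q.1, y⟫ + q.2) * f y)) ≤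
      liminf (fun k => ENNReal.ofReal (Real.posLog
        (Real.exp (⟪(p (χ k)).1, y⟫ + (p (χ k)).2) * F (φ (χ k)) y))) atTop := by
    filter_upwards [h.comp hφχ] with y hy
    have hcont : Continuous (fun p : E n × ℝ => Real.exp (⟪p.1, y⟫ + p.2)) := by fun_prop
    have h1 := ENNReal.tendsto_ofReal ((Real.continuous_posLog.tendsto _).comp
      (((hcont.tendsto q).comp hlim).mul hy))
    exact h1.liminf_eq.ge
  have hcapq : capVolume f q.1 q.2 ≤ v0 :=
    calc capVolume f q.1 q.2 ≤ ∫⁻ y, liminf (fun k => ENNReal.ofReal (Real.posLog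
          (Real.exp (⟪(p (χ k)).1, y⟫ + (p (χ k)).2) * F (φ (χ k)) y))) atTop :=
          lintegral_mono_ae hae
      _ ≤ liminf (fun k => capVolume (F (φ (χ k))) (p (χ k)).1 (p (χ k)).2) atTop :=
          lintegral_liminf_le fun k => (hF _).measurable_cap _ _
      _ ≤ liminf (fun k => v (φ (χ k))) atTop :=
          liminf_le_liminf (Eventually.of_forall fun k => hp1 (χ k))
      _ = v0 := (hv.comp hφχ.tendsto_atTop).liminf_eq
  have hqx : Real.exp (-(⟪q.1, x⟫ + q.2)) ≤ c' := by
    have hcont : Continuous (fun p : E n × ℝ => Real.exp (-(⟪p.1, x⟫ + p.2))) := by fun_prop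
    exact le_of_tendsto ((hcont.tendsto q).comp hlim)
      (Eventually.of_forall fun k => (hp2 (χ k)).le)
  exact absurd (hc'.trans_le ((hf.floatFun_le hcapq x).trans hqx)) (lt_irrefl _)

/-- Upper bounds hold everywhere. Lower bounds are needed only in the interior of the support, since
the limit vanishes outside its closure and the boundary is null. -/
theorem AEConv.floatFun (h : AEConv F f) (hF : ∀ m, IsLC (F m)) (hf : IsLC f)
    {v : ℕ → ℝ≥0∞} {v0 : ℝ≥0∞} (hv : Tendsto v atTop (𝓝 v0)) (hv0 : v0 ≠ ∞) :
    AEConv (fun m => floatFun (F m) (v m)) (floatFun f v0) := by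
  filter_upwards [hf.logIneq.ae_interior_or_notMem_closure hf.nonneg] with x hx
  rw [tendsto_order]
  refine ⟨fun c hc => ?_, fun c hc => h.eventually_floatFun_lt hF hf hv hv0 hc⟩
  rcases hx with hx | hx
  · exact h.eventually_lt_floatFun hF hf hv hv0 hx hc
  · obtain ⟨l, β, hl1, hl2⟩ := geometric_hahn_banach_point_closed hf.convex_support.closure
      isClosed_closure hx
    have hlu : ∀ y, l y = ⟪(InnerProductSpace.toDual ℝ (E n)).symm l, y⟫ := fun y =>
      (InnerProductSpace.toDual_symm_apply).symm
    rw [hf.floatFun_eq_zero v0 (u := (InnerProductSpace.toDual ℝ (E n)).symm l) (β := β)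
      (fun y hy => by rw [← hlu]; exact (hl2 y (subset_closure hy)).le)
      (by rw [← hlu]; exact hl1)] at hc
    exact Eventually.of_forall fun m => hc.trans_le ((hF m).floatFun_nonneg _ x)

/-- Pulling affine functions back along `A` divides cap volumes by the Jacobian, so admissible ones
for `f` give admissible ones for `f ∘ A`. The reverse inequality is this one for the inverse map. -/
theorem IsLC.floatFun_comp_le (hf : IsLC f) (A : E n ≃ᵃ[ℝ] E n) (v : ℝ≥0∞) (x : E n) :
    LogConcave.floatFun (fun y => f (A y)) (ENNReal.ofReal (jac A)⁻¹ * v) x ≤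
      LogConcave.floatFun f v (A x) := by
  set M : E n →L[ℝ] E n := LinearMap.toContinuousLinearMap (A.linear : E n →ₗ[ℝ] E n)
  have hMA : ∀ y, A y = M y + A 0 := affineEquiv_apply A
  rw [hf.le_floatFun_iff]
  intro w b hwb
  have hpull : ∀ y, ⟪ContinuousLinearMap.adjoint M w, y⟫ + (⟪w, A 0⟫ + b) = ⟪w, A y⟫ + b := by
    intro y
    rw [ContinuousLinearMap.adjoint_inner_left, hMA y, inner_add_right]
    ring
  have hcap : capVolume (fun y => f (A y)) (ContinuousLinearMap.adjoint M w) (⟪w, A 0⟫ + b) ≤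
      ENNReal.ofReal (jac A)⁻¹ * v := by
    unfold capVolume
    simp only [hpull]
    rw [lintegral_comp_affineEquiv A
      (fun y => ENNReal.ofReal (Real.posLog (Real.exp (⟪w, y⟫ + b) * f y)))]
    gcongr
    exact hwb
  have := (hf.comp_affine A).floatFun_le hcap x
  rwa [hpull] at this

theorem IsLC.floatFun_comp (hf : IsLC f) (A : E n ≃ᵃ[ℝ] E n) (v : ℝ≥0∞) (x : E n) :
    LogConcave.floatFun (fun y => f (A y)) (ENNReal.ofReal (jac A)⁻¹ * v) x =
      LogConcave.floatFun f v (A x) := by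
  refine le_antisymm (hf.floatFun_comp_le A v x) ?_
  have h1 := (hf.comp_affine A).floatFun_comp_le A.symm (ENNReal.ofReal (jac A)⁻¹ * v) (A x)
  have hj : jac A.symm * jac A = 1 := by
    rw [← jac_trans, AffineEquiv.symm_trans_self]
    simp [jac]
  have h2 : ENNReal.ofReal (jac A.symm)⁻¹ * (ENNReal.ofReal (jac A)⁻¹ * v) = v := by
    rw [← mul_assoc, ← ENNReal.ofReal_mul (inv_nonneg.2 (jac_pos _).le), ← mul_inv, hj]
    simp
  rw [h2] at h1
  simpa using h1

end FloatingConvergence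

/-! ### Determinants, isometries and midpoints -/

section LinearAlgebra

variable {n : ℕ}

theorem det_eq_prod_of_basis (v : OrthonormalBasis (Fin n) ℝ (E n)) {T : E n →ₗ[ℝ] E n}
    {p : Fin n → ℝ} (h : ∀ i, T (v i) = p i • v i) : LinearMap.det T = ∏ i, p i := by
  rw [← LinearMap.det_toMatrix v.toBasis]
  have : LinearMap.toMatrix v.toBasis v.toBasis T = Matrix.diagonal p := by
    ext i j
    rw [LinearMap.toMatrix_apply, OrthonormalBasis.coe_toBasis, h, map_smul, Finsupp.smul_apply,
      ← OrthonormalBasis.coe_toBasis, Module.Basis.repr_self, Matrix.diagonal_apply,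
      Finsupp.single_apply]
    by_cases hij : i = j
    · simp [hij]
    · simp [hij, Ne.symm hij]
  rw [this, Matrix.det_diagonal]

theorem abs_det_isometry (U : E n ≃ₗᵢ[ℝ] E n) :
    |LinearMap.det (U.toLinearEquiv : E n →ₗ[ℝ] E n)| = 1 := by
  rw [← LinearMap.normDet_eq_abs_det]
  exact U.toLinearIsometry.normDet_eq_one

/-- Up to an isometry, an invertible map is diagonal with positive entries in an orthonormal
basis. -/
theorem exists_isometry_diagonal (M : E n ≃ₗ[ℝ] E n) :
    ∃ (U : E n ≃ₗᵢ[ℝ] E n) (v : OrthonormalBasis (Fin n) ℝ (E n)) (p : Fin n → ℝ),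
      (∀ i, 0 < p i) ∧ ∀ i, U (M (v i)) = p i • v i := by
  set L : E n →ₗ[ℝ] E n := (M : E n →ₗ[ℝ] E n)
  have hT := LinearMap.isSymmetric_adjoint_comp_self L
  have hn : Module.finrank ℝ (E n) = n := finrank_euclideanSpace_fin
  set v := hT.eigenvectorBasis hn
  have hinner : ∀ i j, ⟪M (v i), M (v j)⟫ = hT.eigenvalues hn j * ⟪v i, v j⟫ := by
    intro i j
    have h1 := hT.apply_eigenvectorBasis hn j
    calc ⟪M (v i), M (v j)⟫ = ⟪v i, (LinearMap.adjoint L ∘ₗ L) (v j)⟫ := by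
          rw [LinearMap.comp_apply, LinearMap.adjoint_inner_right]
          rfl
      _ = _ := by rw [h1, inner_smul_right]; rfl
  have hp : ∀ i, 0 < ‖M (v i)‖ := fun i => norm_pos_iff.2 (by
    rw [Ne, LinearEquiv.map_eq_zero_iff]
    exact v.orthonormal.ne_zero i)
  -- Eigenvectors of the adjoint of `L` composed with `L` have mutually orthogonal images under `M`.
  -- The isometry `U` carries the normalized images back to the eigenvectors.
  have hon : Orthonormal ℝ (fun i => ‖M (v i)‖⁻¹ • M (v i)) := by
    constructor
    · intro i
      rw [norm_smul, norm_inv, norm_norm, inv_mul_cancel₀ (hp i).ne']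
    · intro i j hij
      rw [inner_smul_left, inner_smul_right, hinner, v.orthonormal.2 hij]
      simp
  obtain ⟨e, he⟩ := Orthonormal.exists_orthonormalBasis_extension_of_card_eq (s := Set.univ)
    (by simp) (v := fun i => ‖M (v i)‖⁻¹ • M (v i))
    (hon.comp _ Subtype.val_injective)
  refine ⟨e.equiv v (Equiv.refl _), v, fun i => ‖M (v i)‖, hp, fun i => ?_⟩
  have h1 : M (v i) = ‖M (v i)‖ • e i := by
    rw [he i (Set.mem_univ i), smul_inv_smul₀ (hp i).ne']
  conv_lhs => rw [h1]
  rw [map_smul, OrthonormalBasis.equiv_apply_basis, Equiv.refl_apply]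

/-- Midpoint inequality for determinants, after composing with a suitable isometry. -/
theorem exists_isometry_midpoint (M : E n ≃ₗ[ℝ] E n) :
    ∃ U : E n ≃ₗᵢ[ℝ] E n,
      LinearMap.det ((1 / 2 : ℝ) • (LinearMap.id + (U.toLinearEquiv : E n →ₗ[ℝ] E n) ∘ₗ
        (M : E n →ₗ[ℝ] E n))) ^ 2 ≤ |LinearMap.det (M : E n →ₗ[ℝ] E n)| →
      ∀ x, U (M x) = x := by
  obtain ⟨U, v, p, hp, hv⟩ := exists_isometry_diagonal M
  refine ⟨U, fun hle => ?_⟩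
  have h1 : LinearMap.det ((U.toLinearEquiv : E n →ₗ[ℝ] E n) ∘ₗ (M : E n →ₗ[ℝ] E n)) =
      ∏ i, p i := det_eq_prod_of_basis v hv
  have h2 : LinearMap.det ((1 / 2 : ℝ) • (LinearMap.id + (U.toLinearEquiv : E n →ₗ[ℝ] E n) ∘ₗ
      (M : E n →ₗ[ℝ] E n))) = ∏ i, ((1 + p i) / 2) := by
    refine det_eq_prod_of_basis v fun i => ?_
    have := hv i
    simp only [LinearMap.smul_apply, LinearMap.add_apply, LinearMap.id_apply,
      LinearMap.comp_apply]
    change (1 / 2 : ℝ) • (v i + U (M (v i))) = _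
    rw [this]
    module
  have h3 : |LinearMap.det (M : E n →ₗ[ℝ] E n)| = ∏ i, p i := by
    have h4 := congrArg abs h1
    rw [LinearMap.det_comp, abs_mul, abs_det_isometry, one_mul,
      abs_of_pos (Finset.prod_pos fun i _ => hp i)] at h4
    exact h4
  rw [h2, h3, ← Finset.prod_pow] at hle
  -- Termwise `p ≤ ((1 + p) / 2) ^ 2`, strictly unless `p = 1`. The product inequality therefore
  -- leaves only `p = 1`.
  have hall : ∀ i, p i = 1 := by
    by_contra! hne
    obtain ⟨j, hj⟩ := hne
    refine absurd hle (not_le.2 (Finset.prod_lt_prod (fun i _ => hp i) (fun i _ => ?_)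
      ⟨j, Finset.mem_univ j, ?_⟩))
    · nlinarith [sq_nonneg (p i - 1)]
    · have : 0 < (p j - 1) ^ 2 := by
        have := sub_ne_zero.2 hj
        positivity
      nlinarith
  have hid : (U.toLinearEquiv : E n →ₗ[ℝ] E n) ∘ₗ (M : E n →ₗ[ℝ] E n) = LinearMap.id := by
    refine v.toBasis.ext fun i => ?_
    rw [OrthonormalBasis.coe_toBasis]
    have := hv i
    rw [hall i, one_smul] at this
    exact this
  exact fun x => LinearMap.congr_fun hid x

/-- Conjugation by `U` interchanges `id + M U` and `id + U M` without changing the determinant. -/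
theorem exists_isometry_midpoint_right (M : E n ≃ₗ[ℝ] E n) :
    ∃ U : E n ≃ₗᵢ[ℝ] E n,
      LinearMap.det ((1 / 2 : ℝ) • (LinearMap.id + (M : E n →ₗ[ℝ] E n) ∘ₗ
        (U.toLinearEquiv : E n →ₗ[ℝ] E n))) ^ 2 ≤ |LinearMap.det (M : E n →ₗ[ℝ] E n)| →
      ∀ x, M (U x) = x := by
  obtain ⟨U, hU⟩ := exists_isometry_midpoint M
  refine ⟨U, fun hle x => ?_⟩
  have h1 : ((1 / 2 : ℝ) • (LinearMap.id + (U.toLinearEquiv : E n →ₗ[ℝ] E n) ∘ₗ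
      (M : E n →ₗ[ℝ] E n))) = (U.toLinearEquiv : E n →ₗ[ℝ] E n) ∘ₗ
      ((1 / 2 : ℝ) • (LinearMap.id + (M : E n →ₗ[ℝ] E n) ∘ₗ
        (U.toLinearEquiv : E n →ₗ[ℝ] E n))) ∘ₗ (U.toLinearEquiv.symm : E n →ₗ[ℝ] E n) := by
    ext1 y
    simp
  rw [h1, LinearMap.det_conj] at hU
  have h2 := hU hle
  apply U.injective
  exact h2 (U x)

theorem abs_det_le_norm_pow (S : E n →L[ℝ] E n) : |S.det| ≤ ‖S‖ ^ n := by
  have h1 := Measure.addHaar_image_continuousLinearMap (volume : Measure (E n)) S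
    (Metric.closedBall 0 1)
  have h2 : S '' Metric.closedBall 0 1 ⊆ Metric.closedBall 0 ‖S‖ := by
    rintro _ ⟨x, hx, rfl⟩
    rw [mem_closedBall_zero_iff] at *
    exact (S.le_opNorm x).trans (mul_le_of_le_one_right (norm_nonneg _) hx)
  have h3 := measure_mono (μ := (volume : Measure (E n))) h2
  rw [h1, Measure.addHaar_closedBall _ _ (norm_nonneg S),
    ← Measure.addHaar_unitClosedBall_eq_addHaar_unitBall, finrank_euclideanSpace_fin] at h3
  have h4 : 0 < volume (Metric.closedBall (0 : E n) 1) :=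
    Metric.measure_closedBall_pos _ _ one_pos
  have h5 := (ENNReal.mul_le_mul_iff_left h4.ne' measure_closedBall_lt_top.ne).1 h3
  exact (ENNReal.ofReal_le_ofReal_iff (by positivity)).1 h5

/-- The exponential dominates the power of order `n + 1`. In both extremal problems `τ` is a
logarithmic gap of heights, and this bounds it in terms of the value. -/
theorem le_of_le_pow_mul_exp {τ v K : ℝ} (hτ : 0 ≤ τ) (hv : 0 < v) (hK : 0 ≤ K)
    (h : v ≤ K * τ ^ n * Real.exp (-τ)) : τ ≤ K * (n + 1).factorial / v := by
  have h1 := Real.pow_div_factorial_le_exp τ hτ (n + 1)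
  have h2 : 0 < ((n + 1).factorial : ℝ) := by positivity
  rw [div_le_iff₀ h2] at h1
  rw [le_div_iff₀ hv]
  calc τ * v ≤ τ * (K * τ ^ n * Real.exp (-τ)) := by gcongr
    _ = K * τ ^ (n + 1) * Real.exp (-τ) := by ring
    _ ≤ K * (Real.exp τ * (n + 1).factorial) * Real.exp (-τ) := by gcongr
    _ = K * (n + 1).factorial * (Real.exp τ * Real.exp (-τ)) := by ring
    _ = _ := by rw [← Real.exp_add]; simp

/-- The linear part of an affine equivalence, as a continuous linear map. -/
noncomputable def linPart (A : E n ≃ᵃ[ℝ] E n) : E n →L[ℝ] E n :=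
  LinearMap.toContinuousLinearMap (A.linear : E n →ₗ[ℝ] E n)

theorem apply_eq_linPart (A : E n ≃ᵃ[ℝ] E n) (x : E n) : A x = linPart A x + A 0 :=
  affineEquiv_apply A x

theorem exists_affineEquiv {S : E n →L[ℝ] E n} (hS : S.det ≠ 0) (a : E n) :
    ∃ A : E n ≃ᵃ[ℝ] E n, (∀ x, A x = S x + a) ∧ linPart A = S ∧ jac A = |S.det| := by
  let e := LinearMap.equivOfDetNeZero (S : E n →ₗ[ℝ] E n) hS
  have h1 : ∀ x, (e.toAffineEquiv.trans (AffineEquiv.constVAdd ℝ (E n) a)) x = S x + a := by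
    intro x
    exact add_comm a (S x)
  refine ⟨e.toAffineEquiv.trans (AffineEquiv.constVAdd ℝ (E n) a), h1, ?_, rfl⟩
  ext1 x
  have h2 := apply_eq_linPart (e.toAffineEquiv.trans (AffineEquiv.constVAdd ℝ (E n) a)) x
  rw [h1, h1] at h2
  simpa using h2.symm

end LinearAlgebra

/-! ### An abstract scheme for extremal problems: existence and stability -/

section Optimum

variable {n : ℕ}

/-- Parameters of affine maps together with a height. -/
abbrev Params (n : ℕ) : Type := (E n →L[ℝ] E n) × E n × ℝ

/-- A solution with positive value of a maximization problem. -/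
def IsOptimum (feas : (E n → ℝ) → Params n → Prop) (val : Params n → ℝ) (f : E n → ℝ)
    (p : Params n) : Prop :=
  feas f p ∧ 0 < val p ∧ ∀ q, feas f q → val q ≤ val p

/-- Compactness of feasible points whose value is bounded below. -/
def CompactFeasible (feas : (E n → ℝ) → Params n → Prop) (val : Params n → ℝ) : Prop :=
  ∀ (F : ℕ → E n → ℝ) (f : E n → ℝ), AEConv F f → (∀ m, IsLC (F m)) → IsLC f →
    ∀ (p : ℕ → Params n) (v : ℝ), 0 < v → (∀ᶠ m in atTop, feas (F m) (p m) ∧ v ≤ val (p m)) →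
      ∃ (p0 : Params n) (φ : ℕ → ℕ), StrictMono φ ∧ Tendsto (p ∘ φ) atTop (𝓝 p0) ∧ feas f p0

/-- Approximability of values along convergent sequences. -/
def RecoverFeasible (feas : (E n → ℝ) → Params n → Prop) (val : Params n → ℝ) : Prop :=
  ∀ (F : ℕ → E n → ℝ) (f : E n → ℝ), AEConv F f → (∀ m, IsLC (F m)) → IsLC f →
    ∀ p : Params n, feas f p → ∀ v, 0 < v → v < val p →
      ∀ᶠ m in atTop, ∃ q, feas (F m) q ∧ v ≤ val q

variable {feas : (E n → ℝ) → Params n → Prop} {val : Params n → ℝ}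

/-- Compactness along the constant sequence makes the set of feasible points at least as good as `p`
compact. -/
theorem CompactFeasible.exists_isOptimum (h : CompactFeasible feas val) (hval : Continuous val)
    {f : E n → ℝ} (hf : IsLC f) {p : Params n} (hp : feas f p) (hp0 : 0 < val p) :
    ∃ q, IsOptimum feas val f q := by
  have hK : IsCompact {q | feas f q ∧ val p ≤ val q} := by
    refine IsSeqCompact.isCompact fun q hq => ?_
    obtain ⟨q0, φ, hφ, hlim, hq0⟩ := h _ f (AEConv.const f) (fun _ => hf) hf q (val p) hp0
      (Eventually.of_forall hq)
    refine ⟨q0, ⟨hq0, ?_⟩, φ, hφ, hlim⟩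
    exact ge_of_tendsto ((hval.tendsto q0).comp hlim) (Eventually.of_forall fun m => (hq (φ m)).2)
  obtain ⟨q, hq, hmax⟩ := hK.exists_isMaxOn ⟨p, hp, le_rfl⟩ hval.continuousOn
  refine ⟨q, hq.1, hp0.trans_le hq.2, fun r hr => ?_⟩
  rcases le_total (val p) (val r) with h1 | h1
  · exact hmax ⟨hr, h1⟩
  · exact h1.trans hq.2

/-- Recovery keeps the optimal values of `F m` from falling below that of `f` in the limit,
compactness extracts a feasible limit `q`, and continuity of the value makes `q` optimal. Nothing
identifies `q` with `p0`. -/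
theorem CompactFeasible.exists_subseq_isOptimum (h : CompactFeasible feas val)
    (hr : RecoverFeasible feas val) (hval : Continuous val) {F : ℕ → E n → ℝ} {f : E n → ℝ}
    (hconv : AEConv F f) (hF : ∀ m, IsLC (F m)) (hf : IsLC f) {p : ℕ → Params n} {p0 : Params n}
    (hp : ∀ m, IsOptimum feas val (F m) (p m)) (hp0 : IsOptimum feas val f p0) :
    ∃ (q : Params n) (φ : ℕ → ℕ), StrictMono φ ∧ Tendsto (p ∘ φ) atTop (𝓝 q) ∧
      IsOptimum feas val f q := by
  have hlow : ∀ v, 0 < v → v < val p0 → ∀ᶠ m in atTop, v ≤ val (p m) := by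
    intro v hv hv'
    filter_upwards [hr F f hconv hF hf p0 hp0.1 v hv hv'] with m hm
    obtain ⟨q, hq, hvq⟩ := hm
    exact hvq.trans ((hp m).2.2 q hq)
  obtain ⟨q, φ, hφ, hlim, hq⟩ := h F f hconv hF hf p (val p0 / 2) (half_pos hp0.2.1)
    ((hlow _ (half_pos hp0.2.1) (half_lt_self hp0.2.1)).mono fun m hm => ⟨(hp m).1, hm⟩)
  have hge : val p0 ≤ val q := by
    refine le_of_forall_lt fun c hc => ?_
    obtain ⟨d, hd1, hd2⟩ := exists_between (max_lt hc hp0.2.1)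
    refine ((le_max_left _ _).trans_lt hd1).trans_le ?_
    exact ge_of_tendsto ((hval.tendsto q).comp hlim)
      (hφ.tendsto_atTop.eventually (hlow d ((le_max_right _ _).trans_lt hd1) hd2))
  exact ⟨q, φ, hφ, hlim, hq, hp0.2.1.trans_le hge, fun r hr => (hp0.2.2 r hr).trans hge⟩

end Optimum

/-! ### The Löwner problem -/

/-- Feasibility for the Löwner problem. -/
def LownerFeas {n : ℕ} (f : E n → ℝ) (p : Params n) : Prop :=
  ∀ x, f x ≤ Real.exp (p.2.2 - ‖p.1 x + p.2.1‖)

/-- The value of the Löwner problem, to be maximized. -/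
noncomputable def lownerVal {n : ℕ} (p : Params n) : ℝ := |p.1.det| * Real.exp (-p.2.2)

/-- The function attached to the parameters of the Löwner problem. -/
noncomputable def lownerFun {n : ℕ} (p : Params n) (x : E n) : ℝ :=
  Real.exp (p.2.2 - ‖p.1 x + p.2.1‖)

section Lowner

variable {n : ℕ} {f : E n → ℝ}

theorem continuous_lownerVal : Continuous (lownerVal : Params n → ℝ) := by
  unfold lownerVal
  have h1 : Continuous (fun p : Params n => p.1.det) :=
    ContinuousLinearMap.continuous_det.comp continuous_fst
  fun_prop

theorem exists_norm_ge {S : E n →L[ℝ] E n} (hS : S.det ≠ 0) (a : E n) :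
    ∃ σ > 0, ∀ x, σ * ‖x‖ - ‖a‖ ≤ ‖S x + a‖ := by
  obtain ⟨A, hA, -, -⟩ := exists_affineEquiv hS (0 : E n)
  set B := linPart A.symm with hB
  have hBS : ∀ x, B (S x) = x := by
    intro x
    have h1 : A x = S x := by simpa using hA x
    have h2 : A.symm 0 = 0 := by
      have : A 0 = 0 := by simpa using hA 0
      rw [← this, A.symm_apply_apply]
      exact this.symm ▸ rfl
    have h3 := apply_eq_linPart A.symm (A x)
    rw [h2, add_zero, A.symm_apply_apply, h1] at h3
    exact h3.symm
  refine ⟨(‖B‖ + 1)⁻¹, by positivity, fun x => ?_⟩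
  have h1 : ‖x‖ ≤ (‖B‖ + 1) * ‖S x‖ := by
    calc ‖x‖ = ‖B (S x)‖ := by rw [hBS]
      _ ≤ ‖B‖ * ‖S x‖ := B.le_opNorm _
      _ ≤ _ := by gcongr; linarith
  have h2 : (‖B‖ + 1)⁻¹ * ‖x‖ ≤ ‖S x‖ := by
    rw [inv_mul_le_iff₀ (by positivity)]
    exact h1
  have h3 : ‖S x‖ ≤ ‖S x + a‖ + ‖a‖ := by
    simpa using norm_sub_le (S x + a) a
  linarith

theorem isLC_lownerFun {p : Params n} (hp : p.1.det ≠ 0) : IsLC (lownerFun p) := by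
  obtain ⟨σ, hσ, h⟩ := exists_norm_ge hp p.2.1
  refine isLC_of_decay (a := σ) (b := p.2.2 + ‖p.2.1‖) (x := 0) (fun x => (Real.exp_pos _).le)
    ?_ ?_ hσ (fun x => ?_) (Eventually.of_forall fun x => Real.exp_pos _)
  · intro x y s t a b ha hb hab hs ht
    unfold lownerFun at *
    rw [Real.exp_le_exp] at *
    have e : p.1 (a • x + b • y) + p.2.1 = a • (p.1 x + p.2.1) + b • (p.1 y + p.2.1) := by
      have : p.2.1 = a • p.2.1 + b • p.2.1 := by rw [← add_smul, hab, one_smul]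
      conv_lhs => rw [this]
      simp only [map_add, map_smul]
      module
    have h1 : ‖p.1 (a • x + b • y) + p.2.1‖ ≤ a * ‖p.1 x + p.2.1‖ + b * ‖p.1 y + p.2.1‖ := by
      rw [e]
      refine (norm_add_le _ _).trans ?_
      rw [norm_smul, norm_smul, Real.norm_of_nonneg ha, Real.norm_of_nonneg hb]
    have h2 := mul_le_mul_of_nonneg_left hs ha
    have h3 := mul_le_mul_of_nonneg_left ht hb
    have h4 : p.2.2 = a * p.2.2 + b * p.2.2 := by rw [← add_mul, hab, one_mul]
    linarith
  · refine Continuous.upperSemicontinuous ?_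
    unfold lownerFun
    fun_prop
  · unfold lownerFun
    rw [Real.exp_le_exp]
    linarith [h x]

theorem IsLC.exists_lownerFeas (hf : IsLC f) : ∃ p, LownerFeas f p ∧ 0 < lownerVal p := by
  obtain ⟨a, b, ha, hab⟩ := hf.exists_decay
  refine ⟨(a • ContinuousLinearMap.id ℝ _, 0, b), fun x => (hab x).trans_eq ?_, ?_⟩
  · simp [norm_smul, abs_of_pos ha]
  · unfold lownerVal
    have : (a • ContinuousLinearMap.id ℝ (E n)).det ≠ 0 := by
      change LinearMap.det ((a • ContinuousLinearMap.id ℝ (E n) : E n →L[ℝ] E n) :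
        E n →ₗ[ℝ] E n) ≠ 0
      rw [ContinuousLinearMap.toLinearMap_smul, LinearMap.det_smul, ContinuousLinearMap.coe_id,
        LinearMap.det_id, mul_one]
      positivity
    positivity

/-- Since `F m` is bounded below near `z`, feasibility gives `‖S y + a‖ ≤ t - l` on a ball. This
bounds `‖S‖` by a multiple of `t - l`, and the value by a multiple of `(t - l) ^ n * exp (-(t -
l))`. A positive lower bound on the value thus bounds `t - l`, and with it all parameters. -/
theorem compactFeasible_lowner : CompactFeasible (n := n) LownerFeas lownerVal := by
  intro F f hconv hF hf p v hv hp
  obtain ⟨z, hz⟩ := hf.nondegenerate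
  have hfz : 0 < f z := hf.mem_support.1 (interior_subset hz)
  obtain ⟨r, hr, hball⟩ := hconv.exists_ball hF hf hz (half_lt_self hfz)
  set l := Real.log (f z / 2) with hl
  set K : ℝ := (4 / r) ^ n * Real.exp (-l) with hK
  have hKpos : 0 < K := by positivity
  set T : ℝ := K * (n + 1).factorial / v with hT
  have hbound : ∀ᶠ m in atTop, p m ∈ Metric.closedBall (0 : E n →L[ℝ] E n) (4 / r * T) ×ˢ
      (Metric.closedBall (0 : E n) (T + 4 / r * T * ‖z‖) ×ˢ Set.Icc l (T + l)) := by
    filter_upwards [hp, hball] with m hm hmb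
    set S := (p m).1
    set a := (p m).2.1
    set t := (p m).2.2
    have hS : ∀ y ∈ Metric.ball z r, ‖S y + a‖ ≤ t - l := by
      intro y hy
      have h1 := Real.log_lt_log (half_pos hfz) ((hmb y hy).trans_le (hm.1 y))
      rw [Real.log_exp, ← hl] at h1
      linarith
    have hz0 := hS z (Metric.mem_ball_self hr)
    have hτ : 0 ≤ t - l := (norm_nonneg _).trans hz0
    have hSn : ‖S‖ ≤ 4 / r * (t - l) := by
      refine ContinuousLinearMap.opNorm_le_of_unit_norm (by positivity) fun x hx => ?_
      have h1 := hS (z + (r / 2) • x) (by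
        rw [mem_ball_iff_norm, add_sub_cancel_left, norm_smul, hx,
          Real.norm_of_nonneg (by positivity)]
        linarith)
      have h2 : (r / 2) • S x = (S (z + (r / 2) • x) + a) - (S z + a) := by
        rw [map_add, map_smul]
        abel
      have h3 : ‖(r / 2) • S x‖ ≤ (t - l) + (t - l) := by
        rw [h2]
        exact (norm_sub_le _ _).trans (add_le_add h1 hz0)
      rw [norm_smul, Real.norm_of_nonneg (by positivity)] at h3
      calc ‖S x‖ = 2 / r * (r / 2 * ‖S x‖) := by field_simp
        _ ≤ 2 / r * ((t - l) + (t - l)) := by gcongr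
        _ = _ := by ring
    have hval : v ≤ K * (t - l) ^ n * Real.exp (-(t - l)) := by
      refine hm.2.trans ?_
      unfold lownerVal
      have h1 : |S.det| ≤ (4 / r * (t - l)) ^ n :=
        (abs_det_le_norm_pow S).trans (by gcongr)
      calc |S.det| * Real.exp (-t) ≤ (4 / r * (t - l)) ^ n * Real.exp (-t) := by gcongr
        _ = _ := by
          rw [hK, mul_pow, show -t = -l + -(t - l) by ring, Real.exp_add]
          ring
    have hτT : t - l ≤ T := le_of_le_pow_mul_exp hτ hv hKpos.le hval
    have hST : ‖S‖ ≤ 4 / r * T := hSn.trans (by gcongr)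
    refine ⟨by simpa using hST, ?_, by linarith, by linarith⟩
    rw [mem_closedBall_zero_iff]
    have h1 : ‖a‖ ≤ ‖S z + a‖ + ‖S z‖ := by
      simpa using norm_sub_le (S z + a) (S z)
    have h2 : ‖S z‖ ≤ 4 / r * T * ‖z‖ := (S.le_opNorm z).trans (by gcongr)
    change ‖a‖ ≤ _
    linarith
  have hcomp : IsCompact (Metric.closedBall (0 : E n →L[ℝ] E n) (4 / r * T) ×ˢ
      (Metric.closedBall (0 : E n) (T + 4 / r * T * ‖z‖) ×ˢ Set.Icc l (T + l))) :=
    (isCompact_closedBall _ _).prod ((isCompact_closedBall _ _).prod isCompact_Icc)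
  obtain ⟨p0, -, φ, hφ, hlim⟩ := hcomp.tendsto_subseq' hbound.frequently
  refine ⟨p0, φ, hφ, hlim, ?_⟩
  have hc0 : Continuous (fun x : E n => Real.exp (p0.2.2 - ‖p0.1 x + p0.2.1‖)) := by fun_prop
  refine hf.le_of_ae_le hc0 (fun x => (Real.exp_pos _).le) ?_
  filter_upwards [hconv.comp hφ] with x hx
  have hc : Continuous (fun q : Params n => Real.exp (q.2.2 - ‖q.1 x + q.2.1‖)) := by fun_prop
  refine le_of_tendsto_of_tendsto hx ((hc.tendsto p0).comp hlim) ?_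
  filter_upwards [hφ.tendsto_atTop.eventually hp] with m hm
  exact hm.1 x

/-- Flattening the cone by `1 - η` and raising `t` by `η * (σ + ‖a‖)`, where `a` is the translation
part, leaves the margin `η * σ * (1 + ‖x‖)`. The perturbed cone is then feasible along the tail, at
a small loss of value. -/
theorem recoverFeasible_lowner : RecoverFeasible (n := n) LownerFeas lownerVal := by
  intro F f hconv hF hf p hp v hv hvp
  have hdet : p.1.det ≠ 0 := by
    intro h0
    have : lownerVal p = 0 := by simp [lownerVal, h0]
    linarith
  obtain ⟨σ, hσ, hge⟩ := exists_norm_ge hdet p.2.1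
  set q : ℝ → Params n := fun η => ((1 - η) • p.1, (1 - η) • p.2.1, p.2.2 + η * (σ + ‖p.2.1‖))
    with hq
  have t1 : ∀ᶠ η : ℝ in 𝓝[>] 0, v < lownerVal (q η) := by
    have hcont : Continuous (fun η : ℝ => lownerVal (q η)) := by
      have : Continuous q := by fun_prop
      exact continuous_lownerVal.comp this
    have := (hcont.tendsto 0).mono_left (nhdsWithin_le_nhds (s := Set.Ioi 0))
    exact this.eventually (lt_mem_nhds (by simpa [hq] using hvp))
  have t2 : ∀ᶠ l : ℝ in 𝓝[>] 0, l ∈ Set.Ioo (0 : ℝ) 1 := Ioo_mem_nhdsGT one_pos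
  obtain ⟨η, hη, hη0, hη1⟩ := (t1.and t2).exists
  have h1 := hconv.eventually_le_exp hF hf (s := 1 - η) (by linarith) p.1 p.2.1 0
    (-(p.2.2 + η * (σ + ‖p.2.1‖))) (κ := η * σ) (by positivity) (fun x => by
      refine (hp x).trans (Real.exp_le_exp.2 ?_)
      have h2 := mul_le_mul_of_nonneg_left (hge x) hη0.le
      rw [inner_zero_left]
      linarith)
  filter_upwards [h1] with m hm
  refine ⟨q η, fun x => (hm x).trans_eq ?_, hη.le⟩
  have h3 : (q η).1 x + (q η).2.1 = (1 - η) • (p.1 x + p.2.1) := by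
    simp [hq]
  rw [h3, norm_smul, Real.norm_of_nonneg (by linarith), inner_zero_left]
  simp only [hq]
  congr 1
  ring

/-- The loss `(1 - s ^ 2) ^ n` is of second order in `s`, while the gain `exp (s * δ)` is of first
order unless `δ = 0`. -/
theorem eq_zero_of_pow_mul_exp_le {δ : ℝ} (hδ : 0 ≤ δ)
    (h : ∀ s : ℝ, 0 < s → s < 1 → (1 - s ^ 2) ^ n * Real.exp (s * δ) ≤ 1) : δ = 0 := by
  refine le_antisymm ?_ hδ
  have key : ∀ᶠ s : ℝ in 𝓝[>] 0, δ ≤ n * s * (1 + s * δ) := by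
    filter_upwards [Ioo_mem_nhdsGT one_pos] with s hs
    have h1 := h s hs.1 hs.2
    have h2 : 1 + (n : ℝ) * (-s ^ 2) ≤ (1 + (-s ^ 2)) ^ n :=
      one_add_mul_le_pow (by nlinarith [hs.1, hs.2]) n
    have h3 := Real.add_one_le_exp (s * δ)
    have h4 : 0 ≤ (1 - s ^ 2) ^ n := by
      have : s ^ 2 ≤ 1 := by nlinarith [hs.1, hs.2]
      exact pow_nonneg (by linarith) n
    have h5 : (1 - s ^ 2) ^ n * (1 + s * δ) ≤ 1 :=
      (mul_le_mul_of_nonneg_left (by linarith) h4).trans h1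
    have h6 : 0 ≤ 1 + s * δ := by have := mul_nonneg hs.1.le hδ; linarith
    have h7 : (1 - n * s ^ 2) * (1 + s * δ) ≤ 1 := by
      refine (mul_le_mul_of_nonneg_right ?_ h6).trans h5
      convert! h2 using 1
      ring
    have h8 : s * δ ≤ s * (n * s * (1 + s * δ)) := by linarith
    exact le_of_mul_le_mul_left h8 hs.1
  have hcont : Continuous (fun s : ℝ => n * s * (1 + s * δ)) := by fun_prop
  have hlim := (hcont.tendsto 0).mono_left (nhdsWithin_le_nhds (s := Set.Ioi 0))
  simpa using ge_of_tendsto hlim key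

/-- Averaging one solution with the other, rotated by `U`, is feasible by the triangle inequality.
Optimality and the determinant midpoint inequality force `U S' = S` and then `t = t'`. If the
centres still differed, a cone with a slightly contracted linear part and a lower `t` would do
better. -/
theorem lowner_unique (hf : IsLC f) {p q : Params n} (hp : IsOptimum LownerFeas lownerVal f p)
    (hq : IsOptimum LownerFeas lownerVal f q) : lownerFun p = lownerFun q := by
  obtain ⟨S, a, t⟩ := p
  obtain ⟨S', a', t'⟩ := q
  obtain ⟨hp1, hp2, hp3⟩ := hp
  obtain ⟨hq1, hq2, hq3⟩ := hq
  have hV : |S.det| * Real.exp (-t) = |S'.det| * Real.exp (-t') := le_antisymm (hq3 _ hp1) (hp3 _ hq1)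
  have hS : S.det ≠ 0 := fun h0 => by simp [lownerVal, h0] at hp2
  have hS' : S'.det ≠ 0 := fun h0 => by simp [lownerVal, h0] at hq2
  set e := LinearMap.equivOfDetNeZero (S : E n →ₗ[ℝ] E n) hS
  set e' := LinearMap.equivOfDetNeZero (S' : E n →ₗ[ℝ] E n) hS'
  have he : ∀ x, e x = S x := fun _ => rfl
  have he' : ∀ x, e' x = S' x := fun _ => rfl
  set M : E n ≃ₗ[ℝ] E n := e.symm.trans e' with hM
  have hMS : ∀ x, M (S x) = S' x := by
    intro x
    rw [hM, LinearEquiv.trans_apply, ← he, e.symm_apply_apply, he']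
  have hdetM : |LinearMap.det (M : E n →ₗ[ℝ] E n)| * |S.det| = |S'.det| := by
    rw [← abs_mul]
    change |LinearMap.det (M : E n →ₗ[ℝ] E n) * LinearMap.det (S : E n →ₗ[ℝ] E n)| = _
    rw [← LinearMap.det_comp]
    congr 2
    ext1 x
    exact hMS x
  obtain ⟨U, hU⟩ := exists_isometry_midpoint M
  set N : E n →ₗ[ℝ] E n := (1 / 2 : ℝ) • (LinearMap.id + (U.toLinearEquiv : E n →ₗ[ℝ] E n) ∘ₗ
    (M : E n →ₗ[ℝ] E n)) with hN
  have hNx : ∀ x, N (S x) = (1 / 2 : ℝ) • (S x + U (S' x)) := by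
    intro x
    rw [← hMS]
    rfl
  set c : E n := (1 / 2 : ℝ) • (a + U a') with hc
  have hmid : LownerFeas f ((LinearMap.toContinuousLinearMap N).comp S, c, (t + t') / 2) := by
    intro x
    rcases (hf.nonneg x).eq_or_lt with h0 | h0
    · rw [← h0]; positivity
    have h1 := (Real.log_le_iff_le_exp h0).2 (hp1 x)
    have h2 := (Real.log_le_iff_le_exp h0).2 (hq1 x)
    rw [← Real.log_le_iff_le_exp h0]
    have h3 : ((LinearMap.toContinuousLinearMap N).comp S) x + c =
        (1 / 2 : ℝ) • (S x + a) + (1 / 2 : ℝ) • U (S' x + a') := by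
      change N (S x) + c = _
      rw [hNx, hc, map_add]
      module
    have h4 : ‖((LinearMap.toContinuousLinearMap N).comp S) x + c‖ ≤
        1 / 2 * ‖S x + a‖ + 1 / 2 * ‖S' x + a'‖ := by
      rw [h3]
      refine (norm_add_le _ _).trans ?_
      rw [norm_smul, norm_smul, U.norm_map, Real.norm_of_nonneg (by norm_num)]
    simp only at h1 h2 ⊢
    linarith
  have hdetC : ((LinearMap.toContinuousLinearMap N).comp S).det = LinearMap.det N * S.det := by
    change LinearMap.det (N ∘ₗ (S : E n →ₗ[ℝ] E n)) = _
    rw [LinearMap.det_comp]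
  have hle := hp3 _ hmid
  unfold lownerVal at hle
  simp only at hle
  rw [hdetC, abs_mul] at hle
  have hUS : ∀ x, U (M x) = x := by
    refine hU ?_
    have hSp : 0 < |S.det| := abs_pos.2 hS
    -- The square of the common optimal value is written as the product of the two values, so that
    -- both determinants appear and the heights cancel.
    have h1 : (|LinearMap.det N| * |S.det| * Real.exp (-((t + t') / 2))) ^ 2 ≤
        (|S.det| * Real.exp (-t)) * (|S'.det| * Real.exp (-t')) := by
      rw [← hV, ← sq]
      gcongr
    have h2 : Real.exp (-((t + t') / 2)) ^ 2 = Real.exp (-t) * Real.exp (-t') := by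
      rw [← Real.exp_nat_mul, ← Real.exp_add]
      congr 1
      push_cast
      ring
    rw [← hdetM, mul_pow, mul_pow, h2, sq_abs, sq_abs] at h1
    have h3 : LinearMap.det N ^ 2 * (S.det ^ 2 * (Real.exp (-t) * Real.exp (-t'))) ≤
        |LinearMap.det (M : E n →ₗ[ℝ] E n)| *
          (S.det ^ 2 * (Real.exp (-t) * Real.exp (-t'))) := by
      rw [← sq_abs S.det] at h1 ⊢
      linarith
    exact le_of_mul_le_mul_right h3 (by positivity)
  have hUS' : ∀ x, U (S' x) = S x := fun x => by rw [← hMS, hUS]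
  have hdetS : |S'.det| = |S.det| := by
    have h1 : (U.toLinearEquiv : E n →ₗ[ℝ] E n) ∘ₗ (S' : E n →ₗ[ℝ] E n) = S := by
      ext1 x
      exact hUS' x
    have h2 := congrArg (fun T : E n →ₗ[ℝ] E n => |LinearMap.det T|) h1
    simp only [LinearMap.det_comp, abs_mul, abs_det_isometry, one_mul] at h2
    exact h2
  have htt : t = t' := by
    rw [hdetS] at hV
    have h1 := mul_left_cancel₀ (abs_pos.2 hS).ne' hV
    have := Real.exp_injective h1
    linarith
  subst htt
  set d : E n := (1 / 2 : ℝ) • (U a' - a) with hd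
  -- After the rotation both cones have linear part `S`, with translation parts `c - d` and `c + d`.
  have hfe : ∀ x, f x ≤ Real.exp (t - max ‖S x + c - d‖ ‖S x + c + d‖) := by
    intro x
    have h1 : S x + c - d = S x + a := by rw [hc, hd]; module
    have h2 : S x + c + d = U (S' x + a') := by rw [map_add, hUS', hc, hd]; module
    rw [h1, h2, U.norm_map]
    rcases max_choice ‖S x + a‖ ‖S' x + a'‖ with h | h <;> rw [h]
    · exact hp1 x
    · exact hq1 x
  have hd0 : ‖d‖ = 0 := by
    refine eq_zero_of_pow_mul_exp_le (n := n) (norm_nonneg d) fun s hs0 hs1 => ?_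
    set k := Real.sqrt (1 - s ^ 2) with hk
    have hs2 : 0 < 1 - s ^ 2 := by nlinarith
    have hk2 : k ^ 2 = 1 - s ^ 2 := Real.sq_sqrt hs2.le
    have hk0 : 0 < k := Real.sqrt_pos.2 hs2
    have hk1 : k ≤ 1 := by nlinarith
    -- As `k ^ 2 + s ^ 2 = 1`, Cauchy–Schwarz and the parallelogram identity bound `k * ‖y‖ + s *
    -- ‖d‖` by the larger of `‖y - d‖` and `‖y + d‖`.
    have hfeas : LownerFeas f (k • S, k • c, t - s * ‖d‖) := by
      intro x
      refine (hfe x).trans (Real.exp_le_exp.2 ?_)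
      have h1 : (k • S) x + k • c = k • (S x + c) := by
        rw [smul_apply, smul_add]
      simp only
      have hn : ‖k • (S x + c)‖ = k * ‖S x + c‖ := by
        rw [norm_smul, Real.norm_of_nonneg hk0.le]
      rw [h1, hn]
      set y := S x + c
      have hpar : ‖y + d‖ ^ 2 + ‖y - d‖ ^ 2 = 2 * (‖y‖ ^ 2 + ‖d‖ ^ 2) := by
        rw [norm_add_sq_real, norm_sub_sq_real]
        ring
      have hm1 : ‖y - d‖ ^ 2 ≤ max ‖y - d‖ ‖y + d‖ ^ 2 := by
        gcongr
        exact le_max_left _ _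
      have hm2 : ‖y + d‖ ^ 2 ≤ max ‖y - d‖ ‖y + d‖ ^ 2 := by
        gcongr
        exact le_max_right _ _
      have hcs : (k * ‖y‖ + s * ‖d‖) ^ 2 ≤ max ‖y - d‖ ‖y + d‖ ^ 2 := by
        have h3 : (k * ‖y‖ + s * ‖d‖) ^ 2 + (s * ‖y‖ - k * ‖d‖) ^ 2 =
            (k ^ 2 + s ^ 2) * (‖y‖ ^ 2 + ‖d‖ ^ 2) := by ring
        rw [hk2] at h3
        nlinarith [sq_nonneg (s * ‖y‖ - k * ‖d‖)]
      have := abs_le_of_sq_le_sq hcs (le_max_of_le_left (norm_nonneg _))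
      linarith [(le_abs_self _).trans this]
    have h1 := hp3 _ hfeas
    unfold lownerVal at h1
    simp only at h1
    have h2 : (k • S).det = k ^ n * S.det := by
      change LinearMap.det ((k • S : E n →L[ℝ] E n) : E n →ₗ[ℝ] E n) = _
      rw [ContinuousLinearMap.toLinearMap_smul, LinearMap.det_smul, finrank_euclideanSpace_fin]
    rw [h2, abs_mul, abs_of_pos (by positivity : 0 < k ^ n),
      show -(t - s * ‖d‖) = s * ‖d‖ + -t by ring, Real.exp_add] at h1
    have h3 : (k ^ n * Real.exp (s * ‖d‖)) * (|S.det| * Real.exp (-t)) ≤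
        1 * (|S.det| * Real.exp (-t)) := by linarith
    have h4 := le_of_mul_le_mul_right h3 (mul_pos (abs_pos.2 hS) (Real.exp_pos _))
    -- Here `1 - s ^ 2 = k ^ 2 ≤ k`, because `k ≤ 1`.
    refine le_trans ?_ h4
    gcongr
    rw [← hk2]
    nlinarith
  have hUa : U a' = a := by
    have h1 := norm_eq_zero.1 hd0
    rw [hd, smul_eq_zero] at h1
    exact sub_eq_zero.1 (h1.resolve_left (by norm_num))
  ext1 x
  unfold lownerFun
  simp only
  rw [← U.norm_map (S' x + a'), map_add, hUS', hUa]

theorem integral_exp_norm_pos : 0 < ∫ x : E n, Real.exp (-‖x‖) := by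
  have h1 : Integrable (fun x : E n => Real.exp (-‖x‖)) := by
    simpa using integrable_exp_decay (n := n) one_pos 0
  exact integral_exp_pos h1

theorem lowner_objective (A : E n ≃ᵃ[ℝ] E n) (t : ℝ) :
    ∫ x, Real.exp (-‖A x‖ + t) = (∫ x : E n, Real.exp (-‖x‖)) * (Real.exp t * (jac A)⁻¹) := by
  simp only [Real.exp_add]
  rw [integral_mul_const, integral_comp_affineEquiv A (fun x => Real.exp (-‖x‖)), smul_eq_mul]
  ring

theorem lowner_objective_le_iff (A B : E n ≃ᵃ[ℝ] E n) (t r : ℝ) :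
    ∫ x, Real.exp (-‖A x‖ + t) ≤ ∫ x, Real.exp (-‖B x‖ + r) ↔
      jac B * Real.exp (-r) ≤ jac A * Real.exp (-t) := by
  rw [lowner_objective, lowner_objective, mul_le_mul_iff_right₀ integral_exp_norm_pos,
    Real.exp_neg, Real.exp_neg, ← div_eq_mul_inv, ← div_eq_mul_inv, ← div_eq_mul_inv,
    ← div_eq_mul_inv, div_le_div_iff₀ (jac_pos A) (jac_pos B),
    div_le_div_iff₀ (Real.exp_pos _) (Real.exp_pos _)]
  constructor <;> intro h <;> linarith

theorem lownerFeasible_iff (A : E n ≃ᵃ[ℝ] E n) (t : ℝ) :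
    LownerFeasible f A t ↔ LownerFeas f (linPart A, A 0, t) := by
  refine forall_congr' fun x => ?_
  rw [coe_le_potential_iff, neg_sub, apply_eq_linPart]

/-- The objective is a constant divided by `lownerVal`, so minimizing one is maximizing the other.
Singular linear parts, which the parameter space allows, have value zero and do not compete. -/
theorem isLownerFunction_iff (h : E n → ℝ) :
    IsLownerFunction f h ↔ ∃ p, IsOptimum LownerFeas lownerVal f p ∧ h = lownerFun p := by
  have hfun : ∀ (A : E n ≃ᵃ[ℝ] E n) (t : ℝ),
      (fun x => Real.exp (-‖A x‖ + t)) = lownerFun (linPart A, A 0, t) := by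
    intro A t
    ext1 x
    unfold lownerFun
    simp only
    rw [← apply_eq_linPart]
    congr 1
    ring
  constructor
  · rintro ⟨A, t, h1, h2, rfl⟩
    refine ⟨(linPart A, A 0, t), ⟨(lownerFeasible_iff A t).1 h1, ?_, ?_⟩, hfun A t⟩
    · exact mul_pos (jac_pos A) (Real.exp_pos _)
    · rintro ⟨S, a, r⟩ hq
      by_cases hS : S.det = 0
      · unfold lownerVal
        rw [hS, abs_zero, zero_mul]
        positivity
      · obtain ⟨B, hB1, hB2, hB3⟩ := exists_affineEquiv hS a
        have hB0 : B 0 = a := by simpa using hB1 0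
        have h3 := h2 B r ((lownerFeasible_iff B r).2 (by rw [hB2, hB0]; exact hq))
        rw [lowner_objective_le_iff, hB3] at h3
        exact h3
  · rintro ⟨⟨S, a, t⟩, ⟨h1, h2, h3⟩, rfl⟩
    have hS : S.det ≠ 0 := fun h0 => by simp [lownerVal, h0] at h2
    obtain ⟨A, hA1, hA2, hA3⟩ := exists_affineEquiv hS a
    have hA0 : A 0 = a := by simpa using hA1 0
    refine ⟨A, t, (lownerFeasible_iff A t).2 (by rw [hA2, hA0]; exact h1), fun B r hB => ?_, ?_⟩
    · rw [lowner_objective_le_iff, hA3]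
      exact h3 _ ((lownerFeasible_iff B r).1 hB)
    · rw [hfun, hA2, hA0]

theorem IsLC.exists_isOptimum_lowner (hf : IsLC f) : ∃ p, IsOptimum LownerFeas lownerVal f p := by
  obtain ⟨p, h1, h2⟩ := hf.exists_lownerFeas
  exact compactFeasible_lowner.exists_isOptimum continuous_lownerVal hf h1 h2

theorem IsOptimum.lowner_isLC {p : Params n} (hp : IsOptimum LownerFeas lownerVal f p) :
    IsLC (lownerFun p) :=
  isLC_lownerFun fun h0 => by
    have := hp.2.1
    simp [lownerVal, h0] at this

/-- Optimal parameters are not unique, so their limit `q` may differ from `p0`, but by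
`lowner_unique` both describe the same function. -/
theorem AEConv.exists_subseq_lowner {F : ℕ → E n → ℝ} (hconv : AEConv F f)
    (hF : ∀ m, IsLC (F m)) (hf : IsLC f) {p : ℕ → Params n} {p0 : Params n}
    (hp : ∀ m, IsOptimum LownerFeas lownerVal (F m) (p m))
    (hp0 : IsOptimum LownerFeas lownerVal f p0) :
    ∃ φ : ℕ → ℕ, StrictMono φ ∧ AEConv (fun m => lownerFun (p (φ m))) (lownerFun p0) := by
  obtain ⟨q, φ, hφ, hlim, hq⟩ := compactFeasible_lowner.exists_subseq_isOptimum
    recoverFeasible_lowner continuous_lownerVal hconv hF hf hp hp0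
  refine ⟨φ, hφ, Eventually.of_forall fun x => ?_⟩
  rw [lowner_unique hf hp0 hq]
  have hc : Continuous (fun q : Params n => lownerFun q x) := by unfold lownerFun; fun_prop
  exact (hc.tendsto q).comp hlim

theorem LownerFeasible.comp {A : E n ≃ᵃ[ℝ] E n} {t : ℝ} (h : LownerFeasible f A t)
    (B : E n ≃ᵃ[ℝ] E n) : LownerFeasible (fun x => f (B x)) (B.trans A) t :=
  fun x => h (B x)

theorem IsLownerFunction.comp {h : E n → ℝ} (hh : IsLownerFunction f h) (A : E n ≃ᵃ[ℝ] E n) :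
    IsLownerFunction (fun x => f (A x)) (fun x => h (A x)) := by
  obtain ⟨B, t, h1, h2, rfl⟩ := hh
  refine ⟨A.trans B, t, h1.comp A, fun C r hC => ?_, rfl⟩
  have h3 := hC.comp A.symm
  simp only [AffineEquiv.apply_symm_apply] at h3
  have h4 := h2 _ r h3
  rw [lowner_objective_le_iff, jac_trans] at h4 ⊢
  have hj : jac A * jac A.symm = 1 := by
    rw [← jac_trans, AffineEquiv.self_trans_symm]
    simp [jac]
  calc jac C * Real.exp (-r) = jac A * (jac A.symm * jac C * Real.exp (-r)) := by
        rw [← mul_assoc, ← mul_assoc, hj, one_mul]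
    _ ≤ jac A * (jac B * Real.exp (-t)) :=
        mul_le_mul_of_nonneg_left h4 (jac_pos A).le
    _ = _ := by ring

end Lowner

/-! ### The John problem -/

/-- Feasibility for the John problem. -/
def JohnFeas {n : ℕ} (f : E n → ℝ) (p : Params n) : Prop :=
  ∀ y ∈ Metric.closedBall (0 : E n) 1, p.2.2 ≤ f (p.1 y + p.2.1)

/-- The value of the John problem. -/
noncomputable def johnVal {n : ℕ} (p : Params n) : ℝ := p.2.2 * |p.1.det|

/-- The function attached to the parameters of the John problem. -/
noncomputable def johnFun {n : ℕ} (p : Params n) : E n → ℝ :=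
  ((fun y => p.1 y + p.2.1) '' Metric.closedBall (0 : E n) 1).indicator (fun _ => p.2.2)

section John

variable {n : ℕ} {f : E n → ℝ}

theorem continuous_johnVal : Continuous (johnVal : Params n → ℝ) := by
  unfold johnVal
  have h1 : Continuous (fun p : Params n => p.1.det) :=
    ContinuousLinearMap.continuous_det.comp continuous_fst
  fun_prop

theorem pos_of_johnVal_pos {p : Params n} (h : 0 < johnVal p) : 0 < p.2.2 ∧ p.1.det ≠ 0 := by
  unfold johnVal at h
  have h1 : 0 < p.2.2 := pos_of_mul_pos_left h (abs_nonneg _)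
  refine ⟨h1, fun h0 => ?_⟩
  simp [h0] at h

theorem IsLC.exists_johnFeas (hf : IsLC f) : ∃ p, JohnFeas f p ∧ 0 < johnVal p := by
  obtain ⟨z, r, c, hr, hc, -, hball⟩ := hf.exists_ball_le
  refine ⟨((r / 2) • ContinuousLinearMap.id ℝ _, z, c), fun y hy => hball _ ?_, ?_⟩
  · rw [mem_closedBall_zero_iff] at hy
    have : ‖(r / 2) • y‖ ≤ r / 2 := by
      rw [norm_smul, Real.norm_of_nonneg (by positivity)]
      exact mul_le_of_le_one_right (by positivity) hy
    simp only [smul_apply, ContinuousLinearMap.id_apply, mem_ball_iff_norm, add_sub_cancel_right]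
    linarith
  · unfold johnVal
    have : ((r / 2) • ContinuousLinearMap.id ℝ (E n)).det ≠ 0 := by
      change LinearMap.det (((r / 2) • ContinuousLinearMap.id ℝ (E n) : E n →L[ℝ] E n) :
        E n →ₗ[ℝ] E n) ≠ 0
      rw [ContinuousLinearMap.toLinearMap_smul, LinearMap.det_smul, ContinuousLinearMap.coe_id,
        LinearMap.det_id, mul_one]
      positivity
    positivity

/-- Uniform decay gives `‖S y + a‖ ≤ τ / α` for `y` in the unit ball, with `τ = b - log t`. Hence
the value is at most a multiple of `τ ^ n * exp (-τ)`, and `τ` is bounded. Feasibility of the limit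
uses the upper bounds of `AEConv.eventually_gt` at moving points. -/
theorem compactFeasible_john : CompactFeasible (n := n) JohnFeas johnVal := by
  intro F f hconv hF hf p v hv hp
  obtain ⟨α, b, hα, -, hdecay⟩ := hconv.exists_decay hF hf
  set K : ℝ := Real.exp b * (1 / α) ^ n with hK
  have hKpos : 0 < K := by positivity
  set T : ℝ := K * (n + 1).factorial / v with hT
  have hbound : ∀ᶠ m in atTop, p m ∈ Metric.closedBall (0 : E n →L[ℝ] E n) (1 / α * T) ×ˢ
      (Metric.closedBall (0 : E n) (1 / α * T) ×ˢ Set.Icc (Real.exp (b - T)) (Real.exp b)) := by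
    filter_upwards [hp, hdecay] with m hm hmd
    obtain ⟨ht, -⟩ := pos_of_johnVal_pos (hv.trans_le hm.2)
    set S := (p m).1
    set a := (p m).2.1
    set t := (p m).2.2
    set τ := b - Real.log t with hτ
    have hS : ∀ y : E n, ‖y‖ ≤ 1 → ‖S y + a‖ ≤ 1 / α * τ := by
      intro y hy
      have h1 := (Real.log_le_iff_le_exp ht).2 ((hm.1 y (by simpa using hy)).trans (hmd _))
      change Real.log t ≤ b - α * ‖S y + a‖ at h1
      rw [one_div, le_inv_mul_iff₀ hα]
      linarith
    have ha : ‖a‖ ≤ 1 / α * τ := by simpa using hS 0 (by simp)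
    have hτ0 : 0 ≤ τ := by
      have := (norm_nonneg _).trans ha
      exact nonneg_of_mul_nonneg_right this (by positivity)
    have hSn : ‖S‖ ≤ 1 / α * τ := by
      refine ContinuousLinearMap.opNorm_le_of_unit_norm (by positivity) fun y hy => ?_
      have h1 := hS y hy.le
      have h2 := hS (-y) (by rw [norm_neg, hy])
      have h3 : (2 : ℝ) • S y = (S y + a) - (S (-y) + a) := by
        rw [map_neg]
        module
      have h4 : ‖(2 : ℝ) • S y‖ ≤ 1 / α * τ + 1 / α * τ := by
        rw [h3]
        exact (norm_sub_le _ _).trans (add_le_add h1 h2)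
      rw [norm_smul, Real.norm_of_nonneg (by norm_num)] at h4
      linarith
    have hte : t = Real.exp (b - τ) := by
      rw [hτ, sub_sub_cancel, Real.exp_log ht]
    have hval : v ≤ K * τ ^ n * Real.exp (-τ) := by
      refine hm.2.trans ?_
      unfold johnVal
      have h1 : |S.det| ≤ (1 / α * τ) ^ n := (abs_det_le_norm_pow S).trans (by gcongr)
      calc t * |S.det| ≤ t * (1 / α * τ) ^ n := by gcongr
        _ = _ := by
          rw [hK, mul_pow, hte, sub_eq_add_neg, Real.exp_add]
          ring
    have hτT : τ ≤ T := le_of_le_pow_mul_exp hτ0 hv hKpos.le hval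
    refine ⟨?_, ?_, ?_, ?_⟩
    · rw [mem_closedBall_zero_iff]
      exact hSn.trans (by gcongr)
    · rw [mem_closedBall_zero_iff]
      exact ha.trans (by gcongr)
    · change _ ≤ t
      rw [hte]
      gcongr
    · change t ≤ _
      rw [hte]
      gcongr
      linarith
  have hcomp : IsCompact (Metric.closedBall (0 : E n →L[ℝ] E n) (1 / α * T) ×ˢ
      (Metric.closedBall (0 : E n) (1 / α * T) ×ˢ Set.Icc (Real.exp (b - T)) (Real.exp b))) :=
    (isCompact_closedBall _ _).prod ((isCompact_closedBall _ _).prod isCompact_Icc)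
  obtain ⟨p0, -, φ, hφ, hlim⟩ := hcomp.tendsto_subseq' hbound.frequently
  refine ⟨p0, φ, hφ, hlim, fun y hy => ?_⟩
  by_contra! hlt
  obtain ⟨d, hd1, hd2⟩ := exists_between hlt
  have hc : Continuous (fun q : Params n => q.1 y + q.2.1) := by fun_prop
  have hc2 : Continuous (fun q : Params n => q.2.2) := by fun_prop
  have h1 : Tendsto (fun m => (φ m, (p (φ m)).1 y + (p (φ m)).2.1)) atTop
      (atTop ×ˢ 𝓝 (p0.1 y + p0.2.1)) :=
    hφ.tendsto_atTop.prodMk ((hc.tendsto p0).comp hlim)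
  have h2 := h1.eventually (hconv.eventually_gt hF hf hd1)
  have h3 := ((hc2.tendsto p0).comp hlim).eventually (lt_mem_nhds hd2)
  obtain ⟨m, hm1, hm2, hm3⟩ := (h2.and (h3.and (hφ.tendsto_atTop.eventually hp))).exists
  exact absurd (hm3.1 y hy) (not_le.2 (lt_trans hm1 hm2))

/-- Contracting the ellipsoid about its centre makes it a compact subset of the interior of the
support, and lowering the height makes the inequality strict. Locally uniform lower bounds then
apply on the whole ellipsoid. -/
theorem recoverFeasible_john : RecoverFeasible (n := n) JohnFeas johnVal := by
  intro F f hconv hF hf p hp v hv hvp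
  obtain ⟨ht, hdet⟩ := pos_of_johnVal_pos (hv.trans hvp)
  obtain ⟨A, hA, -, -⟩ := exists_affineEquiv hdet p.2.1
  set q : ℝ → Params n := fun η => ((1 - η) • p.1, p.2.1, (1 - η) * p.2.2) with hq
  have t1 : ∀ᶠ η : ℝ in 𝓝[>] 0, v < johnVal (q η) := by
    have hcont : Continuous (fun η : ℝ => johnVal (q η)) := by
      have : Continuous q := by fun_prop
      exact continuous_johnVal.comp this
    have := (hcont.tendsto 0).mono_left (nhdsWithin_le_nhds (s := Set.Ioi 0))
    exact this.eventually (lt_mem_nhds (by simpa [hq] using hvp))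
  have t2 : ∀ᶠ l : ℝ in 𝓝[>] 0, l ∈ Set.Ioo (0 : ℝ) 1 := Ioo_mem_nhdsGT one_pos
  obtain ⟨η, hη, hη0, hη1⟩ := (t1.and t2).exists
  set G : E n → E n := fun y => (q η).1 y + (q η).2.1 with hG
  have hGA : ∀ y, G y = A ((1 - η) • y) := fun y => by simp [hG, hq, hA]
  have hshrink : ∀ y ∈ Metric.closedBall (0 : E n) 1, (1 - η) • y ∈ Metric.ball (0 : E n) 1 := by
    intro y hy
    rw [mem_closedBall_zero_iff] at hy
    rw [mem_ball_zero_iff, norm_smul, Real.norm_of_nonneg (by linarith)]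
    nlinarith [norm_nonneg y]
  have hpt : ∀ y ∈ Metric.ball (0 : E n) 1, p.2.2 ≤ f (A y) := fun y hy => by
    rw [hA]
    exact hp y (Metric.ball_subset_closedBall hy)
  have hP : ∀ x ∈ G '' Metric.closedBall (0 : E n) 1, ∀ᶠ s : ℕ × E n in atTop ×ˢ 𝓝 x,
      (1 - η) * p.2.2 < F s.1 s.2 := by
    rintro _ ⟨y, hy, rfl⟩
    refine hconv.eventually_lt hF hf ?_ ?_
    · refine mem_interior.2 ⟨A.symm ⁻¹' Metric.ball 0 1, fun x hx => ?_,
        Metric.isOpen_ball.preimage (continuous_affineEquiv A.symm), ?_⟩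
      · have := hpt _ hx
        rw [A.apply_symm_apply] at this
        exact (ht.trans_le this).ne'
      · rw [Set.mem_preimage, hGA, A.symm_apply_apply]
        exact hshrink y hy
    · rw [hGA]
      refine lt_of_lt_of_le ?_ (hpt _ (hshrink y hy))
      nlinarith
  have hGc : Continuous G := by fun_prop
  have hKc : IsCompact (G '' Metric.closedBall (0 : E n) 1) :=
    (isCompact_closedBall _ _).image hGc
  have hall : ∀ᶠ s : ℕ × E n in atTop ×ˢ 𝓝ˢ (G '' Metric.closedBall (0 : E n) 1),
      (1 - η) * p.2.2 < F s.1 s.2 := by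
    rw [hKc.prod_nhdsSet_eq_biSup]
    simpa only [eventually_iSup] using hP
  filter_upwards [hall.curry] with m hm
  exact ⟨q η, fun y hy => (hm.self_of_nhdsSet _ ⟨y, hy, rfl⟩).le, hη.le⟩

/-- Averaging one ellipsoid with a reparametrization of the other by an isometry, at the geometric
mean of the heights, is feasible by log-concavity. As in the Löwner problem this identifies the
linear parts, up to the isometry, and the heights. If two translates of one ellipsoid are feasible
at the same height, their convex hull contains an ellipsoid of larger volume. -/
theorem john_unique (hf : IsLC f) {p q : Params n} (hp : IsOptimum JohnFeas johnVal f p)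
    (hq : IsOptimum JohnFeas johnVal f q) : johnFun p = johnFun q := by
  obtain ⟨ht, hS⟩ := pos_of_johnVal_pos hp.2.1
  obtain ⟨ht', hS'⟩ := pos_of_johnVal_pos hq.2.1
  obtain ⟨S, a, t⟩ := p
  obtain ⟨S', a', t'⟩ := q
  obtain ⟨hp1, hp2, hp3⟩ := hp
  obtain ⟨hq1, hq2, hq3⟩ := hq
  simp only at ht hS ht' hS'
  have hV : t * |S.det| = t' * |S'.det| := le_antisymm (hq3 _ hp1) (hp3 _ hq1)
  set e := LinearMap.equivOfDetNeZero (S : E n →ₗ[ℝ] E n) hS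
  set e' := LinearMap.equivOfDetNeZero (S' : E n →ₗ[ℝ] E n) hS'
  have he : ∀ x, e x = S x := fun _ => rfl
  have he' : ∀ x, e' x = S' x := fun _ => rfl
  set M : E n ≃ₗ[ℝ] E n := e'.trans e.symm with hM
  have hMS : ∀ x, S (M x) = S' x := by
    intro x
    rw [hM, LinearEquiv.trans_apply, ← he, e.apply_symm_apply, he']
  have hdetM : |S.det| * |LinearMap.det (M : E n →ₗ[ℝ] E n)| = |S'.det| := by
    rw [← abs_mul]
    change |LinearMap.det (S : E n →ₗ[ℝ] E n) * LinearMap.det (M : E n →ₗ[ℝ] E n)| = _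
    rw [← LinearMap.det_comp]
    congr 2
    ext1 x
    exact hMS x
  have hdetC : ∀ N : E n →ₗ[ℝ] E n,
      (S.comp (LinearMap.toContinuousLinearMap N)).det = S.det * LinearMap.det N := by
    intro N
    change LinearMap.det ((S : E n →ₗ[ℝ] E n) ∘ₗ N) = _
    rw [LinearMap.det_comp]
  obtain ⟨U, hU⟩ := exists_isometry_midpoint_right M
  set N : E n →ₗ[ℝ] E n := (1 / 2 : ℝ) • (LinearMap.id + (M : E n →ₗ[ℝ] E n) ∘ₗ
    (U.toLinearEquiv : E n →ₗ[ℝ] E n)) with hN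
  have hNx : ∀ x, S (N x) = (1 / 2 : ℝ) • (S x + S' (U x)) := by
    intro x
    have h1 : N x = (1 / 2 : ℝ) • (x + M (U x)) := rfl
    rw [h1, map_smul, map_add, hMS]
  have hUmem : ∀ y, y ∈ Metric.closedBall (0 : E n) 1 → U y ∈ Metric.closedBall (0 : E n) 1 := by
    intro y hy
    simpa using hy
  have hmid : JohnFeas f (S.comp (LinearMap.toContinuousLinearMap N), (1 / 2 : ℝ) • (a + a'),
      Real.exp ((1 / 2) * Real.log t + (1 / 2) * Real.log t')) := by
    intro y hy
    have h3 : (S.comp (LinearMap.toContinuousLinearMap N)) y + (1 / 2 : ℝ) • (a + a') =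
        (1 / 2 : ℝ) • (S y + a) + (1 / 2 : ℝ) • (S' (U y) + a') := by
      change S (N y) + _ = _
      rw [hNx]
      module
    simp only
    rw [h3]
    refine hf.logIneq _ _ _ _ _ _ (by norm_num) (by norm_num) (by norm_num) ?_ ?_
    · rw [Real.exp_log ht]
      exact hp1 y hy
    · rw [Real.exp_log ht']
      exact hq1 _ (hUmem y hy)
  have hle := hp3 _ hmid
  unfold johnVal at hle
  simp only at hle
  rw [hdetC, abs_mul] at hle
  have hMU : ∀ x, M (U x) = x := by
    refine hU ?_
    have hSp : 0 < |S.det| := abs_pos.2 hS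
    set τ := Real.exp ((1 / 2) * Real.log t + (1 / 2) * Real.log t') with hτ
    have h1 : (τ * (|S.det| * |LinearMap.det N|)) ^ 2 ≤ (t * |S.det|) * (t' * |S'.det|) := by
      rw [← hV, ← sq]
      gcongr
    have h2 : τ ^ 2 = t * t' := by
      rw [hτ, ← Real.exp_nat_mul, ← Real.exp_log ht, ← Real.exp_log ht', ← Real.exp_add]
      simp only [Real.log_exp]
      congr 1
      push_cast
      ring
    rw [← hdetM, mul_pow, mul_pow, h2, sq_abs (LinearMap.det N)] at h1
    have h3 : LinearMap.det N ^ 2 * (t * t' * |S.det| ^ 2) ≤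
        |LinearMap.det (M : E n →ₗ[ℝ] E n)| * (t * t' * |S.det| ^ 2) := by linarith
    exact le_of_mul_le_mul_right h3 (by positivity)
  have hUS : ∀ x, S' (U x) = S x := fun x => by rw [← hMS, hMU]
  have hUS' : ∀ x, S' x = S (U.symm x) := fun x => by rw [← hUS, U.apply_symm_apply]
  have hdetS : |S'.det| = |S.det| := by
    have h1 : (S' : E n →ₗ[ℝ] E n) ∘ₗ (U.toLinearEquiv : E n →ₗ[ℝ] E n) = S := by
      ext1 x
      exact hUS x
    have h2 := congrArg (fun T : E n →ₗ[ℝ] E n => |LinearMap.det T|) h1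
    simp only [LinearMap.det_comp, abs_mul, abs_det_isometry, mul_one] at h2
    exact h2
  have htt : t = t' := by
    rw [hdetS] at hV
    exact mul_right_cancel₀ (abs_pos.2 hS).ne' hV
  subst htt
  have haa : a = a' := by
    by_contra hne
    set d : E n := (1 / 2 : ℝ) • (a' - a) with hd
    have hd0 : d ≠ 0 := smul_ne_zero (by norm_num) (sub_ne_zero.2 (Ne.symm hne))
    set w : E n := e.symm d with hw
    have hw0 : w ≠ 0 := by
      rw [hw, Ne, LinearEquiv.map_eq_zero_iff]
      exact hd0
    have hSw : S w = d := by rw [← he, hw, e.apply_symm_apply]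
    have hwn : 0 < ‖w‖ := norm_pos_iff.2 hw0
    -- `R` stretches by the factor `1 + ‖w‖` along `w` and fixes its orthogonal complement. As `S w
    -- = d`, the new ellipsoid is elongated along the line of centres.
    set R : E n →ₗ[ℝ] E n :=
      LinearMap.transvection ((innerSL ℝ w : E n →L[ℝ] ℝ) : E n →ₗ[ℝ] ℝ) (‖w‖⁻¹ • w) with hR
    have hRx : ∀ y, R y = y + ⟪w, y⟫ • (‖w‖⁻¹ • w) := fun y => rfl
    have hRdet : LinearMap.det R = 1 + ‖w‖ := by
      rw [hR, LinearMap.transvection.det]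
      have h1 : ((innerSL ℝ w : E n →L[ℝ] ℝ) : E n →ₗ[ℝ] ℝ) (‖w‖⁻¹ • w) = ⟪w, ‖w‖⁻¹ • w⟫ := rfl
      rw [h1, inner_smul_right, real_inner_self_eq_norm_sq]
      field_simp
    have hfeas : JohnFeas f
        (S.comp (LinearMap.toContinuousLinearMap R), (1 / 2 : ℝ) • (a + a'), t) := by
      intro y hy
      set s := ‖w‖⁻¹ * ⟪w, y⟫ with hs
      have hs1 : |s| ≤ 1 := by
        rw [hs, abs_mul, abs_of_pos (inv_pos.2 hwn), inv_mul_le_iff₀ hwn]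
        rw [mem_closedBall_zero_iff] at hy
        exact (abs_real_inner_le_norm w y).trans (by gcongr)
      rw [abs_le] at hs1
      have h1 : t ≤ f (S y + a) := hp1 y hy
      have h2 : t ≤ f (S y + a') := by
        rw [← hUS]
        exact hq1 _ (hUmem y hy)
      have h3 := hf.logIneq.convex_superlevel ht h1 h2 (a := (1 - s) / 2) (b := (1 + s) / 2)
        (by linarith) (by linarith) (by ring)
      -- Since `|s| ≤ 1`, each point of the stretched ellipsoid is a convex combination of
      -- corresponding points of the two translates.
      have h4 : (S.comp (LinearMap.toContinuousLinearMap R)) y + (1 / 2 : ℝ) • (a + a') =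
          ((1 - s) / 2) • (S y + a) + ((1 + s) / 2) • (S y + a') := by
        change S (R y) + _ = _
        rw [hRx, map_add, map_smul, map_smul, hSw, smul_smul, mul_comm, ← hs, hd]
        module
      simp only
      rw [h4]
      exact h3
    have h1 := hp3 _ hfeas
    unfold johnVal at h1
    simp only at h1
    rw [hdetC, abs_mul, hRdet, abs_of_pos (by positivity : 0 < 1 + ‖w‖)] at h1
    have h2 : 0 < t * |S.det| := mul_pos ht (abs_pos.2 hS)
    nlinarith [mul_pos h2 hwn]
  subst haa
  unfold johnFun
  simp only
  congr 1
  ext x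
  constructor
  · rintro ⟨y, hy, rfl⟩
    exact ⟨U y, hUmem y hy, by simp only [hUS]⟩
  · rintro ⟨y, hy, rfl⟩
    exact ⟨U.symm y, by simpa using hy, by simp only [hUS']⟩

theorem isUnit_of_det_ne_zero {S : E n →L[ℝ] E n} (hS : S.det ≠ 0) : IsUnit S :=
  ⟨(LinearMap.equivOfDetNeZero (S : E n →ₗ[ℝ] E n) hS).toContinuousLinearEquiv.toUnit, rfl⟩

theorem mem_image_closedBall_iff {S : E n →L[ℝ] E n} (hS : S.det ≠ 0) (a x : E n) :
    x ∈ (fun y => S y + a) '' Metric.closedBall (0 : E n) 1 ↔ ‖Ring.inverse S (x - a)‖ ≤ 1 := by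
  have hu := isUnit_of_det_ne_zero hS
  have h1 : ∀ y, Ring.inverse S (S y) = y := fun y =>
    congrArg (fun T : E n →L[ℝ] E n => T y) (Ring.inverse_mul_cancel S hu)
  have h2 : ∀ y, S (Ring.inverse S y) = y := fun y =>
    congrArg (fun T : E n →L[ℝ] E n => T y) (Ring.mul_inverse_cancel S hu)
  constructor
  · rintro ⟨y, hy, rfl⟩
    simpa [h1] using hy
  · intro h
    exact ⟨_, mem_closedBall_zero_iff.2 h, by simp only [h2, sub_add_cancel]⟩

theorem ae_norm_inverse_ne {S : E n →L[ℝ] E n} (hS : S.det ≠ 0) (a : E n) :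
    ∀ᵐ x, ‖Ring.inverse S (x - a)‖ ≠ 1 := by
  obtain ⟨A, hA, -, -⟩ := exists_affineEquiv hS a
  have hAs : ∀ x, Ring.inverse S (x - a) = A.symm x := by
    intro x
    have h1 := hA (A.symm x)
    rw [A.apply_symm_apply] at h1
    conv_lhs => rw [h1, add_sub_cancel_right]
    exact congrArg (fun T : E n →L[ℝ] E n => T (A.symm x))
      (Ring.inverse_mul_cancel S (isUnit_of_det_ne_zero hS))
  have h0 : ∀ᵐ y ∂(Measure.map A.symm volume), ‖y‖ ≠ 1 := by
    rw [map_affineEquiv]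
    refine Measure.ae_smul_measure ?_ _
    have := Measure.addHaar_sphere_of_ne_zero (volume : Measure (E n)) 0 one_ne_zero
    filter_upwards [measure_eq_zero_iff_ae_notMem.1 this] with y hy
    simpa using hy
  filter_upwards [ae_of_ae_map (continuous_affineEquiv A.symm).measurable.aemeasurable h0] with x hx
  rwa [hAs]

theorem isLC_johnFun {p : Params n} (hp : 0 < johnVal p) : IsLC (johnFun p) := by
  obtain ⟨ht, hS⟩ := pos_of_johnVal_pos hp
  obtain ⟨S, a, t⟩ := p
  simp only at ht hS
  have hG : Continuous (fun y : E n => S y + a) := by fun_prop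
  have hK : IsCompact ((fun y : E n => S y + a) '' Metric.closedBall 0 1) :=
    (isCompact_closedBall _ _).image hG
  have hconv : Convex ℝ ((fun y : E n => S y + a) '' Metric.closedBall 0 1) := by
    have h1 := ((convex_closedBall (0 : E n) 1).linear_image (S : E n →ₗ[ℝ] E n)).vadd a
    convert! h1 using 1
    rw [← Set.image_vadd, Set.image_image]
    simp only [vadd_eq_add, ContinuousLinearMap.coe_coe, add_comm]
  obtain ⟨r, hr⟩ := isBounded_iff_forall_norm_le.1 hK.isBounded
  refine isLC_of_decay (a := 1) (b := Real.log t + r) (x := a) ?_ ?_ ?_ one_pos ?_ ?_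
  · exact fun x => Set.indicator_nonneg (fun _ _ => ht.le) x
  · intro x y s u c d hc hd hcd hx hy
    unfold johnFun at *
    simp only at hx hy ⊢
    by_cases hxm : x ∈ (fun y : E n => S y + a) '' Metric.closedBall 0 1
    · by_cases hym : y ∈ (fun y : E n => S y + a) '' Metric.closedBall 0 1
      · rw [Set.indicator_of_mem hxm, ← Real.le_log_iff_exp_le ht] at hx
        rw [Set.indicator_of_mem hym, ← Real.le_log_iff_exp_le ht] at hy
        rw [Set.indicator_of_mem (hconv hxm hym hc hd hcd), ← Real.le_log_iff_exp_le ht]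
        have h1 := mul_le_mul_of_nonneg_left hx hc
        have h2 := mul_le_mul_of_nonneg_left hy hd
        have h3 : Real.log t = c * Real.log t + d * Real.log t := by rw [← add_mul, hcd, one_mul]
        linarith
      · rw [Set.indicator_of_notMem hym] at hy
        exact absurd hy (not_le.2 (Real.exp_pos _))
    · rw [Set.indicator_of_notMem hxm] at hx
      exact absurd hx (not_le.2 (Real.exp_pos _))
  · exact hK.isClosed.upperSemicontinuous_indicator ht.le
  · intro x
    refine Set.indicator_le' (g := fun x => Real.exp (Real.log t + r - 1 * ‖x‖))
      (fun x hx => ?_) (fun x _ => (Real.exp_pos _).le) x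
    simp only
    rw [← Real.log_le_iff_le_exp ht]
    have := hr x hx
    linarith
  · have hc : Continuous (fun x => ‖Ring.inverse S (x - a)‖) := by fun_prop
    have : ∀ᶠ x in 𝓝 a, ‖Ring.inverse S (x - a)‖ < 1 :=
      hc.continuousAt.eventually (gt_mem_nhds (by simp))
    filter_upwards [this] with x hx
    unfold johnFun
    rw [Set.indicator_of_mem ((mem_image_closedBall_iff hS a x).2 hx.le)]
    exact ht

theorem tendsto_clm_apply {T : ℕ → E n →L[ℝ] E n} {T0 : E n →L[ℝ] E n} {y : ℕ → E n} {y0 : E n}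
    (hT : Tendsto T atTop (𝓝 T0)) (hy : Tendsto y atTop (𝓝 y0)) :
    Tendsto (fun m => T m (y m)) atTop (𝓝 (T0 y0)) :=
  ((isBoundedBilinearMap_apply (𝕜 := ℝ) (E := E n) (F := E n)).continuous.tendsto (T0, y0)).comp
    (hT.prodMk_nhds hy)

/-- Off the boundary of the limit ellipsoid, a null set, membership is a strict inequality for
`‖S⁻¹(x - a)‖` either way. This is stable because inversion is continuous at invertible maps. -/
theorem tendsto_johnFun {p : ℕ → Params n} {q : Params n} (hlim : Tendsto p atTop (𝓝 q))
    (hp : ∀ m, (p m).1.det ≠ 0) (hq : q.1.det ≠ 0) :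
    AEConv (fun m => johnFun (p m)) (johnFun q) := by
  filter_upwards [ae_norm_inverse_ne hq q.2.1] with x hx
  have h1 : Tendsto (fun m => (p m).1) atTop (𝓝 q.1) := (continuous_fst.tendsto q).comp hlim
  have h2 : Tendsto (fun m => x - (p m).2.1) atTop (𝓝 (x - q.2.1)) := by
    have hc : Continuous (fun q : Params n => x - q.2.1) := by fun_prop
    exact (hc.tendsto q).comp hlim
  have h3 : Tendsto (fun m => (p m).2.2) atTop (𝓝 q.2.2) := by
    have hc : Continuous (fun q : Params n => q.2.2) := by fun_prop
    exact (hc.tendsto q).comp hlim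
  obtain ⟨u, hu⟩ := isUnit_of_det_ne_zero hq
  have h4 : Tendsto (fun m => Ring.inverse (p m).1) atTop (𝓝 (Ring.inverse q.1)) := by
    have := NormedRing.inverse_continuousAt u
    rw [hu] at this
    exact this.tendsto.comp h1
  have h5 : Tendsto (fun m => ‖Ring.inverse (p m).1 (x - (p m).2.1)‖) atTop
      (𝓝 ‖Ring.inverse q.1 (x - q.2.1)‖) := (tendsto_clm_apply h4 h2).norm
  unfold johnFun
  rcases lt_or_gt_of_ne hx with h | h
  · rw [Set.indicator_of_mem ((mem_image_closedBall_iff hq _ _).2 h.le)]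
    refine h3.congr' ?_
    filter_upwards [h5.eventually (gt_mem_nhds h)] with m hm
    rw [Set.indicator_of_mem ((mem_image_closedBall_iff (hp m) _ _).2 hm.le)]
  · rw [Set.indicator_of_notMem fun h' => not_le.2 h ((mem_image_closedBall_iff hq _ _).1 h')]
    refine tendsto_const_nhds.congr' ?_
    filter_upwards [h5.eventually (lt_mem_nhds h)] with m hm
    rw [Set.indicator_of_notMem fun h' =>
      not_le.2 hm ((mem_image_closedBall_iff (hp m) _ _).1 h')]

/-- The constraint by the essential supremum is automatic: an inequality `t ≤ f` on an ellipsoid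
with interior holds on a set of positive measure. -/
theorem johnFeasible_iff (hf : IsLC f) (A : E n ≃ᵃ[ℝ] E n) (t : ℝ) :
    JohnFeasible f A t ↔ JohnFeas f (linPart A, A 0, t) := by
  unfold JohnFeas
  simp only [← apply_eq_linPart]
  constructor
  · rintro ⟨-, h⟩ y hy
    have := h (A y)
    rwa [ellipsoidFunction, Set.indicator_of_mem (Set.mem_image_of_mem A hy)] at this
  · intro h
    constructor
    · have h1 : A.symm ⁻¹' Metric.ball 0 1 ∈ 𝓝 (A 0) :=
        (Metric.isOpen_ball.preimage (continuous_affineEquiv A.symm)).mem_nhds (by simp)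
      have h2 := ae_le_eLpNormEssSup (f := f) (μ := (volume : Measure (E n)))
      obtain ⟨y, hy1, hy2⟩ := mem_closure_iff_nhds.1 (Measure.dense_of_ae h2 (A 0)) _ h1
      have h3 := h _ (Metric.ball_subset_closedBall hy1)
      rw [A.apply_symm_apply] at h3
      rw [eLpNorm_exponent_top]
      refine le_trans ?_ hy2
      rw [Real.enorm_of_nonneg (hf.nonneg y)]
      exact ENNReal.ofReal_le_ofReal h3
    · intro x
      unfold ellipsoidFunction
      by_cases hx : x ∈ A '' Metric.closedBall (0 : E n) 1
      · rw [Set.indicator_of_mem hx]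
        obtain ⟨y, hy, rfl⟩ := hx
        exact h y hy
      · rw [Set.indicator_of_notMem hx]
        exact hf.nonneg x

theorem ellipsoidFunction_eq (A : E n ≃ᵃ[ℝ] E n) (t : ℝ) :
    ellipsoidFunction A t = johnFun (linPart A, A 0, t) := by
  unfold ellipsoidFunction johnFun
  simp only [← apply_eq_linPart]

/-- The positivity demanded by `IsOptimum` comes from comparison with a small ball on which `f` is
bounded below. Singular linear parts have value zero. -/
theorem isJohnFunction_iff (hf : IsLC f) (h : E n → ℝ) :
    IsJohnFunction f h ↔ ∃ p, IsOptimum JohnFeas johnVal f p ∧ h = johnFun p := by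
  constructor
  · rintro ⟨A, t, h1, h2, rfl⟩
    have key : ∀ q, JohnFeas f q → q.1.det ≠ 0 → johnVal q ≤ johnVal (linPart A, A 0, t) := by
      rintro ⟨S, a, r⟩ hq hS
      simp only at hS
      obtain ⟨B, hB1, hB2, hB3⟩ := exists_affineEquiv hS a
      have hB0 : B 0 = a := by simpa using hB1 0
      have h3 := h2 B r ((johnFeasible_iff hf B r).2 (by rw [hB2, hB0]; exact hq))
      rw [← hB2]
      exact h3
    obtain ⟨p, hp, hp0⟩ := hf.exists_johnFeas
    have hpos := hp0.trans_le (key p hp (pos_of_johnVal_pos hp0).2)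
    refine ⟨(linPart A, A 0, t), ⟨(johnFeasible_iff hf A t).1 h1, hpos, fun q hq => ?_⟩,
      ellipsoidFunction_eq A t⟩
    by_cases hS : q.1.det = 0
    · refine le_trans ?_ hpos.le
      simp [johnVal, hS]
    · exact key q hq hS
  · rintro ⟨⟨S, a, t⟩, ⟨h1, h2, h3⟩, rfl⟩
    have hS : S.det ≠ 0 := (pos_of_johnVal_pos h2).2
    obtain ⟨A, hA1, hA2, hA3⟩ := exists_affineEquiv hS a
    have hA0 : A 0 = a := by simpa using hA1 0
    refine ⟨A, t, (johnFeasible_iff hf A t).2 (by rw [hA2, hA0]; exact h1), fun B r hB => ?_, ?_⟩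
    · have h4 := h3 _ ((johnFeasible_iff hf B r).1 hB)
      rw [← hA2] at h4
      exact h4
    · rw [ellipsoidFunction_eq, hA2, hA0]

theorem IsLC.exists_isOptimum_john (hf : IsLC f) : ∃ p, IsOptimum JohnFeas johnVal f p := by
  obtain ⟨p, h1, h2⟩ := hf.exists_johnFeas
  exact compactFeasible_john.exists_isOptimum continuous_johnVal hf h1 h2

theorem AEConv.exists_subseq_john {F : ℕ → E n → ℝ} (hconv : AEConv F f)
    (hF : ∀ m, IsLC (F m)) (hf : IsLC f) {p : ℕ → Params n} {p0 : Params n}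
    (hp : ∀ m, IsOptimum JohnFeas johnVal (F m) (p m))
    (hp0 : IsOptimum JohnFeas johnVal f p0) :
    ∃ φ : ℕ → ℕ, StrictMono φ ∧ AEConv (fun m => johnFun (p (φ m))) (johnFun p0) := by
  obtain ⟨q, φ, hφ, hlim, hq⟩ := compactFeasible_john.exists_subseq_isOptimum
    recoverFeasible_john continuous_johnVal hconv hF hf hp hp0
  refine ⟨φ, hφ, ?_⟩
  rw [john_unique hf hp0 hq]
  exact tendsto_johnFun hlim (fun m => (pos_of_johnVal_pos (hp _).2.1).2)
    (pos_of_johnVal_pos hq.2.1).2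

theorem ellipsoidFunction_trans (B A : E n ≃ᵃ[ℝ] E n) (t : ℝ) (x : E n) :
    ellipsoidFunction (B.trans A.symm) t x = ellipsoidFunction B t (A x) := by
  have h : x ∈ (B.trans A.symm) '' Metric.closedBall (0 : E n) 1 ↔
      A x ∈ B '' Metric.closedBall (0 : E n) 1 := by
    constructor
    · rintro ⟨y, hy, rfl⟩
      exact ⟨y, hy, by simp⟩
    · rintro ⟨y, hy, h⟩
      exact ⟨y, hy, by simp [h]⟩
  unfold ellipsoidFunction
  by_cases hx : x ∈ (B.trans A.symm) '' Metric.closedBall (0 : E n) 1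
  · rw [Set.indicator_of_mem hx, Set.indicator_of_mem (h.1 hx)]
  · rw [Set.indicator_of_notMem hx, Set.indicator_of_notMem fun h' => hx (h.2 h')]

theorem JohnFeasible.comp (hf : IsLC f) {B : E n ≃ᵃ[ℝ] E n} {t : ℝ} (h : JohnFeasible f B t)
    (A : E n ≃ᵃ[ℝ] E n) : JohnFeasible (fun x => f (A x)) (B.trans A.symm) t := by
  rw [johnFeasible_iff hf] at h
  rw [johnFeasible_iff (hf.comp_affine A)]
  intro y hy
  have := h y hy
  simp only [← apply_eq_linPart] at this ⊢
  simpa using this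

theorem IsJohnFunction.comp (hf : IsLC f) {h : E n → ℝ} (hh : IsJohnFunction f h)
    (A : E n ≃ᵃ[ℝ] E n) : IsJohnFunction (fun x => f (A x)) (fun x => h (A x)) := by
  obtain ⟨B, t, h1, h2, rfl⟩ := hh
  refine ⟨B.trans A.symm, t, h1.comp hf A, fun C r hC => ?_, ?_⟩
  · have h3 := hC.comp (hf.comp_affine A) A.symm
    simp only [AffineEquiv.apply_symm_apply] at h3
    have h4 := h2 _ r h3
    change r * jac (C.trans A.symm.symm) ≤ t * jac B at h4
    change r * jac C ≤ t * jac (B.trans A.symm)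
    rw [jac_trans] at h4 ⊢
    have hj : jac A * jac A.symm = 1 := by
      rw [← jac_trans, AffineEquiv.self_trans_symm]
      simp [jac]
    have h5 := mul_le_mul_of_nonneg_right h4 (jac_pos A.symm).le
    calc r * jac C = r * (jac C * jac A) * jac A.symm := by
          rw [mul_assoc, mul_assoc, hj, mul_one]
      _ ≤ t * jac B * jac A.symm := h5
      _ = _ := by ring
  · ext1 x
    exact (ellipsoidFunction_trans B A t x).symm

end John

/-! ### The operators and the resulting affine contravariant points -/

section Operators

variable {n : ℕ}

theorem L1Tendsto.exists_seq_aeConv {F : ℕ → LC n} {f : LC n} (h : L1Tendsto F f) :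
    ∃ φ : ℕ → ℕ, StrictMono φ ∧ AEConv (fun m => (F (φ m)).1) f.1 := by
  have hF : ∀ m, IsLC (F m).1 := fun m => (F m).2
  have hf : IsLC f.1 := f.2
  refine TendstoInMeasure.exists_seq_tendsto_ae (μ := (volume : Measure (E n)))
    (f := fun m => (F m).1) ?_
  refine tendstoInMeasure_of_tendsto_eLpNorm_of_ne_top one_ne_zero ENNReal.one_ne_top
    (fun m => (hF m).measurable.aestronglyMeasurable) hf.measurable.aestronglyMeasurable ?_
  have h1 : ∀ m, eLpNorm ((F m).1 - f.1) 1 volume =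
      ENNReal.ofReal (∫ x, |(F m).1 x - f.1 x|) := by
    intro m
    rw [eLpNorm_one_eq_lintegral_enorm,
      ← ofReal_integral_norm_eq_lintegral_enorm ((hF m).integrable.sub hf.integrable)]
    rfl
  simp only [h1]
  simpa using ENNReal.tendsto_ofReal h

/-- A sequence converges if each of its subsequences has a further subsequence with the same limit.
One extraction passes from the `L₁`-norm to almost everywhere convergence, the next is the
hypothesis. -/
theorem tendsto_of_exists_subseq {p : LC n → E n}
    (hp : ∀ (F : ℕ → LC n) (f : LC n), AEConv (fun m => (F m).1) f.1 →
      ∃ φ : ℕ → ℕ, Tendsto (fun m => p (F (φ m))) atTop (𝓝 (p f)))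
    {F : ℕ → LC n} {f : LC n} (h : L1Tendsto F f) :
    Tendsto (fun m => p (F m)) atTop (𝓝 (p f)) := by
  refine tendsto_of_subseq_tendsto fun ns hns => ?_
  have h1 : L1Tendsto (fun m => F (ns m)) f := h.comp hns
  obtain ⟨ms, -, hms⟩ := h1.exists_seq_aeConv
  obtain ⟨φ, hφ⟩ := hp (fun m => F (ns (ms m))) f hms
  exact ⟨fun m => ms (φ m), hφ⟩

/-- An operator on the class which commutes with affine maps and is continuous, along
subsequences, for almost everywhere convergence. -/
structure IsContinuousEquivariant (P : LC n → LC n) : Prop where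
  exists_subseq : ∀ (F : ℕ → LC n) (f : LC n), AEConv (fun m => (F m).1) f.1 →
    ∃ φ : ℕ → ℕ, StrictMono φ ∧ AEConv (fun m => (P (F (φ m))).1) (P f).1
  equivariant : ∀ (A : E n ≃ᵃ[ℝ] E n) (f : LC n), P (affineAct A f) = affineAct A (P f)

theorem IsContinuousEquivariant.centroid {P : LC n → LC n} (hP : IsContinuousEquivariant P) :
    IsAffineContravariantPoint (fun f => centroid (P f).1) where
  continuous F f h := by
    refine tendsto_of_exists_subseq (p := fun f => LogConcave.centroid (P f).1) ?_ h
    intro F f hconv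
    obtain ⟨φ, -, h1⟩ := hP.exists_subseq F f hconv
    exact ⟨φ, h1.tendsto_centroid (fun m => (P (F (φ m))).2) (P f).2⟩
  contravariant A f := by
    rw [hP.equivariant]
    exact IsLC.centroid_comp (P f).2 A

theorem IsContinuousEquivariant.santalo {P : LC n → LC n} (hP : IsContinuousEquivariant P)
    {s : LC n → E n} (hs : ∀ f : LC n, IsSantaloPoint f.1 (s f)) :
    IsAffineContravariantPoint (fun f => s (P f)) where
  continuous F f h := by
    refine tendsto_of_exists_subseq (p := fun f => s (P f)) ?_ h
    intro F f hconv
    obtain ⟨φ, -, h1⟩ := hP.exists_subseq F f hconv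
    obtain ⟨θ, -, h2⟩ := h1.exists_subseq_tendsto_santalo (fun m => (P (F (φ m))).2) (P f).2
      (fun m => hs _) (hs _)
    exact ⟨fun m => φ (θ m), h2⟩
  contravariant A f := by
    rw [hP.equivariant]
    have hf : IsLC (P f).1 := (P f).2
    exact (hf.comp_affine A).santaloPoint_unique (hs (affineAct A (P f)))
      (hf.santaloPoint_comp (hs (P f)) A)

theorem IsAffineContravariantPoint.affine_combination {p q : LC n → E n}
    (hp : IsAffineContravariantPoint p) (hq : IsAffineContravariantPoint q) (lam : ℝ) :
    IsAffineContravariantPoint (fun f => lam • p f + (1 - lam) • q f) where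
  continuous F f h :=
    ((hp.continuous F f h).const_smul lam).add ((hq.continuous F f h).const_smul (1 - lam))
  contravariant A f := by
    -- The coefficients sum to one, so the translation part of the inverse map is reproduced
    -- exactly.
    rw [hp.contravariant, hq.contravariant, affineEquiv_apply A.symm (p f),
      affineEquiv_apply A.symm (q f), affineEquiv_apply A.symm (_ + _), map_add, map_smul, map_smul]
    module

/-- The floating operator. -/
noncomputable def floatOp (δ : ℝ≥0) (f : LC n) : LC n :=
  ⟨floatFun f.1 (ENNReal.ofReal ((δ : ℝ) * ∫ x, f.1 x)),
    IsLC.isLC_floatFun f.2 ENNReal.ofReal_ne_top⟩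

theorem isContinuousEquivariant_floatOp (δ : ℝ≥0) :
    IsContinuousEquivariant (floatOp (n := n) δ) where
  exists_subseq F f h := by
    have hF : ∀ m, IsLC (F m).1 := fun m => (F m).2
    have hf : IsLC f.1 := f.2
    refine ⟨id, strictMono_id, h.floatFun hF hf ?_ ENNReal.ofReal_ne_top⟩
    exact ENNReal.tendsto_ofReal ((h.tendsto_integral hF hf).const_mul _)
  equivariant A f := by
    have hf : IsLC f.1 := f.2
    refine Subtype.ext (funext fun x => ?_)
    change floatFun (fun y => f.1 (A y)) (ENNReal.ofReal ((δ : ℝ) * ∫ y, f.1 (A y))) x = _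
    -- The threshold `δ ∫ f` scales by the same Jacobian factor as cap volumes.
    have h1 : ENNReal.ofReal ((δ : ℝ) * ∫ y, f.1 (A y)) =
        ENNReal.ofReal (jac A)⁻¹ * ENNReal.ofReal ((δ : ℝ) * ∫ y, f.1 y) := by
      rw [integral_comp_affineEquiv, smul_eq_mul,
        ← ENNReal.ofReal_mul (inv_nonneg.2 (jac_pos A).le)]
      congr 1
      ring
    rw [h1]
    exact hf.floatFun_comp A _ x

/-- The solution of the Löwner problem. -/
noncomputable def lownerParams (f : LC n) : Params n :=
  (IsLC.exists_isOptimum_lowner f.2).choose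

theorem isOptimum_lownerParams (f : LC n) :
    IsOptimum LownerFeas lownerVal f.1 (lownerParams f) :=
  (IsLC.exists_isOptimum_lowner f.2).choose_spec

/-- The Löwner operator. -/
noncomputable def lownerOp (f : LC n) : LC n :=
  ⟨lownerFun (lownerParams f), (isOptimum_lownerParams f).lowner_isLC⟩

theorem isLownerFunction_iff_eq (f : LC n) (h : E n → ℝ) :
    IsLownerFunction f.1 h ↔ h = (lownerOp f).1 := by
  rw [isLownerFunction_iff]
  constructor
  · rintro ⟨p, hp, rfl⟩
    exact lowner_unique f.2 hp (isOptimum_lownerParams f)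
  · rintro rfl
    exact ⟨_, isOptimum_lownerParams f, rfl⟩

/-- The parameters were chosen arbitrarily for each function, but the Löwner function does not
depend on the choice, so equivariance of the extremal problem suffices. -/
theorem lownerOp_affineAct (A : E n ≃ᵃ[ℝ] E n) (f : LC n) :
    lownerOp (affineAct A f) = affineAct A (lownerOp f) := by
  have h1 : IsLownerFunction f.1 (lownerOp f).1 := (isLownerFunction_iff_eq f _).2 rfl
  have h2 : IsLownerFunction (affineAct A f).1 (affineAct A (lownerOp f)).1 := h1.comp A
  exact Subtype.ext ((isLownerFunction_iff_eq _ _).1 h2).symm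

theorem isContinuousEquivariant_lownerOp : IsContinuousEquivariant (lownerOp (n := n)) where
  exists_subseq F f h := by
    have hF : ∀ m, IsLC (F m).1 := fun m => (F m).2
    exact h.exists_subseq_lowner hF f.2 (p := fun m => lownerParams (F m))
      (fun m => isOptimum_lownerParams (F m)) (isOptimum_lownerParams f)
  equivariant := lownerOp_affineAct

/-- The solution of the John problem. -/
noncomputable def johnParams (f : LC n) : Params n :=
  (IsLC.exists_isOptimum_john f.2).choose

theorem isOptimum_johnParams (f : LC n) : IsOptimum JohnFeas johnVal f.1 (johnParams f) :=
  (IsLC.exists_isOptimum_john f.2).choose_spec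

/-- The John operator. -/
noncomputable def johnOp (f : LC n) : LC n :=
  ⟨johnFun (johnParams f), isLC_johnFun (isOptimum_johnParams f).2.1⟩

theorem isJohnFunction_iff_eq (f : LC n) (h : E n → ℝ) :
    IsJohnFunction f.1 h ↔ h = (johnOp f).1 := by
  rw [isJohnFunction_iff f.2]
  constructor
  · rintro ⟨p, hp, rfl⟩
    exact john_unique f.2 hp (isOptimum_johnParams f)
  · rintro rfl
    exact ⟨_, isOptimum_johnParams f, rfl⟩

theorem johnOp_affineAct (A : E n ≃ᵃ[ℝ] E n) (f : LC n) :
    johnOp (affineAct A f) = affineAct A (johnOp f) := by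
  have h1 : IsJohnFunction f.1 (johnOp f).1 := (isJohnFunction_iff_eq f _).2 rfl
  have h2 : IsJohnFunction (affineAct A f).1 (affineAct A (johnOp f)).1 := h1.comp f.2 A
  exact Subtype.ext ((isJohnFunction_iff_eq _ _).1 h2).symm

theorem isContinuousEquivariant_johnOp : IsContinuousEquivariant (johnOp (n := n)) where
  exists_subseq F f h := by
    have hF : ∀ m, IsLC (F m).1 := fun m => (F m).2
    exact h.exists_subseq_john hF f.2 (p := fun m => johnParams (F m))
      (fun m => isOptimum_johnParams (F m)) (isOptimum_johnParams f)
  equivariant := johnOp_affineAct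

end Operators

end LogConcave

theorem corollary4p4 (n : ℕ) :
    ∃ (s : LogConcave.LC n → LogConcave.E n)
      (F : ℝ≥0 → LogConcave.LC n → LogConcave.LC n)
      (L J : LogConcave.LC n → LogConcave.LC n),
      -- the centroid is well defined on the class
      (∀ f : LogConcave.LC n, 0 < ∫ x, f.1 x) ∧
      (∀ f : LogConcave.LC n, Integrable (fun x => f.1 x • x)) ∧
      -- `s` is the Santaló point: the unique minimizer
      (∀ (f : LogConcave.LC n) (z : LogConcave.E n),
        LogConcave.IsSantaloPoint f.1 z ↔ z = s f) ∧
      -- `F δ`, `L`, `J` are the floating, Löwner and John operators: each of these functions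
      -- exists, is unique, and lies in the class
      (∀ (δ : ℝ≥0) (f : LogConcave.LC n) (h : LogConcave.E n → ℝ),
        LogConcave.IsFloatingFunction δ f.1 h ↔ h = (F δ f).1) ∧
      (∀ (f : LogConcave.LC n) (h : LogConcave.E n → ℝ),
        LogConcave.IsLownerFunction f.1 h ↔ h = (L f).1) ∧
      (∀ (f : LogConcave.LC n) (h : LogConcave.E n → ℝ),
        LogConcave.IsJohnFunction f.1 h ↔ h = (J f).1) ∧
      ∀ P : LogConcave.LC n → LogConcave.LC n, ((∃ δ : ℝ≥0, P = F δ) ∨ P = L ∨ P = J) →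
        ∀ lam : ℝ,
          LogConcave.IsAffineContravariantPoint (fun f => LogConcave.centroid (P f).1) ∧
          LogConcave.IsAffineContravariantPoint (fun f => s (P f)) ∧
          LogConcave.IsAffineContravariantPoint
            (fun f => lam • LogConcave.centroid (P f).1 + (1 - lam) • s (P f)) := by
  choose s hs using fun f : LogConcave.LC n => LogConcave.IsLC.exists_santaloPoint f.2
  refine ⟨s, LogConcave.floatOp, LogConcave.lownerOp, LogConcave.johnOp,
    fun f => LogConcave.IsLC.integral_pos f.2, fun f => LogConcave.IsLC.integrable_smul f.2,
    fun f z => ⟨fun hz => LogConcave.IsLC.santaloPoint_unique f.2 hz (hs f), ?_⟩,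
    fun δ f h => LogConcave.IsLC.isFloatingFunction_iff f.2 δ h,
    LogConcave.isLownerFunction_iff_eq, LogConcave.isJohnFunction_iff_eq, ?_⟩
  · rintro rfl
    exact hs f
  · intro P hP lam
    have h : LogConcave.IsContinuousEquivariant P := by
      rcases hP with ⟨δ, rfl⟩ | rfl | rfl
      · exact LogConcave.isContinuousEquivariant_floatOp δ
      · exact LogConcave.isContinuousEquivariant_lownerOp
      · exact LogConcave.isContinuousEquivariant_johnOp
    exact ⟨h.centroid, h.santalo hs, h.centroid.affine_combination (h.santalo hs) lam⟩
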